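/- **Setting.** Let $\Phi=F+r$ on $\mathbb R^d$, with $r:\mathbb R^d\to\mathbb R$ convex and $\Phi^*=\inf\Phi>-\infty$, where either $(\Sigma^2)$: $F(x)=\frac1N\sum_{k=1}^N f_k\big(\frac1n\sum_{i=1}^n g_i(x)\big)$, or $(\mathbb E^2)$: $F(x)=\mathbb E_\eta f_\eta\big(\mathbb E_\xi g_\xi(x)\big)$. All $f_\eta:\mathbb R^p\to\mathbb R$ and $g_\xi:\mathbb R^d\to\mathbb R^p$ are differentiable; $f_\eta$ is $l_f$-Lipschitz, $\nabla f_\eta$ is $L_f$-Lipschitz, $g_\xi$ is $l_g$-Lipschitz, and the Jacobian $g_\xi'$ is $L_g$-Lipschitz in Frobenius norm. Put $L_F=l_g^2L_f+l_fL_g$. For $(\mathbb E^2)$, with $g=\mathbb E_\xi g_\xi$ and $f=\mathbb E_\eta f_\eta$ (these expectations existing), also $\mathbb E\|g_\xi(x)-g(x)\|^2\le\sigma_g^2$, $\mathbb E\|g'_\xi(x)-g'(x)\|_F^2\le\sigma_{g'}^2$ and $\mathbb E\|\nabla f_\eta(y)-\nabla f(y)\|^2\le\sigma_{f'}^2$ for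 all $x,y$, where $\sigma_g,\sigma_{g'},\sigma_{f'}>0$. Let $\mathrm{prox}_{\lambda r}(x)=\arg\min_u\{r(u)+\frac1{2\lambda}\|u-x\|^2\}$ and $\mathcal G_\lambda(x)=\frac1\lambda\big(x-\mathrm{prox}_{\lambda r}(x-\lambda\nabla F(x))\big)$. **Algorithm (MVRC-2).** Given $x_0$, $T$, $\tau$, $\epsilon,\beta,\lambda_t>0$ and $\alpha_t=\frac2{t+1}$, set $y_0=x_0$. For $t=0,\dots,T-1$ let $z_t=(1-\alpha_{t+1})y_t+\alpha_{t+1}x_t$ and take minibatches $\mathcal A_t,\mathcal A'_t$ (of $\xi$'s) and $\mathcal B_t$ (of $\eta$'s). If $\tau\mid t$, let $\tilde g_t,\tilde g_t',\tilde f_t'$ be the averages of $g_\xi(z_t)$ over $\mathcal A_t$, of $g'_\xi(z_t)$ over $\mathcal A'_t$, and of $\nabla f_\eta(\tilde g_t)$ over $\mathcal B_t$. Otherwise let $\tilde g_t=\tilde g_{t-1}+\frac1{|\mathcal A_t|}\sum_{\mathcal A_t}(g_\xi(z_t)-g_\xi(z_{t-1}))$, $\tilde g'_t=\tilde g'_{t-1}+\frac1{|\mathcal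 A'_t|}\sum_{\mathcal A'_t}(g'_\xi(z_t)-g'_\xi(z_{t-1}))$, $\tilde f'_t=\tilde f'_{t-1}+\frac1{|\mathcal B_t|}\sum_{\mathcal B_t}(\nabla f_\eta(\tilde g_t)-\nabla f_\eta(\tilde g_{t-1}))$. Then $\tilde x_{t+1}=\mathrm{prox}_{\lambda_t r}(x_t-\lambda_t\tilde g_t'^\top\tilde f_t')$, $x_{t+1}=(1-\theta_t)x_t+\theta_t\tilde x_{t+1}$ with $\theta_t=\min\{\epsilon\lambda_t/\|\tilde x_{t+1}-x_t\|,\frac12\}$, and $y_{t+1}=z_t+\frac\beta{\lambda_t}(x_{t+1}-x_t)$. **Restart.** MVRC-2 is run $M$ times with sequences $x_{t,m},y_{t,m},z_{t,m}$, the first run from a given $x_{0,1}$ and $x_{0,m+1}=x_{T-1,m}$ for $1\le m<M$. The output is $z_{\zeta,\delta}$, with $\zeta$ uniform on $\{0,\dots,T-1\}$ and $\delta$ uniform on $\{1,\dots,M\}$, independent of each other and of all samples. **Hyperparameters.** Fix $C\ge1$. For an integer $X\ge 0$ write $k\asymp_C X$ if $k\ge1$ is an integer with $X\le Ck$ and $k\le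 C\max(X,1)$. Let $\beta>0$, $\beta L_F\le C$ and $\beta\le\lambda_t\le(1+\alpha_t)\beta$ for all $t$. * $(\Sigma^2)$: $\tau=\lfloor\sqrt{\max\{N,n\}}\rfloor$; if $\tau\mid t$ the minibatches are the full index sets; otherwise $|\mathcal A_t|,|\mathcal A'_t|,|\mathcal B_t|\asymp_C\tau$, sampled uniformly and independently, either all with replacement or all without replacement. Assume $0<\epsilon<l_fl_g\max\{N,n\}^{-1/2}$. * $(\mathbb E^2)$: $\tau=\lfloor l_fl_g/\epsilon\rfloor$ and all samples are i.i.d.; if $\tau\mid t$ then $|\mathcal A_t|\asymp_C\lceil L_f^2l_g^2\sigma_g^2\epsilon^{-2}\rceil$, $|\mathcal A'_t|\asymp_C\lceil l_f^2\sigma_{g'}^2\epsilon^{-2}\rceil$, $|\mathcal B_t|\asymp_C\lceil l_g^2\sigma_{f'}^2\epsilon^{-2}\rceil$; otherwise all three sizes are $\asymp_C\tau$. Assume $0<\epsilon\le l_fl_g$. **Theorem.** For every $C\ge1$ there is a constant $K\ge1$, depending only on $C$, such that the following holds for both problems. 1. (Rate) For all $M\ge1$ and $T\ge2$, $$\mathbb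 E\|\mathcal G_{\lambda_\zeta}(z_{\zeta,\delta})\|\le K\Big(\epsilon+\frac{\Phi(x_{0,1})-\Phi^*}{\beta\,\epsilon MT}\Big).$$ 2. (Sample complexity) For all $l_f,L_f,l_g,L_g,\beta,\Delta$ (and $\sigma_g,\sigma_{g'},\sigma_{f'}$ for $(\mathbb E^2)$) there are $s,K_1>0$, depending only on these and $C$, such that for every problem with $\Phi(x_{0,1})-\Phi^*\le\Delta$ and every target accuracy $\epsilon$ with $0<\epsilon<l_fl_g\max\{N,n\}^{-1/2}$ for $(\Sigma^2)$, $0<\epsilon\le l_fl_g$ for $(\mathbb E^2)$: running the restarted algorithm with $\epsilon/K$ in place of $\epsilon$ and $M=T=\lceil s/\epsilon\rceil$ gives $\mathbb E\|\mathcal G_{\lambda_\zeta}(z_{\zeta,\delta})\|\le\epsilon$, and the total number of evaluations of sample values of $g,g',\nabla f$ is at most $K_1\big(N+n+\sqrt{\max\{N,n\}}\,\epsilon^{-2}\big)$ for $(\Sigma^2)$ and at most $K_1\epsilon^{-3}$ for $(\mathbb E^2)$. -/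

import Mathlib

open MeasureTheory ProbabilityTheory
open scoped NNReal

universe u v w

noncomputable section

namespace MVRC

abbrev Vec (d : ℕ) := EuclideanSpace ℝ (Fin d)

/-- Frobenius (Hilbert--Schmidt) norm of a Jacobian. -/
def frobNorm {d p : ℕ} (A : Vec d →L[ℝ] Vec p) : ℝ :=
  Real.sqrt (∑ i : Fin d, ‖A (EuclideanSpace.single i (1 : ℝ))‖ ^ 2)

/-- Proximal mapping `argmin_y r(y) + ‖y - x‖² / (2 lam)`. For convex `r` and `lam > 0` the
minimizer exists and is unique. -/
def prox {d : ℕ} (lam : ℝ) (r : Vec d → ℝ) (x : Vec d) : Vec d :=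
  Classical.epsilon fun y =>
    IsMinOn (fun u : Vec d => r u + 1 / (2 * lam) * ‖u - x‖ ^ 2) Set.univ y

/-- Generalized gradient mapping of `F + r` at `x` with parameter `lam`. -/
def gradMap {d : ℕ} (lam : ℝ) (F r : Vec d → ℝ) (x : Vec d) : Vec d :=
  (1 / lam) • (x - prox lam r (x - lam • gradient F x))

/-! ### Composition problems -/

/-- Sample functions `f η`, sample mappings `g ξ` and the regularizer `r`. -/
structure Problem (Ξ : Type u) (H : Type v) (d p : ℕ) where
  f : H → Vec p → ℝ
  g : Ξ → Vec d → Vec p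
  r : Vec d → ℝ

/-- `F(x) = (1/N) ∑ₖ fₖ((1/n) ∑ᵢ gᵢ(x))`. -/
def Problem.sumF {N n d p : ℕ} (P : Problem (Fin n) (Fin N) d p) (x : Vec d) : ℝ :=
  (N : ℝ)⁻¹ * ∑ k, P.f k ((n : ℝ)⁻¹ • ∑ i, P.g i x)

section Online

variable {Ξ : Type u} {H : Type v} [MeasurableSpace Ξ] [MeasurableSpace H] {d p : ℕ}

/-- `f(y) = 𝔼_η f_η(y)`. -/
def Problem.meanf (P : Problem Ξ H d p) (Q : Measure H) (y : Vec p) : ℝ :=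
  ∫ η, P.f η y ∂Q

/-- `g(x) = 𝔼_ξ g_ξ(x)`. -/
def Problem.meang (P : Problem Ξ H d p) (D : Measure Ξ) (x : Vec d) : Vec p :=
  ∫ ξ, P.g ξ x ∂D

/-- `F(x) = 𝔼_η f_η(𝔼_ξ g_ξ(x))`. -/
def Problem.onlineF (P : Problem Ξ H d p) (D : Measure Ξ) (Q : Measure H) (x : Vec d) : ℝ :=
  P.meanf Q (P.meang D x)

/-- The expectations defining the online problem make sense, and the sample values of `g`, of its
Jacobian (in Frobenius norm) and of `∇f` have variances at most `σg²`, `σJ²`, `σf²`. -/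
structure Problem.BoundedVariance (P : Problem Ξ H d p) (D : Measure Ξ) (Q : Measure H)
    (σg σJ σf : ℝ) : Prop where
  f_meas : ∀ y, Measurable fun η => P.f η y
  g_meas : ∀ x, Measurable fun ξ => P.g ξ x
  f_int : ∀ y, Integrable (fun η => P.f η y) Q
  g_int : ∀ x, Integrable (fun ξ => P.g ξ x) D
  σg_pos : 0 < σg
  σJ_pos : 0 < σJ
  σf_pos : 0 < σf
  g_var_int : ∀ x, Integrable (fun ξ => ‖P.g ξ x - P.meang D x‖ ^ 2) D
  g_var : ∀ x, ∫ ξ, ‖P.g ξ x - P.meang D x‖ ^ 2 ∂D ≤ σg ^ 2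
  jac_var_int : ∀ x,
    Integrable (fun ξ => frobNorm (fderiv ℝ (P.g ξ) x - fderiv ℝ (P.meang D) x) ^ 2) D
  jac_var : ∀ x,
    ∫ ξ, frobNorm (fderiv ℝ (P.g ξ) x - fderiv ℝ (P.meang D) x) ^ 2 ∂D ≤ σJ ^ 2
  f_var_int : ∀ y, Integrable (fun η => ‖gradient (P.f η) y - gradient (P.meanf Q) y‖ ^ 2) Q
  f_var : ∀ y, ∫ η, ‖gradient (P.f η) y - gradient (P.meanf Q) y‖ ^ 2 ∂Q ≤ σf ^ 2

end Online

/-- The objective `Φ = F + r`. -/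
def Problem.obj {Ξ : Type u} {H : Type v} {d p : ℕ} (P : Problem Ξ H d p) (F : Vec d → ℝ)
    (x : Vec d) : ℝ :=
  F x + P.r x

/-- Standing assumptions: Lipschitz sample functions with Lipschitz derivatives, convex
regularizer, objective bounded below. -/
structure Problem.Regular {Ξ : Type u} {H : Type v} {d p : ℕ} (P : Problem Ξ H d p)
    (F : Vec d → ℝ) (lf Lf lg Lg : ℝ≥0) : Prop where
  f_diff : ∀ η, Differentiable ℝ (P.f η)
  f_lip : ∀ η, LipschitzWith lf (P.f η)
  f_grad_lip : ∀ η, LipschitzWith Lf (gradient (P.f η))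
  g_diff : ∀ ξ, Differentiable ℝ (P.g ξ)
  g_lip : ∀ ξ, LipschitzWith lg (P.g ξ)
  g_jac_lip : ∀ ξ x y, frobNorm (fderiv ℝ (P.g ξ) x - fderiv ℝ (P.g ξ) y) ≤ Lg * ‖x - y‖
  r_convex : ConvexOn ℝ Set.univ P.r
  obj_bdd : BddBelow (Set.range (P.obj F))

/-- The Lipschitz constant `L_F = l_g² L_f + l_f L_g` of `∇F`. -/
def LF (lf Lf lg Lg : ℝ≥0) : ℝ := lg ^ 2 * Lf + lf * Lg

/-! ### The algorithm -/

/-- A minibatch: a finite tuple of samples. -/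
abbrev Batch (Ξ : Type u) := Σ k : ℕ, Fin k → Ξ

/-- Average of `h` over a minibatch. -/
def Batch.avg {Ξ : Type u} {V : Type v} [AddCommGroup V] [Module ℝ V] (b : Batch Ξ)
    (h : Ξ → V) : V :=
  (b.1 : ℝ)⁻¹ • ∑ i, h (b.2 i)

/-- The three minibatches of one iteration: for `g`, for the Jacobian of `g`, and for `∇f`. -/
structure Batches (Ξ : Type u) (H : Type v) where
  A : Batch Ξ
  AJ : Batch Ξ
  B : Batch H

/-- Number of samples in the three minibatches. -/
def Batches.size {Ξ : Type u} {H : Type v} (b : Batches Ξ H) : ℕ := b.A.1 + b.AJ.1 + b.B.1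

/-- Memory of the algorithm at the start of iteration `t`: `x_t`, `y_t`, and from iteration
`t - 1` the point `z` and the estimators of `g(z)`, of the Jacobian and of `∇f`. -/
structure State (d p : ℕ) where
  x : Vec d
  y : Vec d
  z : Vec d
  gEst : Vec p
  jEst : Vec d →L[ℝ] Vec p
  fEst : Vec p

/-- Momentum coefficient `α_t = 2 / (t + 1)`. -/
def alpha (t : ℕ) : ℝ := 2 / ((t : ℝ) + 1)

/-- `z_t = (1 - α_{t+1}) y_t + α_{t+1} x_t`. -/
def zPoint {d p : ℕ} (t : ℕ) (s : State d p) : Vec d :=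
  (1 - alpha (t + 1)) • s.y + alpha (t + 1) • s.x

/-- Iteration `t` with period `τ`, accuracy `ε` and step sizes `β`, `lam`. When `xt = s.x` the
value of `θ` is irrelevant. -/
def step {Ξ : Type u} {H : Type v} {d p : ℕ} (P : Problem Ξ H d p) (τ : ℕ) (ε β : ℝ)
    (lam : ℕ → ℝ) (t : ℕ) (b : Batches Ξ H) (s : State d p) : State d p :=
  let z := zPoint t s
  let gE : Vec p :=
    if t % τ = 0 then b.A.avg fun ξ => P.g ξ z
    else s.gEst + b.A.avg fun ξ => P.g ξ z - P.g ξ s.z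
  let jE : Vec d →L[ℝ] Vec p :=
    if t % τ = 0 then b.AJ.avg fun ξ => fderiv ℝ (P.g ξ) z
    else s.jEst + b.AJ.avg fun ξ => fderiv ℝ (P.g ξ) z - fderiv ℝ (P.g ξ) s.z
  let fE : Vec p :=
    if t % τ = 0 then b.B.avg fun η => gradient (P.f η) gE
    else s.fEst + b.B.avg fun η => gradient (P.f η) gE - gradient (P.f η) s.gEst
  let xt : Vec d := prox (lam t) P.r (s.x - lam t • ContinuousLinearMap.adjoint jE fE)
  let θ : ℝ := min (ε * lam t / ‖xt - s.x‖) (1 / 2)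
  let x : Vec d := (1 - θ) • s.x + θ • xt
  { x := x
    y := z + (β / lam t) • (x - s.x)
    z := z
    gEst := gE
    jEst := jE
    fEst := fE }

/-- The state after `t` iterations started at `x₀` (with `y₀ = x₀`); the remaining initial
entries are overwritten at `t = 0`. -/
def iter {Ξ : Type u} {H : Type v} {d p : ℕ} (P : Problem Ξ H d p) (τ : ℕ) (ε β : ℝ)
    (lam : ℕ → ℝ) (b : ℕ → Batches Ξ H) (x₀ : Vec d) : ℕ → State d p
  | 0 => ⟨x₀, x₀, x₀, 0, 0, 0⟩
  | t + 1 => step P τ ε β lam t (b t) (iter P τ ε β lam b x₀ t)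

/-- Input, hyperparameters and randomness of `M` restarted runs of `T` iterations. Runs are
numbered from `0`; `draw (m, t)` holds the samples drawn in iteration `t` of run `m`. -/
structure Run (Ξ : Type u) (H : Type v) (Ω : Type w) (d p : ℕ) where
  P : Problem Ξ H d p
  x₀ : Vec d
  M : ℕ
  T : ℕ
  τ : ℕ
  ε : ℝ
  β : ℝ
  lam : ℕ → ℝ
  a : ℕ → ℕ
  aJ : ℕ → ℕ
  b : ℕ → ℕ
  draw : (q : ℕ × ℕ) → Ω → (Fin (a q.2) → Ξ) × (Fin (aJ q.2) → Ξ) × (Fin (b q.2) → H)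
  ζ : Ω → ℕ
  δ : Ω → ℕ

section Runs

variable {Ξ : Type u} {H : Type v} {Ω : Type w} {d p : ℕ}

/-- Starting point of run `m`: the next run starts at the iterate `x_{T-1}` of the current one. -/
def Run.start (R : Run Ξ H Ω d p) (b : ℕ → ℕ → Batches Ξ H) : ℕ → Vec d
  | 0 => R.x₀
  | m + 1 => (iter R.P R.τ R.ε R.β R.lam (b m) (R.start b m) (R.T - 1)).x

/-- The point `z_{t,m}`. -/
def Run.z (R : Run Ξ H Ω d p) (b : ℕ → ℕ → Batches Ξ H) (m t : ℕ) : Vec d :=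
  zPoint t (iter R.P R.τ R.ε R.β R.lam (b m) (R.start b m) t)

/-- All minibatches consist of the drawn samples (online problem). -/
def Run.drawnBatches (R : Run Ξ H Ω d p) (ω : Ω) (m t : ℕ) : Batches Ξ H :=
  { A := ⟨R.a t, (R.draw (m, t) ω).1⟩
    AJ := ⟨R.aJ t, (R.draw (m, t) ω).2.1⟩
    B := ⟨R.b t, (R.draw (m, t) ω).2.2⟩ }

/-- The full index sets when `τ ∣ t`, the drawn samples otherwise (finite-sum problem). -/
def Run.sumBatches {N n : ℕ} (R : Run (Fin n) (Fin N) Ω d p) (ω : Ω) (m t : ℕ) :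
    Batches (Fin n) (Fin N) :=
  if t % R.τ = 0 then ⟨⟨n, id⟩, ⟨n, id⟩, ⟨N, id⟩⟩ else R.drawnBatches ω m t

/-- Norm of the gradient mapping at the random output `z_{ζ,δ}`. -/
def Run.outNorm (R : Run Ξ H Ω d p) (F : Vec d → ℝ) (b : Ω → ℕ → ℕ → Batches Ξ H) (ω : Ω) : ℝ :=
  ‖gradMap (R.lam (R.ζ ω)) F R.P.r (R.z (b ω) (R.δ ω) (R.ζ ω))‖

/-- Number of evaluations of `g`, of its Jacobian and of `∇f` at samples, over all `M` runs: one
per sample when `τ ∣ t`, two per sample otherwise. -/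
def Run.evals (R : Run Ξ H Ω d p) (b : ℕ → ℕ → Batches Ξ H) : ℕ :=
  ∑ m ∈ Finset.range R.M, ∑ t ∈ Finset.range R.T,
    (if t % R.τ = 0 then 1 else 2) * (b m t).size

/-- Initial objective gap `Φ(x₀) - inf Φ`. -/
def Run.gap (R : Run Ξ H Ω d p) (F : Vec d → ℝ) : ℝ :=
  R.P.obj F R.x₀ - ⨅ x, R.P.obj F x

/-- `β = O(1 / L)` and `β ≤ λ_t ≤ (1 + α_t) β`. -/
structure Run.StepSizes (R : Run Ξ H Ω d p) (C L : ℝ) : Prop where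
  β_pos : 0 < R.β
  β_le : R.β * L ≤ C
  lam_ge : ∀ t, R.β ≤ R.lam t
  lam_le : ∀ t, R.lam t ≤ (1 + alpha t) * R.β

/-- The draws of different iterations and runs are independent, the draw of iteration `t` has
independent components with the given laws, and `(ζ, δ)` is independent of all draws and uniform
on `{0, …, T-1} × {0, …, M-1}`. -/
structure Run.Sampled [MeasurableSpace Ξ] [MeasurableSpace H] [MeasurableSpace Ω]
    (R : Run Ξ H Ω d p) (μ : Measure Ω)
    (lawA : (k : ℕ) → Measure (Fin k → Ξ)) (lawB : (k : ℕ) → Measure (Fin k → H)) : Prop where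
  draw_meas : ∀ q, Measurable (R.draw q)
  draw_indep : iIndepFun R.draw μ
  draw_law : ∀ q, μ.map (R.draw q) =
    (lawA (R.a q.2)).prod ((lawA (R.aJ q.2)).prod (lawB (R.b q.2)))
  out_meas : Measurable fun ω => (R.ζ ω, R.δ ω)
  out_law : μ.map (fun ω => (R.ζ ω, R.δ ω)) =
    (uniformOn (Set.Iio R.T)).prod (uniformOn (Set.Iio R.M))
  out_indep : IndepFun (fun ω => (R.ζ ω, R.δ ω)) (fun ω q => R.draw q ω) μ

end Runs

/-- The two ways of sampling a minibatch from a finite index set. -/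
inductive Scheme
  | withReplacement
  | withoutReplacement

/-- Law of a uniform `k`-sample from `{0, …, n-1}`. Without replacement this is a probability
measure only if `k ≤ n`. -/
def Scheme.law (S : Scheme) (n k : ℕ) : Measure (Fin k → Fin n) :=
  match S with
  | .withReplacement => uniformOn Set.univ
  | .withoutReplacement => uniformOn {v | Function.Injective v}

/-- The batch size `k` is of order `X`, up to the factor `C`. -/
structure IsOfOrder (C : ℝ) (X k : ℕ) : Prop where
  pos : 1 ≤ k
  lower : (X : ℝ) ≤ C * k
  upper : (k : ℝ) ≤ C * max (X : ℝ) 1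

/-- `R` is a run for the finite-sum problem with the prescribed hyperparameters; `C` is the
constant in their orders of magnitude. -/
structure IsSumRun {N n d p : ℕ} {Ω : Type w} [MeasurableSpace Ω] (μ : Measure Ω)
    (R : Run (Fin n) (Fin N) Ω d p) (S : Scheme) (C : ℝ) (lf Lf lg Lg : ℝ≥0) : Prop where
  N_pos : 1 ≤ N
  n_pos : 1 ≤ n
  regular : R.P.Regular R.P.sumF lf Lf lg Lg
  steps : R.StepSizes C (LF lf Lf lg Lg)
  period : R.τ = Nat.sqrt (max N n)
  a_size : ∀ t, IsOfOrder C R.τ (R.a t)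
  aJ_size : ∀ t, IsOfOrder C R.τ (R.aJ t)
  b_size : ∀ t, IsOfOrder C R.τ (R.b t)
  sampled : R.Sampled μ (S.law n) (S.law N)

/-- `R` is a run for the online problem with the prescribed hyperparameters; `C` is the
constant in their orders of magnitude. -/
structure IsOnlineRun {Ξ : Type u} {H : Type v} {d p : ℕ} {Ω : Type w} [MeasurableSpace Ξ]
    [MeasurableSpace H] [MeasurableSpace Ω] (D : Measure Ξ) (Q : Measure H) (μ : Measure Ω)
    (R : Run Ξ H Ω d p) (C : ℝ) (lf Lf lg Lg : ℝ≥0) (σg σJ σf : ℝ) : Prop where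
  regular : R.P.Regular (R.P.onlineF D Q) lf Lf lg Lg
  variance : R.P.BoundedVariance D Q σg σJ σf
  steps : R.StepSizes C (LF lf Lf lg Lg)
  period : R.τ = ⌊lf * lg / R.ε⌋₊
  a_size : ∀ t, IsOfOrder C
    (if t % R.τ = 0 then ⌈(Lf : ℝ) ^ 2 * (lg : ℝ) ^ 2 * σg ^ 2 / R.ε ^ 2⌉₊ else R.τ) (R.a t)
  aJ_size : ∀ t, IsOfOrder C
    (if t % R.τ = 0 then ⌈(lf : ℝ) ^ 2 * σJ ^ 2 / R.ε ^ 2⌉₊ else R.τ) (R.aJ t)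
  b_size : ∀ t, IsOfOrder C
    (if t % R.τ = 0 then ⌈(lg : ℝ) ^ 2 * σf ^ 2 / R.ε ^ 2⌉₊ else R.τ) (R.b t)
  sampled : R.Sampled μ (fun _ => Measure.pi fun _ => D) (fun _ => Measure.pi fun _ => Q)

end MVRC

end

/-! The argument combines a pathwise descent estimate with a second-moment estimate for the
recursive estimators.

Pathwise part. The choice of `θ` clips every step: `‖x_{t+1} - x_t‖ ≤ ε λ_t ≤ 3βε`. By induction
`y_t` and `z_t` stay within `2βε` of `x_t`, so momentum only perturbs the method: since `β L_F ≤ C`,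
replacing `∇F(x_t)` by `∇F(z_t)` costs a multiple of `Cε`. Clipping also makes descent linear,
rather than quadratic, in the prox residual. The descent inequality for `F`, convexity of `r` on the
segment towards the prox point and the variational inequality of the prox give (`step_descent`,
`norm_gradMap_iter_le`) `‖G(z_t)‖ ≤ (Φ(x_t) - Φ(x_{t+1}))/(βε) + (10 + 15C)ε + 4 err_t`, where
`err_t` is the error of the estimated direction at `z_t`. Sums telescope within a run and, because a
run starts where the previous one was at `x_{T-1}`, across runs. The iteration `t = T-1` lies
outside the telescoping range; its gradient mapping is at most three times the preceding one plus
`(14 + 7C)ε` (`norm_gradMap_iter_succ_le`, based on `residual_le_of_le`).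

Stochastic part. The direction is a product of two estimators and is biased, so its error is not
treated as a martingale. Instead `err_le` uses Young's inequality, with `ε ≤ l_f l_g` absorbing the
product of two errors, to get `err ≤ sqErr/ε + 3ε/2`, where `sqErr` is a weighted sum of squared
errors of the three estimators. It remains to show `E sqErr = O(ε²)`. The error of the `∇f`
estimator is measured at the current `g̃_t`, not at `g(z_t)`; hence, given the past (and `g̃_t`),
each of the three increments is unbiased. An ordinary iteration adds at most `2(C/τ) L_F² (7βε)²` to
`E sqErr`; a restart resets it to at most `3Cε²` (to zero for full batches). Fewer than `τ`
iterations separate restarts, so the total is at most `(3C + 98C³)ε²`.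

The two problems are treated together: a finite sum is an expectation under the uniform law, and
both sampling schemes satisfy `IsSamplingLaw` (correct marginals, nonpositive correlations), which
is all that the variance bound needs. Conditioning is replaced by independence of the state before
an iteration from that iteration's samples. Expectations are lower integrals of nonnegative
functions until the end, where finiteness yields integrability.

Sample complexity follows by running at accuracy `ε/K` with `MT ≥ s²/ε²` and counting: restarts are
rare, and the other batches have size of order `τ`. -/

noncomputable section

namespace MVRC

/-! ### The proximal mapping of a convex function -/

section Prox

variable {d : ℕ} {r : Vec d → ℝ} {lam : ℝ}

/-- A convex function on `ℝ^d` decreases at most linearly. -/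
theorem exists_linear_lower_bound (hr : ConvexOn ℝ Set.univ r) (x : Vec d) :
    ∃ c : ℝ, 0 ≤ c ∧ ∀ u, 1 ≤ ‖u - x‖ → r x - c * ‖u - x‖ ≤ r u := by
  have hcont : Continuous r := hr.locallyLipschitz.continuous
  obtain ⟨y, -, hy⟩ := (isCompact_closedBall x 1).exists_isMinOn
    ⟨x, by simp⟩ hcont.continuousOn
  have hxy : r y ≤ r x := hy (by simp)
  refine ⟨r x - r y, by linarith, fun u hu => ?_⟩
  set R := ‖u - x‖ with hR
  have hR0 : 0 < R := by linarith
  -- The segment from `x` to `u` leaves the unit ball at this point, where `r` is at least its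
  -- minimum over the ball; convexity along the segment then bounds `r u` from below.
  have hw : r y ≤ r ((1 - R⁻¹) • x + R⁻¹ • u) := by
    refine hy ?_
    rw [Metric.mem_closedBall, dist_eq_norm]
    have : (1 - R⁻¹) • x + R⁻¹ • u - x = R⁻¹ • (u - x) := by module
    rw [this, norm_smul, Real.norm_of_nonneg (inv_nonneg.2 hR0.le), ← hR,
      inv_mul_cancel₀ hR0.ne']
  have hconv := hr.2 (Set.mem_univ x) (Set.mem_univ u)
    (sub_nonneg.2 (inv_le_one_of_one_le₀ hu)) (inv_nonneg.2 hR0.le) (by ring)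
  simp only [smul_eq_mul] at hconv
  have h := hw.trans hconv
  have h2 := mul_le_mul_of_nonneg_left h hR0.le
  have h3 : R * ((1 - R⁻¹) * r x + R⁻¹ * r u) = R * r x - r x + r u := by
    field_simp
  rw [h3] at h2
  nlinarith

/-- A convex function falls at most linearly, so the quadratic term wins outside the ball of radius
`max 1 (2 * lam * c)`: there the objective is at least its value at `x`, and compactness applies. -/
theorem exists_prox (hr : ConvexOn ℝ Set.univ r) (hl : 0 < lam) (x : Vec d) :
    ∃ y, IsMinOn (fun u : Vec d => r u + 1 / (2 * lam) * ‖u - x‖ ^ 2) Set.univ y := by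
  have hcont : Continuous r := hr.locallyLipschitz.continuous
  obtain ⟨c, hc, hlow⟩ := exists_linear_lower_bound hr x
  obtain ⟨y, hy⟩ := Continuous.exists_forall_le'
    (f := fun u : Vec d => r u + 1 / (2 * lam) * ‖u - x‖ ^ 2) (by fun_prop) x (by
      have hcompl : (Metric.closedBall x (max 1 (2 * lam * c)))ᶜ ∈ Filter.cocompact (Vec d) :=
        (isCompact_closedBall x _).compl_mem_cocompact
      filter_upwards [hcompl] with u hu
      simp only [Set.mem_compl_iff, Metric.mem_closedBall, dist_eq_norm, not_le, max_lt_iff] at hu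
      have h1 := hlow u hu.1.le
      have h2 : c * ‖u - x‖ ≤ 1 / (2 * lam) * ‖u - x‖ ^ 2 := by
        rw [one_div, inv_mul_eq_div, le_div_iff₀ (by positivity)]
        nlinarith [hu.2, norm_nonneg (u - x)]
      simp only [sub_self, norm_zero]
      nlinarith)
  exact ⟨y, fun u _ => hy u⟩

theorem prox_isMinOn (hr : ConvexOn ℝ Set.univ r) (hl : 0 < lam) (x : Vec d) :
    IsMinOn (fun u : Vec d => r u + 1 / (2 * lam) * ‖u - x‖ ^ 2) Set.univ (prox lam r x) :=
  Classical.epsilon_spec (exists_prox hr hl x)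

/-- Variational inequality characterizing the proximal point. -/
theorem inner_sub_prox_le (hr : ConvexOn ℝ Set.univ r) (hl : 0 < lam) (x u : Vec d) :
    inner ℝ (x - prox lam r x) (u - prox lam r x) ≤ lam * (r u - r (prox lam r x)) := by
  set p := prox lam r x with hp
  have hmin : ∀ w, r p + 1 / (2 * lam) * ‖p - x‖ ^ 2 ≤ r w + 1 / (2 * lam) * ‖w - x‖ ^ 2 :=
    fun w => prox_isMinOn hr hl x (Set.mem_univ w)
  -- Minimality is tested against points of the segment from `p` to `u`. After division by `t` the
  -- quadratic remainder is `O(t)` and vanishes as `t → 0`.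
  have key : ∀ t : ℝ, 0 < t → t ≤ 1 →
      inner ℝ (x - p) (u - p) ≤ lam * (r u - r p) + t * (‖u - p‖ ^ 2 / 2) := by
    intro t ht0 ht1
    have h1 := hmin ((1 - t) • p + t • u)
    have h2 := hr.2 (Set.mem_univ p) (Set.mem_univ u) (sub_nonneg.2 ht1) ht0.le (by ring)
    simp only [smul_eq_mul] at h2
    have h3 : (1 - t) • p + t • u - x = (p - x) + t • (u - p) := by module
    have h4 : ‖(p - x) + t • (u - p)‖ ^ 2
        = ‖p - x‖ ^ 2 - 2 * t * inner ℝ (x - p) (u - p) + t ^ 2 * ‖u - p‖ ^ 2 := by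
      rw [norm_add_sq_real, inner_smul_right, norm_smul, mul_pow, Real.norm_eq_abs, sq_abs,
        ← neg_sub x p, inner_neg_left]
      ring
    rw [h3, h4] at h1
    have h5 : 0 ≤ t * (r u - r p) + 1 / (2 * lam) *
        (- 2 * t * inner ℝ (x - p) (u - p) + t ^ 2 * ‖u - p‖ ^ 2) := by linarith
    have h6 : t * (r u - r p) + 1 / (2 * lam) *
        (- 2 * t * inner ℝ (x - p) (u - p) + t ^ 2 * ‖u - p‖ ^ 2)
        = (t / lam) * (lam * (r u - r p) + t * (‖u - p‖ ^ 2 / 2) - inner ℝ (x - p) (u - p)) := by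
      field_simp
      ring
    rw [h6] at h5
    by_contra hcon
    push Not at hcon
    have : (t / lam) * (lam * (r u - r p) + t * (‖u - p‖ ^ 2 / 2) - inner ℝ (x - p) (u - p)) < 0 :=
      mul_neg_of_pos_of_neg (by positivity) (by linarith)
    linarith
  refine le_of_forall_pos_le_add fun δ hδ => ?_
  have hN : 0 ≤ ‖u - p‖ ^ 2 / 2 := by positivity
  set N := ‖u - p‖ ^ 2 / 2
  -- The denominator `N + 1` keeps the choice valid when `u = p`.
  have ht := key (min 1 (δ / (N + 1))) (by positivity) (min_le_left _ _)
  have : min 1 (δ / (N + 1)) * N ≤ δ := by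
    calc min 1 (δ / (N + 1)) * N ≤ δ / (N + 1) * (N + 1) := by
          gcongr
          · exact min_le_right _ _
          · linarith
      _ = δ := by field_simp
  linarith

/-- Testing each variational inequality at the other prox point and adding cancels the values of `r`
and leaves firm nonexpansiveness; Cauchy–Schwarz finishes. -/
theorem norm_prox_sub_prox_le (hr : ConvexOn ℝ Set.univ r) (hl : 0 < lam) (x y : Vec d) :
    ‖prox lam r x - prox lam r y‖ ≤ ‖x - y‖ := by
  have h1 := inner_sub_prox_le hr hl x (prox lam r y)
  have h2 := inner_sub_prox_le hr hl y (prox lam r x)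
  set p := prox lam r x
  set q := prox lam r y
  have h3 : inner ℝ (x - p) (q - p) + inner ℝ (y - q) (p - q)
      = ‖p - q‖ ^ 2 - inner ℝ (x - y) (p - q) := by
    have : q - p = -(p - q) := by abel
    rw [this, inner_neg_right, ← real_inner_self_eq_norm_sq]
    have e : inner ℝ (x - y) (p - q)
        = inner ℝ (x - p) (p - q) - inner ℝ (y - q) (p - q) + inner ℝ (p - q) (p - q) := by
      rw [← inner_sub_left, ← inner_add_left]
      congr 1
      abel
    rw [e]
    ring
  have h4 : ‖p - q‖ ^ 2 ≤ ‖x - y‖ * ‖p - q‖ := by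
    have := real_inner_le_norm (x - y) (p - q)
    linarith
  rcases eq_or_lt_of_le (norm_nonneg (p - q)) with h0 | h0
  · rw [← h0]; positivity
  · nlinarith

theorem continuous_prox (hr : ConvexOn ℝ Set.univ r) (hl : 0 < lam) :
    Continuous (prox lam r) := by
  refine (LipschitzWith.of_dist_le_mul (K := 1) fun x y => ?_).continuous
  simpa [dist_eq_norm] using norm_prox_sub_prox_le hr hl x y

/-- Comparison of prox-gradient residuals with different parameters. -/
theorem residual_le_of_le (hr : ConvexOn ℝ Set.univ r) {l₁ l₂ c : ℝ} (h₁ : 0 < l₁) (h₂ : 0 < l₂)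
    (hc : 1 ≤ c) (hle : l₂ ≤ c * l₁) (x v : Vec d) :
    ‖(1 / l₁) • (x - prox l₁ r (x - l₁ • v))‖ ≤ c * ‖(1 / l₂) • (x - prox l₂ r (x - l₂ • v))‖ := by
  have k1 := inner_sub_prox_le hr h₁ (x - l₁ • v) (prox l₂ r (x - l₂ • v))
  have k2 := inner_sub_prox_le hr h₂ (x - l₂ • v) (prox l₁ r (x - l₁ • v))
  set p := prox l₁ r (x - l₁ • v)
  set q := prox l₂ r (x - l₂ • v)
  set a := (1 / l₁) • (x - p) with ha
  set b := (1 / l₂) • (x - q) with hb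
  have ea : x - p = l₁ • a := by rw [ha, smul_smul]; field_simp; simp
  have eb : x - q = l₂ • b := by rw [hb, smul_smul]; field_simp; simp
  have e1 : x - l₁ • v - p = l₁ • (a - v) := by rw [smul_sub, ← ea]; abel
  have e2 : x - l₂ • v - q = l₂ • (b - v) := by rw [smul_sub, ← eb]; abel
  have e3 : q - p = l₁ • a - l₂ • b := by rw [← ea, ← eb]; abel
  have e4 : p - q = -(l₁ • a - l₂ • b) := by rw [← e3]; abel
  rw [e1, e3, real_inner_smul_left] at k1
  rw [e2, e4, real_inner_smul_left, inner_neg_right] at k2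
  have k1' := le_of_mul_le_mul_left k1 h₁
  have k2' := le_of_mul_le_mul_left k2 h₂
  -- Adding the two variational inequalities, each divided by its own parameter, eliminates both `r`
  -- and `v`.
  have k3 : inner ℝ (a - b) (l₁ • a - l₂ • b) ≤ 0 := by
    have : a - b = (a - v) - (b - v) := by abel
    rw [this, inner_sub_left]
    linarith
  have k4 : l₁ * ‖a‖ ^ 2 + l₂ * ‖b‖ ^ 2 ≤ (l₁ + l₂) * (‖a‖ * ‖b‖) := by
    simp only [inner_sub_left, inner_sub_right, inner_smul_right, real_inner_self_eq_norm_sq] at k3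
    rw [real_inner_comm a b] at k3
    have := real_inner_le_norm a b
    nlinarith
  -- The factors cannot both be positive, so `‖a‖` is at most `‖b‖` or at most `(l₂ / l₁) * ‖b‖`.
  have k5 : (l₁ * ‖a‖ - l₂ * ‖b‖) * (‖a‖ - ‖b‖) ≤ 0 := by nlinarith
  by_contra hcon
  push Not at hcon
  have hbn := norm_nonneg b
  have f1 : 0 < ‖a‖ - ‖b‖ := by nlinarith
  have f2 : 0 < l₁ * ‖a‖ - l₂ * ‖b‖ := by
    have : l₂ * ‖b‖ ≤ l₁ * (c * ‖b‖) := by nlinarith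
    have := mul_lt_mul_of_pos_left hcon h₁
    linarith
  nlinarith [mul_pos f2 f1]

end Prox

/-! ### Deterministic analysis of the iteration -/

theorem alpha_nonneg (t : ℕ) : 0 ≤ alpha t := by
  unfold alpha; positivity

theorem alpha_le_two (t : ℕ) : alpha t ≤ 2 := by
  unfold alpha
  rw [div_le_iff₀ (by positivity)]
  have : (0 : ℝ) ≤ t := t.cast_nonneg
  linarith

theorem alpha_succ_le_one (t : ℕ) : alpha (t + 1) ≤ 1 := by
  unfold alpha
  rw [div_le_one (by positivity)]
  push_cast
  have : (0 : ℝ) ≤ t := t.cast_nonneg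
  linarith

/-- The descent inequality for a function with Lipschitz gradient. -/
theorem le_add_inner_gradient {d : ℕ} {F : Vec d → ℝ} {L : ℝ} (hF : Differentiable ℝ F)
    (hL0 : 0 ≤ L) (hL : ∀ x y, ‖gradient F x - gradient F y‖ ≤ L * ‖x - y‖) (x y : Vec d) :
    F y ≤ F x + inner ℝ (gradient F x) (y - x) + L * ‖y - x‖ ^ 2 := by
  -- A mean value estimate with the derivative frozen at `x` gives the constant `L` instead of the
  -- sharp `L / 2`; only numerical constants suffer.
  have hb : ∀ z ∈ Metric.closedBall x ‖y - x‖, ‖fderiv ℝ F z - fderiv ℝ F x‖ ≤ L * ‖y - x‖ := by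
    intro z hz
    rw [← toDual_gradient, ← toDual_gradient, ← map_sub, LinearIsometryEquiv.norm_map]
    refine (hL z x).trans ?_
    rw [Metric.mem_closedBall, dist_eq_norm] at hz
    gcongr
  have h := (convex_closedBall x ‖y - x‖).norm_image_sub_le_of_norm_hasFDerivWithin_le'
    (f := F) (f' := fderiv ℝ F) (φ := fderiv ℝ F x)
    (fun z _ => (hF z).hasFDerivAt.hasFDerivWithinAt) hb
    (Metric.mem_closedBall_self (norm_nonneg _))
    (show y ∈ Metric.closedBall x ‖y - x‖ by rw [Metric.mem_closedBall, dist_eq_norm])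
  rw [← inner_gradient_left] at h
  have h' := (le_abs_self _).trans h
  nlinarith

/-- Direction `g̃'ᵀ f̃'` stored in a state. -/
def State.dir {d p : ℕ} (s : State d p) : Vec d := ContinuousLinearMap.adjoint s.jEst s.fEst

/-- Error of the stored direction as an estimator of `∇F(z)`. -/
def State.err {d p : ℕ} (F : Vec d → ℝ) (s : State d p) : ℝ := ‖s.dir - gradient F s.z‖

/-! ### One clipped prox step. -/

section Step

variable {Ξ : Type u} {H : Type v} {d p : ℕ} {P : Problem Ξ H d p} {τ : ℕ} {ε β : ℝ}
  {lam : ℕ → ℝ} {t : ℕ} {b : Batches Ξ H} {s : State d p}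

theorem step_x_sub : (step P τ ε β lam t b s).x - s.x
    = min (ε * lam t / ‖prox (lam t) P.r (s.x - lam t • (step P τ ε β lam t b s).dir) - s.x‖)
        (1 / 2) • (prox (lam t) P.r (s.x - lam t • (step P τ ε β lam t b s).dir) - s.x) := by
  change (1 - min (ε * lam t / ‖prox (lam t) P.r (s.x - lam t • (step P τ ε β lam t b s).dir) - s.x‖)
    (1 / 2)) • s.x + min (ε * lam t / ‖prox (lam t) P.r (s.x - lam t •
      (step P τ ε β lam t b s).dir) - s.x‖) (1 / 2) •
      prox (lam t) P.r (s.x - lam t • (step P τ ε β lam t b s).dir) - s.x = _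
  module

theorem step_z : (step P τ ε β lam t b s).z = zPoint t s := rfl

theorem min_div_mul_le {a D : ℝ} (ha : 0 ≤ a) (hD : 0 ≤ D) : min (a / D) (1 / 2) * D ≤ a := by
  rcases hD.eq_or_lt with rfl | h
  · simpa using ha
  · calc min (a / D) (1 / 2) * D ≤ a / D * D := by gcongr; exact min_le_left _ _
      _ = a := by field_simp

/-- This is how clipping turns quadratic decrease into linear decrease. In the clipped regime the
right side is `a * D`; otherwise `D ≤ 2 * a` and the deficit `D ^ 2 / 2 - a * D + 2 * a ^ 2` is
nonnegative. At `D = 0` the junk value of the division is harmless. -/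
theorem le_min_div_mul_sq {a D : ℝ} (hD : 0 ≤ D) :
    a * D - 2 * a ^ 2 ≤ min (a / D) (1 / 2) * D ^ 2 := by
  rcases hD.eq_or_lt with rfl | h
  · simp; positivity
  · rcases le_total (a / D) (1 / 2) with h1 | h1
    · rw [min_eq_left h1]
      have : a / D * D ^ 2 = a * D := by field_simp
      rw [this]; nlinarith
    · rw [min_eq_right h1]
      nlinarith [sq_nonneg (D - a), sq_nonneg a]

theorem norm_step_x_sub_le (hε : 0 ≤ ε) (hl : 0 ≤ lam t) :
    ‖(step P τ ε β lam t b s).x - s.x‖ ≤ ε * lam t := by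
  rw [step_x_sub, norm_smul, Real.norm_of_nonneg (by positivity)]
  exact min_div_mul_le (by positivity) (norm_nonneg _)

/-- Decrease of the objective in one step. -/
theorem step_descent {F : Vec d → ℝ} {L : ℝ} (hF : Differentiable ℝ F) (hL0 : 0 ≤ L)
    (hL : ∀ x y, ‖gradient F x - gradient F y‖ ≤ L * ‖x - y‖)
    (hr : ConvexOn ℝ Set.univ P.r) (hε : 0 ≤ ε) (hl : 0 < lam t) :
    ε * ‖prox (lam t) P.r (s.x - lam t • (step P τ ε β lam t b s).dir) - s.x‖
      ≤ P.obj F s.x - P.obj F (step P τ ε β lam t b s).x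
        + ε * lam t * (2 * ε + L * lam t * ε
          + ‖gradient F s.x - (step P τ ε β lam t b s).dir‖) := by
  have hx := step_x_sub (P := P) (τ := τ) (ε := ε) (β := β) (lam := lam) (t := t) (b := b) (s := s)
  set s' := step P τ ε β lam t b s
  set q := prox (lam t) P.r (s.x - lam t • s'.dir) with hq
  set D := ‖q - s.x‖ with hD
  set θ := min (ε * lam t / D) (1 / 2) with hθ
  have hθ0 : 0 ≤ θ := by positivity
  have hθ1 : θ ≤ 1 := (min_le_right _ _).trans (by norm_num)
  have hθD : θ * D ≤ ε * lam t := min_div_mul_le (by positivity) (norm_nonneg _)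
  have hθD2 := le_min_div_mul_sq (a := ε * lam t) (D := D) (norm_nonneg _)
  rw [← hθ] at hθD2
  have hdesc := le_add_inner_gradient hF hL0 hL s.x s'.x
  rw [hx, inner_smul_right, norm_smul, Real.norm_of_nonneg hθ0, ← hD] at hdesc
  have hxc : s'.x = (1 - θ) • s.x + θ • q := by
    rw [sub_eq_iff_eq_add'.1 hx]; module
  have hrc := hr.2 (Set.mem_univ s.x) (Set.mem_univ q) (sub_nonneg.2 hθ1) hθ0 (by ring)
  rw [← hxc] at hrc
  simp only [smul_eq_mul] at hrc
  have hprox := inner_sub_prox_le hr hl (s.x - lam t • s'.dir) s.x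
  rw [← hq] at hprox
  have e1 : inner ℝ (s.x - lam t • s'.dir - q) (s.x - q)
      = D ^ 2 + lam t * inner ℝ s'.dir (q - s.x) := by
    have : s.x - lam t • s'.dir - q = -(q - s.x) - lam t • s'.dir := by abel
    have h2 : s.x - q = -(q - s.x) := by abel
    rw [this, h2, inner_sub_left, inner_neg_neg, inner_neg_right, real_inner_smul_left,
      real_inner_self_eq_norm_sq]
    ring
  rw [e1] at hprox
  have hcs : inner ℝ (gradient F s.x) (q - s.x) - inner ℝ s'.dir (q - s.x)
      ≤ ‖gradient F s.x - s'.dir‖ * D := by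
    rw [← inner_sub_left]; exact real_inner_le_norm _ _
  set E := ‖gradient F s.x - s'.dir‖
  have hE : 0 ≤ E := norm_nonneg _
  have hprox' : D ^ 2 / lam t + inner ℝ s'.dir (q - s.x) ≤ P.r s.x - P.r q := by
    rw [← mul_le_mul_iff_of_pos_left hl, mul_add, mul_div_cancel₀ _ hl.ne']
    exact hprox
  have m1 := mul_le_mul_of_nonneg_left hprox' hθ0
  have m2 := mul_le_mul_of_nonneg_left hcs hθ0
  have m3 : θ * (E * D) ≤ ε * lam t * E := by nlinarith
  have m4 : L * (θ * D) ^ 2 ≤ L * (ε * lam t) ^ 2 := by gcongr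
  -- The quadratic gain of the prox step becomes the linear term `ε * D`, at the price of the `2 *
  -- ε` in the statement.
  have m5 : ε * D - 2 * ε ^ 2 * lam t ≤ θ * (D ^ 2 / lam t) := by
    rw [← mul_le_mul_iff_of_pos_left hl]
    have : lam t * (θ * (D ^ 2 / lam t)) = θ * D ^ 2 := by field_simp
    rw [this]; linarith
  unfold Problem.obj
  nlinarith

end Step

/-! ### The iterates of one run: momentum drift, descent and telescoping. -/

section Iter

variable {Ξ : Type u} {H : Type v} {d p : ℕ} {P : Problem Ξ H d p} {τ : ℕ} {ε β : ℝ}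
  {lam : ℕ → ℝ} {b : ℕ → Batches Ξ H} {x₀ : Vec d}

/-- The recursion `y' - x' = (1 - α_{t+1})(y - x) - (1 - β/λ_t)(x' - x)` contracts the old gap. Its
new term is at most `(λ_t - β)ε ≤ α_t βε` by clipping, so `2βε` is preserved. -/
theorem norm_iter_y_sub_x_le (hε : 0 ≤ ε) (hβ : 0 < β) (hl : ∀ t, β ≤ lam t)
    (hu : ∀ t, lam t ≤ (1 + alpha t) * β) (t : ℕ) :
    ‖(iter P τ ε β lam b x₀ t).y - (iter P τ ε β lam b x₀ t).x‖ ≤ 2 * β * ε := by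
  induction t with
  | zero => simp only [iter, sub_self, norm_zero]; positivity
  | succ t ih =>
    have hlt : 0 < lam t := hβ.trans_le (hl t)
    have hx : ‖(iter P τ ε β lam b x₀ (t + 1)).x - (iter P τ ε β lam b x₀ t).x‖ ≤ ε * lam t :=
      norm_step_x_sub_le hε hlt.le
    have hy : (iter P τ ε β lam b x₀ (t + 1)).y = zPoint t (iter P τ ε β lam b x₀ t)
        + (β / lam t) • ((iter P τ ε β lam b x₀ (t + 1)).x - (iter P τ ε β lam b x₀ t).x) := rfl
    set s := iter P τ ε β lam b x₀ t
    set s' := iter P τ ε β lam b x₀ (t + 1)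
    have e : s'.y - s'.x = (1 - alpha (t + 1)) • (s.y - s.x)
        - (1 - β / lam t) • (s'.x - s.x) := by
      rw [hy, zPoint]; module
    have h1 : 0 ≤ 1 - alpha (t + 1) := sub_nonneg.2 (alpha_succ_le_one t)
    have h2 : 0 ≤ 1 - β / lam t := sub_nonneg.2 ((div_le_one hlt).2 (hl t))
    rw [e]
    refine (norm_sub_le _ _).trans ?_
    rw [norm_smul, norm_smul, Real.norm_of_nonneg h1, Real.norm_of_nonneg h2]
    have h3 : (1 - β / lam t) * ‖s'.x - s.x‖ ≤ alpha t * β * ε := by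
      calc (1 - β / lam t) * ‖s'.x - s.x‖ ≤ (1 - β / lam t) * (ε * lam t) := by gcongr
        _ = ε * (lam t - β) := by field_simp
        _ ≤ ε * (alpha t * β) := by gcongr; linarith [hu t]
        _ = alpha t * β * ε := by ring
    -- Equivalent to `α_t ≤ 2 α_{t+1}`; this is what fixes the constant 2 in the invariant.
    have h4 : (1 - alpha (t + 1)) * 2 + alpha t ≤ 2 := by
      unfold alpha
      push_cast
      have : (0 : ℝ) ≤ t := t.cast_nonneg
      rw [sub_mul, div_mul_eq_mul_div]
      have : (2 : ℝ) / (t + 1) ≤ 2 * 2 / (t + 1 + 1) := by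
        rw [div_le_div_iff₀ (by positivity) (by positivity)]; linarith
      linarith
    have h5 := mul_le_mul_of_nonneg_left ih h1
    have h6 : 0 ≤ β * ε := by positivity
    nlinarith

theorem norm_zPoint_sub_x_le (hε : 0 ≤ ε) (hβ : 0 < β) (hl : ∀ t, β ≤ lam t)
    (hu : ∀ t, lam t ≤ (1 + alpha t) * β) (t : ℕ) :
    ‖zPoint t (iter P τ ε β lam b x₀ t) - (iter P τ ε β lam b x₀ t).x‖ ≤ 2 * β * ε := by
  have h := norm_iter_y_sub_x_le (P := P) (τ := τ) (b := b) (x₀ := x₀) hε hβ hl hu t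
  set s := iter P τ ε β lam b x₀ t
  have e : zPoint t s - s.x = (1 - alpha (t + 1)) • (s.y - s.x) := by rw [zPoint]; module
  have h1 : 0 ≤ 1 - alpha (t + 1) := sub_nonneg.2 (alpha_succ_le_one t)
  rw [e, norm_smul, Real.norm_of_nonneg h1]
  have := alpha_nonneg (t + 1)
  nlinarith [norm_nonneg (s.y - s.x)]

theorem lam_le_three_mul (hβ : 0 < β) (hu : ∀ t, lam t ≤ (1 + alpha t) * β) (t : ℕ) :
    lam t ≤ 3 * β := by
  have := alpha_le_two t
  nlinarith [hu t]

/-- The path from `z_t` to `z_{t+1}` through `x_t` and `x_{t+1}` has length at most `2βε + 3βε +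
2βε`. -/
theorem norm_zPoint_succ_sub_le (hε : 0 ≤ ε) (hβ : 0 < β) (hl : ∀ t, β ≤ lam t)
    (hu : ∀ t, lam t ≤ (1 + alpha t) * β) (t : ℕ) :
    ‖zPoint (t + 1) (iter P τ ε β lam b x₀ (t + 1)) - zPoint t (iter P τ ε β lam b x₀ t)‖
      ≤ 7 * β * ε := by
  have h1 := norm_zPoint_sub_x_le (P := P) (τ := τ) (b := b) (x₀ := x₀) hε hβ hl hu t
  have h2 := norm_zPoint_sub_x_le (P := P) (τ := τ) (b := b) (x₀ := x₀) hε hβ hl hu (t + 1)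
  have hlt : 0 < lam t := hβ.trans_le (hl t)
  have h3 : ‖(iter P τ ε β lam b x₀ (t + 1)).x - (iter P τ ε β lam b x₀ t).x‖ ≤ ε * lam t :=
    norm_step_x_sub_le hε hlt.le
  have h4 := lam_le_three_mul hβ hu t
  set s := iter P τ ε β lam b x₀ t
  set s' := iter P τ ε β lam b x₀ (t + 1)
  have e : zPoint (t + 1) s' - zPoint t s
      = (zPoint (t + 1) s' - s'.x) + (s'.x - s.x) - (zPoint t s - s.x) := by abel
  rw [e]
  have := norm_sub_le ((zPoint (t + 1) s' - s'.x) + (s'.x - s.x)) (zPoint t s - s.x)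
  have := norm_add_le (zPoint (t + 1) s' - s'.x) (s'.x - s.x)
  nlinarith

variable {F : Vec d → ℝ} {L C : ℝ}

/-- The gradient mapping at `z_t` in terms of the decrease of the objective. -/
theorem norm_gradMap_iter_le (hF : Differentiable ℝ F) (hL0 : 0 ≤ L)
    (hL : ∀ x y, ‖gradient F x - gradient F y‖ ≤ L * ‖x - y‖)
    (hr : ConvexOn ℝ Set.univ P.r) (hε : 0 < ε) (hβ : 0 < β) (hβL : β * L ≤ C)
    (hl : ∀ t, β ≤ lam t) (hu : ∀ t, lam t ≤ (1 + alpha t) * β) (t : ℕ) :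
    ‖gradMap (lam t) F P.r (zPoint t (iter P τ ε β lam b x₀ t))‖
      ≤ (P.obj F (iter P τ ε β lam b x₀ t).x - P.obj F (iter P τ ε β lam b x₀ (t + 1)).x)
          / (β * ε) + (10 + 15 * C) * ε + 4 * (iter P τ ε β lam b x₀ (t + 1)).err F := by
  have hlt : 0 < lam t := hβ.trans_le (hl t)
  have hz := norm_zPoint_sub_x_le (P := P) (τ := τ) (b := b) (x₀ := x₀) hε.le hβ hl hu t
  have hdesc : ε * ‖prox (lam t) P.r ((iter P τ ε β lam b x₀ t).x
      - lam t • (iter P τ ε β lam b x₀ (t + 1)).dir) - (iter P τ ε β lam b x₀ t).x‖ ≤ _ :=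
    step_descent (P := P) (τ := τ) (ε := ε) (β := β) (lam := lam) (t := t) (b := b t)
      (s := iter P τ ε β lam b x₀ t) hF hL0 hL hr hε.le hlt
  have h3 := lam_le_three_mul hβ hu t
  have hzz : (iter P τ ε β lam b x₀ (t + 1)).z = zPoint t (iter P τ ε β lam b x₀ t) := rfl
  change _ ≤ P.obj F (iter P τ ε β lam b x₀ t).x - P.obj F (iter P τ ε β lam b x₀ (t + 1)).x
        + ε * lam t * (2 * ε + L * lam t * ε
          + ‖gradient F (iter P τ ε β lam b x₀ t).x - (iter P τ ε β lam b x₀ (t + 1)).dir‖)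
    at hdesc
  set s := iter P τ ε β lam b x₀ t
  set s' := iter P τ ε β lam b x₀ (t + 1)
  set q := prox (lam t) P.r (s.x - lam t • s'.dir) with hq
  set z := zPoint t s
  set D := ‖q - s.x‖
  set δ := P.obj F s.x - P.obj F s'.x
  have hE : s'.err F = ‖s'.dir - gradient F z‖ := by rw [State.err, hzz]
  set E := s'.err F
  have hE0 : 0 ≤ E := by rw [hE]; positivity
  have hgx : ‖gradient F s.x - s'.dir‖ ≤ 2 * C * ε + E := by
    have e : gradient F s.x - s'.dir = (gradient F s.x - gradient F z)
      - (s'.dir - gradient F z) := by abel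
    rw [e]
    refine (norm_sub_le _ _).trans ?_
    rw [← hE]
    have h := hL s.x z
    rw [norm_sub_rev s.x z] at h
    have : L * ‖z - s.x‖ ≤ L * (2 * β * ε) := by gcongr
    nlinarith
  -- The descent inequality is divided by `βε`, using `λ_t ≤ 3β` and `L λ_t ≤ 3C`: the constant is
  -- `3 * (2 + 3C + 2C)`.
  have hD : D / lam t ≤ δ / (β * ε) + (6 + 15 * C) * ε + 3 * E := by
    have hLl : L * lam t ≤ 3 * C := by nlinarith
    have e1 : ε * D ≤ δ + ε * (3 * β) * (2 * ε + 3 * C * ε + (2 * C * ε + E)) := by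
      refine hdesc.trans ?_
      have hC0 : 0 ≤ C := le_trans (by positivity) hβL
      gcongr
    have e2 : D / lam t ≤ D / β := by
      gcongr
      exact hl t
    refine e2.trans ?_
    rw [div_le_iff₀ hβ, ← mul_le_mul_iff_of_pos_left hε]
    refine e1.trans (le_of_eq ?_)
    field_simp
    ring
  -- The displacement `z - x` enters twice, once directly and once through nonexpansiveness of the
  -- prox, giving `2 * (2βε) / λ_t ≤ 4ε`.
  have hG : ‖gradMap (lam t) F P.r z‖ ≤ D / lam t + 4 * ε + E := by
    have hne := norm_prox_sub_prox_le hr hlt (s.x - lam t • s'.dir) (z - lam t • gradient F z)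
    have e : z - prox (lam t) P.r (z - lam t • gradient F z) = (z - s.x) - (q - s.x)
      + (q - prox (lam t) P.r (z - lam t • gradient F z)) := by abel
    have e2 : s.x - lam t • s'.dir - (z - lam t • gradient F z)
        = -(z - s.x) - lam t • (s'.dir - gradient F z) := by module
    have h5 : ‖-(z - s.x) - lam t • (s'.dir - gradient F z)‖ ≤ ‖z - s.x‖ + lam t * E := by
      refine (norm_sub_le _ _).trans ?_
      rw [norm_neg, norm_smul, Real.norm_of_nonneg hlt.le, hE]
    rw [e2] at hne
    have h6 : ‖z - prox (lam t) P.r (z - lam t • gradient F z)‖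
        ≤ 4 * β * ε + D + lam t * E := by
      rw [e]
      have := norm_add_le ((z - s.x) - (q - s.x))
        (q - prox (lam t) P.r (z - lam t • gradient F z))
      have := norm_sub_le (z - s.x) (q - s.x)
      linarith
    rw [gradMap, norm_smul, Real.norm_of_nonneg (by positivity), one_div, inv_mul_eq_div,
      div_le_iff₀ hlt]
    refine h6.trans ?_
    have : (D / lam t + 4 * ε + E) * lam t = D + 4 * ε * lam t + E * lam t := by
      field_simp
    rw [this]
    nlinarith [hl t]
  linarith

/-- The gradient mappings at consecutive points `z_t` are comparable. -/
theorem norm_gradMap_iter_succ_le (hL0 : 0 ≤ L)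
    (hL : ∀ x y, ‖gradient F x - gradient F y‖ ≤ L * ‖x - y‖)
    (hr : ConvexOn ℝ Set.univ P.r) (hε : 0 < ε) (hβ : 0 < β) (hβL : β * L ≤ C)
    (hl : ∀ t, β ≤ lam t) (hu : ∀ t, lam t ≤ (1 + alpha t) * β) (t : ℕ) :
    ‖gradMap (lam (t + 1)) F P.r (zPoint (t + 1) (iter P τ ε β lam b x₀ (t + 1)))‖
      ≤ 3 * ‖gradMap (lam t) F P.r (zPoint t (iter P τ ε β lam b x₀ t))‖
        + (14 + 7 * C) * ε := by
  have hz := norm_zPoint_succ_sub_le (P := P) (τ := τ) (b := b) (x₀ := x₀) hε.le hβ hl hu t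
  set z' := zPoint (t + 1) (iter P τ ε β lam b x₀ (t + 1))
  set z := zPoint t (iter P τ ε β lam b x₀ t)
  have hl' : 0 < lam (t + 1) := hβ.trans_le (hl _)
  -- The factor 3 comes from `λ_t ≤ 3β ≤ 3 λ_{t+1}`. The step size is changed first, at fixed `z`;
  -- the point is moved afterwards.
  have h1 := residual_le_of_le hr hl' (hβ.trans_le (hl t)) (c := 3) (by norm_num)
    ((lam_le_three_mul hβ hu t).trans (by linarith [hl (t + 1)])) z (gradient F z)
  set l := lam (t + 1)
  have h2 : ‖gradMap l F P.r z' - gradMap l F P.r z‖ ≤ (14 + 7 * C) * ε := by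
    have hne := norm_prox_sub_prox_le hr hl' (z' - l • gradient F z') (z - l • gradient F z)
    have e1 : z' - l • gradient F z' - (z - l • gradient F z)
      = (z' - z) - l • (gradient F z' - gradient F z) := by module
    have hg : ‖l • (gradient F z' - gradient F z)‖ ≤ l * (L * ‖z' - z‖) := by
      rw [norm_smul, Real.norm_of_nonneg hl'.le]
      gcongr
      exact hL _ _
    rw [e1] at hne
    have hne' := hne.trans (norm_sub_le _ _)
    rw [gradMap, gradMap, ← smul_sub, norm_smul, Real.norm_of_nonneg (by positivity), one_div,
      inv_mul_eq_div, div_le_iff₀ hl']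
    have e2 : z' - prox l P.r (z' - l • gradient F z') - (z - prox l P.r (z - l • gradient F z))
      = (z' - z) - (prox l P.r (z' - l • gradient F z') - prox l P.r (z - l • gradient F z)) := by
      abel
    rw [e2]
    refine (norm_sub_le _ _).trans ?_
    have h3 : l * (L * ‖z' - z‖) ≤ l * (7 * C * ε) := by
      refine mul_le_mul_of_nonneg_left ?_ hl'.le
      have : L * ‖z' - z‖ ≤ L * (7 * β * ε) := by gcongr
      nlinarith
    have h4 : β * ε ≤ l * ε := by gcongr; exact hl _
    nlinarith
  have h3 : ‖gradMap l F P.r z'‖ ≤ ‖gradMap l F P.r z' - gradMap l F P.r z‖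
      + ‖gradMap l F P.r z‖ := by
    simpa using norm_add_le (gradMap l F P.r z' - gradMap l F P.r z) (gradMap l F P.r z)
  unfold gradMap at *
  linarith

/-- The telescoping sum must end at `x_{T-1}`, the start of the next run, so it covers only `t < T -
1`. The last term is at most `3` times its predecessor plus `(14 + 7C)ε`, hence at most `3` times
the covered sum plus that: all constants are multiplied by 4, and `4 * (10 + 15C) + 14 + 7C = 54 +
67C`. -/
theorem sum_norm_gradMap_iter_le (hF : Differentiable ℝ F) (hL0 : 0 ≤ L)
    (hL : ∀ x y, ‖gradient F x - gradient F y‖ ≤ L * ‖x - y‖)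
    (hr : ConvexOn ℝ Set.univ P.r) (hε : 0 < ε) (hβ : 0 < β) (hβL : β * L ≤ C)
    (hl : ∀ t, β ≤ lam t) (hu : ∀ t, lam t ≤ (1 + alpha t) * β) {T : ℕ} (hT : 2 ≤ T) :
    ∑ t ∈ Finset.range T, ‖gradMap (lam t) F P.r (zPoint t (iter P τ ε β lam b x₀ t))‖
      ≤ 4 * (P.obj F x₀ - P.obj F (iter P τ ε β lam b x₀ (T - 1)).x) / (β * ε)
        + (54 + 67 * C) * ε * T
        + 16 * ∑ t ∈ Finset.range T, (iter P τ ε β lam b x₀ (t + 1)).err F := by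
  obtain ⟨k, rfl⟩ : ∃ k, T = k + 2 := ⟨T - 2, by omega⟩
  have hC0 : 0 ≤ C := le_trans (by positivity) hβL
  have h1 := norm_gradMap_iter_succ_le (τ := τ) (b := b) (x₀ := x₀) hL0 hL hr hε hβ hβL hl hu k
  have h2 := Finset.sum_le_sum fun t (_ : t ∈ Finset.range (k + 1)) =>
    norm_gradMap_iter_le (τ := τ) (b := b) (x₀ := x₀) hF hL0 hL hr hε hβ hβL hl hu t
  simp only [Finset.sum_add_distrib, ← Finset.sum_div, Finset.sum_const, Finset.card_range,
    nsmul_eq_mul, ← Finset.mul_sum] at h2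
  rw [Finset.sum_range_sub' (fun t => P.obj F (iter P τ ε β lam b x₀ t).x)] at h2
  have h3 : ‖gradMap (lam k) F P.r (zPoint k (iter P τ ε β lam b x₀ k))‖
      ≤ ∑ t ∈ Finset.range (k + 1),
        ‖gradMap (lam t) F P.r (zPoint t (iter P τ ε β lam b x₀ t))‖ :=
    Finset.single_le_sum (f := fun t =>
      ‖gradMap (lam t) F P.r (zPoint t (iter P τ ε β lam b x₀ t))‖)
      (fun _ _ => norm_nonneg _) (by simp)
  have h4 : ∑ t ∈ Finset.range (k + 1), (iter P τ ε β lam b x₀ (t + 1)).err F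
      ≤ ∑ t ∈ Finset.range (k + 2), (iter P τ ε β lam b x₀ (t + 1)).err F :=
    Finset.sum_le_sum_of_subset_of_nonneg (by simp) fun _ _ _ => norm_nonneg _
  have e0 : (iter P τ ε β lam b x₀ 0).x = x₀ := rfl
  rw [e0] at h2
  rw [Finset.sum_range_succ]
  have e1 : k + 2 - 1 = k + 1 := rfl
  rw [e1, mul_div_assoc]
  push_cast at h2 ⊢
  have h5 : 0 ≤ C * ε := by positivity
  have h6 : (0 : ℝ) ≤ k := k.cast_nonneg
  nlinarith [mul_nonneg h5 h6, mul_nonneg hε.le h6]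

end Iter

/-- Sum of the gradient mappings over all runs. -/
theorem Run.sum_norm_gradMap_le {Ξ : Type u} {H : Type v} {Ω : Type w} {d p : ℕ}
    (R : Run Ξ H Ω d p) {F : Vec d → ℝ} {L C : ℝ} (hF : Differentiable ℝ F) (hL0 : 0 ≤ L)
    (hL : ∀ x y, ‖gradient F x - gradient F y‖ ≤ L * ‖x - y‖)
    (hr : ConvexOn ℝ Set.univ R.P.r) (hbdd : BddBelow (Set.range (R.P.obj F))) (hε : 0 < R.ε)
    (hs : R.StepSizes C L) (hT : 2 ≤ R.T) (b : ℕ → ℕ → Batches Ξ H) :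
    ∑ m ∈ Finset.range R.M, ∑ t ∈ Finset.range R.T, ‖gradMap (R.lam t) F R.P.r (R.z b m t)‖
      ≤ 4 * R.gap F / (R.β * R.ε) + (54 + 67 * C) * R.ε * R.T * R.M
        + 16 * ∑ m ∈ Finset.range R.M, ∑ t ∈ Finset.range R.T,
          (iter R.P R.τ R.ε R.β R.lam (b m) (R.start b m) (t + 1)).err F := by
  have h := Finset.sum_le_sum fun m (_ : m ∈ Finset.range R.M) =>
    sum_norm_gradMap_iter_le (τ := R.τ) (b := b m) (x₀ := R.start b m) hF hL0 hL hr hε hs.β_pos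
      hs.β_le hs.lam_ge hs.lam_le hT
  refine h.trans ?_
  -- The end point of one telescoping sum is by definition the start of the next, so the sums
  -- telescope over `m` too and the initial gap is paid only once.
  have e : ∀ m, (iter R.P R.τ R.ε R.β R.lam (b m) (R.start b m) (R.T - 1)).x = R.start b (m + 1) :=
    fun m => rfl
  simp only [e, Finset.sum_add_distrib, ← Finset.sum_div, ← Finset.mul_sum, Finset.sum_const,
    Finset.card_range, nsmul_eq_mul]
  rw [Finset.sum_range_sub' (fun m => R.P.obj F (R.start b m))]
  have hgap : R.P.obj F (R.start b 0) - R.P.obj F (R.start b R.M) ≤ R.gap F := by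
    have := ciInf_le hbdd (R.start b R.M)
    unfold Run.gap
    have e0 : R.start b 0 = R.x₀ := rfl
    rw [e0]
    linarith
  have hβ := hs.β_pos
  have : 4 * (R.P.obj F (R.start b 0) - R.P.obj F (R.start b R.M)) / (R.β * R.ε)
      ≤ 4 * R.gap F / (R.β * R.ε) := by gcongr
  linarith

/-! ### The Frobenius norm -/

section Frob

variable {d p : ℕ}

theorem frobNorm_nonneg (A : Vec d →L[ℝ] Vec p) : 0 ≤ frobNorm A := Real.sqrt_nonneg _

theorem frobNorm_sq (A : Vec d →L[ℝ] Vec p) :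
    frobNorm A ^ 2 = ∑ i : Fin d, ‖A (EuclideanSpace.single i (1 : ℝ))‖ ^ 2 :=
  Real.sq_sqrt (by positivity)

theorem vec_eq_sum_single (x : Vec d) :
    x = ∑ i, x i • (EuclideanSpace.single i (1 : ℝ) : Vec d) := by
  ext j
  simp [Finset.sum_apply, Pi.single_apply]

theorem norm_le_frobNorm (A : Vec d →L[ℝ] Vec p) : ‖A‖ ≤ frobNorm A := by
  refine A.opNorm_le_bound (frobNorm_nonneg A) fun x => ?_
  conv_lhs => rw [vec_eq_sum_single x]
  rw [map_sum]
  refine (norm_sum_le _ _).trans ?_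
  simp only [map_smul, norm_smul]
  rw [frobNorm, EuclideanSpace.norm_eq, mul_comm]
  exact Real.sum_mul_le_sqrt_mul_sqrt _ _ _

theorem clm_eq_sum_smulRight {V : Type*} [NormedAddCommGroup V] [NormedSpace ℝ V]
    (A : Vec d →L[ℝ] V) :
    A = ∑ i, (EuclideanSpace.proj i : Vec d →L[ℝ] ℝ).smulRight
      (A (EuclideanSpace.single i (1 : ℝ))) := by
  ext x
  conv_lhs => rw [vec_eq_sum_single x]
  simp [map_sum]

end Frob

/-! ### Measurability of derivatives in a parameter -/

/-- Each directional derivative is a pointwise limit of the difference quotients with step `1 / n`,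
and the full derivative is a finite combination of its values on the basis vectors. -/
theorem measurable_fderiv_of_measurable {α V : Type*} [MeasurableSpace α] [NormedAddCommGroup V]
    [NormedSpace ℝ V] [MeasurableSpace V] [BorelSpace V] [SecondCountableTopology V] {d : ℕ}
    {h : α → Vec d → V} (hd : ∀ a, Differentiable ℝ (h a)) (hm : ∀ x, Measurable fun a => h a x)
    (x : Vec d) : Measurable fun a => fderiv ℝ (h a) x := by
  have h1 : ∀ e : Vec d, Measurable fun a => fderiv ℝ (h a) x e := by
    intro e
    refine measurable_of_tendsto_metrizable
      (f := fun (n : ℕ) a => (n : ℝ) • (h a (x + (n : ℝ)⁻¹ • e) - h a x)) (fun n => ?_) ?_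
    · exact ((hm _).sub (hm _)).const_smul _
    · rw [tendsto_pi_nhds]
      intro a
      refine (hd a x).hasFDerivAt.lim e ?_
      simpa using tendsto_natCast_atTop_atTop (R := ℝ)
  have h2 : (fun a => fderiv ℝ (h a) x) = fun a =>
      ∑ i, ContinuousLinearMap.smulRightL ℝ (Vec d) V (EuclideanSpace.proj i : Vec d →L[ℝ] ℝ)
        (fderiv ℝ (h a) x (EuclideanSpace.single i (1 : ℝ))) := by
    funext a
    exact clm_eq_sum_smulRight _
  rw [h2]
  exact Finset.measurable_sum _ fun i _ =>
    (ContinuousLinearMap.continuous _).measurable.comp (h1 _)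

theorem norm_gradient {d : ℕ} (f : Vec d → ℝ) (x : Vec d) :
    ‖gradient f x‖ = ‖fderiv ℝ f x‖ := by
  rw [← toDual_gradient, LinearIsometryEquiv.norm_map]

theorem measurable_gradient_of_measurable {α : Type*} [MeasurableSpace α] {d : ℕ}
    {h : α → Vec d → ℝ} (hd : ∀ a, Differentiable ℝ (h a)) (hm : ∀ x, Measurable fun a => h a x)
    (x : Vec d) : Measurable fun a => gradient (h a) x :=
  (LinearIsometryEquiv.continuous _).measurable.comp (measurable_fderiv_of_measurable hd hm x)

/-! ### Differentiation under the expectation -/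

/-- The common Lipschitz constant dominates all derivatives, and a constant is integrable for a
probability measure. -/
theorem hasFDerivAt_integral_of_lipschitz {α V : Type*} [MeasurableSpace α] {D : Measure α}
    [IsProbabilityMeasure D] [NormedAddCommGroup V] [NormedSpace ℝ V] [MeasurableSpace V]
    [BorelSpace V] [SecondCountableTopology V] [CompleteSpace V] {d : ℕ} {h : α → Vec d → V}
    {K : ℝ≥0} (hd : ∀ a, Differentiable ℝ (h a)) (hm : ∀ x, Measurable fun a => h a x)
    (hi : ∀ x, Integrable (fun a => h a x) D) (hK : ∀ a, LipschitzWith K (h a)) (x : Vec d) :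
    HasFDerivAt (fun x => ∫ a, h a x ∂D) (∫ a, fderiv ℝ (h a) x ∂D) x :=
  (hasFDerivAt_integral_of_dominated_of_fderiv_le (s := Set.univ) (bound := fun _ => (K : ℝ))
    (F := fun x a => h a x) (F' := fun x a => fderiv ℝ (h a) x) Filter.univ_mem
    (.of_forall fun x => (hi x).aestronglyMeasurable) (hi x)
    (measurable_fderiv_of_measurable hd hm x).aestronglyMeasurable
    (.of_forall fun a _ _ => norm_fderiv_le_of_lipschitz ℝ (hK a)) (integrable_const _)
    (.of_forall fun a y _ => (hd a y).hasFDerivAt))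

theorem integrable_fderiv_of_lipschitz {α V : Type*} [MeasurableSpace α] {D : Measure α}
    [IsProbabilityMeasure D] [NormedAddCommGroup V] [NormedSpace ℝ V] [MeasurableSpace V]
    [BorelSpace V] [SecondCountableTopology V] {d : ℕ} {h : α → Vec d → V}
    {K : ℝ≥0} (hd : ∀ a, Differentiable ℝ (h a)) (hm : ∀ x, Measurable fun a => h a x)
    (hK : ∀ a, LipschitzWith K (h a)) (x : Vec d) :
    Integrable (fun a => fderiv ℝ (h a) x) D :=
  Integrable.of_bound (measurable_fderiv_of_measurable hd hm x).aestronglyMeasurable K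
    (.of_forall fun a => norm_fderiv_le_of_lipschitz ℝ (hK a))

theorem norm_integral_le_of_norm_le' {α V : Type*} [MeasurableSpace α] {D : Measure α}
    [IsProbabilityMeasure D] [NormedAddCommGroup V] [NormedSpace ℝ V] {h : α → V} {c : ℝ}
    (hc : ∀ a, ‖h a‖ ≤ c) : ‖∫ a, h a ∂D‖ ≤ c := by
  simpa using norm_integral_le_of_norm_le_const (μ := D) (.of_forall hc)

/-- The expectations defining the composition problem make sense. -/
structure Problem.Averages {Ξ : Type u} {H : Type v} [MeasurableSpace Ξ] [MeasurableSpace H]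
    {d p : ℕ} (P : Problem Ξ H d p) (D : Measure Ξ) (Q : Measure H) : Prop where
  f_meas : ∀ y, Measurable fun η => P.f η y
  g_meas : ∀ x, Measurable fun ξ => P.g ξ x
  f_int : ∀ y, Integrable (fun η => P.f η y) Q
  g_int : ∀ x, Integrable (fun ξ => P.g ξ x) D

/-! ### Smoothness of the averaged maps and of the composition; the error of the direction. -/

section Online

set_option linter.unusedSectionVars false

variable {Ξ : Type u} {H : Type v} [MeasurableSpace Ξ] [MeasurableSpace H] {d p : ℕ}
  {P : Problem Ξ H d p} {D : Measure Ξ} [IsProbabilityMeasure D] {Q : Measure H}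
  [IsProbabilityMeasure Q] {F : Vec d → ℝ} {lf Lf lg Lg : ℝ≥0}

theorem Problem.Averages.hasFDerivAt_meang (hA : P.Averages D Q) (hP : P.Regular F lf Lf lg Lg)
    (x : Vec d) : HasFDerivAt (P.meang D) (∫ ξ, fderiv ℝ (P.g ξ) x ∂D) x :=
  hasFDerivAt_integral_of_lipschitz hP.g_diff hA.g_meas hA.g_int hP.g_lip x

theorem Problem.Averages.fderiv_meang (hA : P.Averages D Q) (hP : P.Regular F lf Lf lg Lg)
    (x : Vec d) : fderiv ℝ (P.meang D) x = ∫ ξ, fderiv ℝ (P.g ξ) x ∂D :=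
  (hA.hasFDerivAt_meang hP x).fderiv

theorem Problem.Averages.differentiable_meang (hA : P.Averages D Q)
    (hP : P.Regular F lf Lf lg Lg) : Differentiable ℝ (P.meang D) :=
  fun x => (hA.hasFDerivAt_meang hP x).differentiableAt

theorem Problem.Averages.norm_fderiv_meang_le (hA : P.Averages D Q)
    (hP : P.Regular F lf Lf lg Lg) (x : Vec d) : ‖fderiv ℝ (P.meang D) x‖ ≤ lg := by
  rw [hA.fderiv_meang hP]
  exact norm_integral_le_of_norm_le' fun ξ => norm_fderiv_le_of_lipschitz ℝ (hP.g_lip ξ)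

theorem Problem.Averages.norm_fderiv_meang_sub_le (hA : P.Averages D Q)
    (hP : P.Regular F lf Lf lg Lg) (x y : Vec d) :
    ‖fderiv ℝ (P.meang D) x - fderiv ℝ (P.meang D) y‖ ≤ Lg * ‖x - y‖ := by
  rw [hA.fderiv_meang hP, hA.fderiv_meang hP, ← integral_sub
    (integrable_fderiv_of_lipschitz hP.g_diff hA.g_meas hP.g_lip x)
    (integrable_fderiv_of_lipschitz hP.g_diff hA.g_meas hP.g_lip y)]
  exact norm_integral_le_of_norm_le' fun ξ =>
    (norm_le_frobNorm _).trans (hP.g_jac_lip ξ x y)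

theorem Problem.Averages.norm_meang_sub_le (hA : P.Averages D Q)
    (hP : P.Regular F lf Lf lg Lg) (x y : Vec d) :
    ‖P.meang D x - P.meang D y‖ ≤ lg * ‖x - y‖ := by
  unfold Problem.meang
  rw [← integral_sub (hA.g_int x) (hA.g_int y)]
  refine norm_integral_le_of_norm_le' fun ξ => ?_
  simpa [dist_eq_norm] using (hP.g_lip ξ).dist_le_mul x y

theorem Problem.Averages.measurable_gradient (hA : P.Averages D Q)
    (hP : P.Regular F lf Lf lg Lg) (y : Vec p) : Measurable fun η => gradient (P.f η) y :=
  measurable_gradient_of_measurable hP.f_diff hA.f_meas y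

theorem Problem.Averages.measurable_fderiv (hA : P.Averages D Q)
    (hP : P.Regular F lf Lf lg Lg) (x : Vec d) : Measurable fun ξ => fderiv ℝ (P.g ξ) x :=
  measurable_fderiv_of_measurable hP.g_diff hA.g_meas x

theorem Problem.Regular.norm_gradient_le (hP : P.Regular F lf Lf lg Lg) (η : H) (y : Vec p) :
    ‖gradient (P.f η) y‖ ≤ lf := by
  rw [norm_gradient]
  exact norm_fderiv_le_of_lipschitz ℝ (hP.f_lip η)

theorem Problem.Averages.integrable_gradient (hA : P.Averages D Q)
    (hP : P.Regular F lf Lf lg Lg) (y : Vec p) :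
    Integrable (fun η => gradient (P.f η) y) Q :=
  Integrable.of_bound (hA.measurable_gradient hP y).aestronglyMeasurable lf
    (.of_forall fun η => hP.norm_gradient_le η y)

theorem Problem.Averages.hasFDerivAt_meanf (hA : P.Averages D Q) (hP : P.Regular F lf Lf lg Lg)
    (y : Vec p) : HasFDerivAt (P.meanf Q) (∫ η, fderiv ℝ (P.f η) y ∂Q) y :=
  hasFDerivAt_integral_of_lipschitz hP.f_diff hA.f_meas hA.f_int hP.f_lip y

theorem Problem.Averages.differentiable_meanf (hA : P.Averages D Q)
    (hP : P.Regular F lf Lf lg Lg) : Differentiable ℝ (P.meanf Q) :=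
  fun x => (hA.hasFDerivAt_meanf hP x).differentiableAt

theorem Problem.Averages.gradient_meanf (hA : P.Averages D Q) (hP : P.Regular F lf Lf lg Lg)
    (y : Vec p) : gradient (P.meanf Q) y = ∫ η, gradient (P.f η) y ∂Q := by
  unfold gradient
  rw [(hA.hasFDerivAt_meanf hP y).fderiv]
  exact ((InnerProductSpace.toDual ℝ (Vec p)).symm.toContinuousLinearEquiv.integral_comp_comm
    _).symm

theorem Problem.Averages.norm_gradient_meanf_le (hA : P.Averages D Q)
    (hP : P.Regular F lf Lf lg Lg) (y : Vec p) : ‖gradient (P.meanf Q) y‖ ≤ lf := by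
  rw [hA.gradient_meanf hP]
  exact norm_integral_le_of_norm_le' fun η => hP.norm_gradient_le η y

theorem Problem.Averages.norm_gradient_meanf_sub_le (hA : P.Averages D Q)
    (hP : P.Regular F lf Lf lg Lg) (x y : Vec p) :
    ‖gradient (P.meanf Q) x - gradient (P.meanf Q) y‖ ≤ Lf * ‖x - y‖ := by
  rw [hA.gradient_meanf hP, hA.gradient_meanf hP, ← integral_sub (hA.integrable_gradient hP x)
    (hA.integrable_gradient hP y)]
  refine norm_integral_le_of_norm_le' fun η => ?_
  simpa [dist_eq_norm] using (hP.f_grad_lip η).dist_le_mul x y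

theorem Problem.Averages.hasGradientAt_onlineF (hA : P.Averages D Q)
    (hP : P.Regular F lf Lf lg Lg) (x : Vec d) :
    HasGradientAt (P.onlineF D Q) (ContinuousLinearMap.adjoint (fderiv ℝ (P.meang D) x)
      (gradient (P.meanf Q) (P.meang D x))) x := by
  rw [hasGradientAt_iff_hasFDerivAt]
  have h := (hA.differentiable_meanf hP (P.meang D x)).hasFDerivAt.comp x
    (hA.differentiable_meang hP x).hasFDerivAt
  refine h.congr_fderiv ?_
  ext e
  simp [ContinuousLinearMap.adjoint_inner_left]

theorem Problem.Averages.gradient_onlineF (hA : P.Averages D Q) (hP : P.Regular F lf Lf lg Lg)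
    (x : Vec d) : gradient (P.onlineF D Q) x =
      ContinuousLinearMap.adjoint (fderiv ℝ (P.meang D) x)
        (gradient (P.meanf Q) (P.meang D x)) :=
  (hA.hasGradientAt_onlineF hP x).gradient

theorem Problem.Averages.differentiable_onlineF (hA : P.Averages D Q)
    (hP : P.Regular F lf Lf lg Lg) : Differentiable ℝ (P.onlineF D Q) :=
  fun x => (hA.hasGradientAt_onlineF hP x).differentiableAt

theorem norm_adjoint_apply_sub_le (A A' : Vec d →L[ℝ] Vec p) (v v' : Vec p) :
    ‖ContinuousLinearMap.adjoint A v - ContinuousLinearMap.adjoint A' v'‖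
      ≤ ‖A - A'‖ * ‖v‖ + ‖A'‖ * ‖v - v'‖ := by
  have e : ContinuousLinearMap.adjoint A v - ContinuousLinearMap.adjoint A' v'
      = ContinuousLinearMap.adjoint (A - A') v + ContinuousLinearMap.adjoint A' (v - v') := by
    simp [map_sub]
  rw [e]
  refine (norm_add_le _ _).trans (add_le_add ?_ ?_)
  · exact (ContinuousLinearMap.le_opNorm _ _).trans (by rw [LinearIsometryEquiv.norm_map])
  · exact (ContinuousLinearMap.le_opNorm _ _).trans (by rw [LinearIsometryEquiv.norm_map])

/-- Product rule for `g'(x)ᵀ ∇f(g(x))`: varying the Jacobian costs `l_f L_g`, varying `∇f ∘ g` costs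
`l_g · L_f l_g`. -/
theorem Problem.Averages.norm_gradient_onlineF_sub_le (hA : P.Averages D Q)
    (hP : P.Regular F lf Lf lg Lg) (x y : Vec d) :
    ‖gradient (P.onlineF D Q) x - gradient (P.onlineF D Q) y‖ ≤ LF lf Lf lg Lg * ‖x - y‖ := by
  rw [hA.gradient_onlineF hP, hA.gradient_onlineF hP]
  refine (norm_adjoint_apply_sub_le _ _ _ _).trans ?_
  have h1 := hA.norm_fderiv_meang_sub_le hP x y
  have h2 := hA.norm_gradient_meanf_le hP (P.meang D x)
  have h3 := hA.norm_fderiv_meang_le hP y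
  have h4 := hA.norm_gradient_meanf_sub_le hP (P.meang D x) (P.meang D y)
  have h5 := hA.norm_meang_sub_le hP x y
  have h6 : ‖gradient (P.meanf Q) (P.meang D x) - gradient (P.meanf Q) (P.meang D y)‖
      ≤ Lf * (lg * ‖x - y‖) := h4.trans (by gcongr)
  calc _ ≤ (Lg * ‖x - y‖) * lf + lg * (Lf * (lg * ‖x - y‖)) := by gcongr
    _ = _ := by unfold LF; ring

theorem LF_nonneg (lf Lf lg Lg : ℝ≥0) : 0 ≤ LF lf Lf lg Lg := by
  unfold LF; positivity

/-- Weighted sum of the squared errors of the three estimators. -/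
def Problem.sqErr (P : Problem Ξ H d p) (D : Measure Ξ) (Q : Measure H) (lf Lf lg : ℝ≥0)
    (s : State d p) : ℝ :=
  lf ^ 2 * frobNorm (s.jEst - fderiv ℝ (P.meang D) s.z) ^ 2
    + lg ^ 2 * ‖s.fEst - gradient (P.meanf Q) s.gEst‖ ^ 2
    + lg ^ 2 * Lf ^ 2 * ‖s.gEst - P.meang D s.z‖ ^ 2

theorem Problem.sqErr_nonneg (s : State d p) : 0 ≤ P.sqErr D Q lf Lf lg s := by
  unfold Problem.sqErr; positivity

/-- With Jacobian, gradient and value errors `a, b, c`, the direction error is at most `a(b + l_f) +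
l_g(b + L_f c)`. After multiplication by `ε`, Young's inequality for each term leaves the weighted
squares and three copies of `ε² / 2`. This reduces the biased product estimator to second moments.
-/
theorem Problem.Averages.err_le (hA : P.Averages D Q) (hP : P.Regular F lf Lf lg Lg) {ε : ℝ}
    (hε : 0 < ε) (hεl : ε ≤ lf * lg) (s : State d p) :
    s.err (P.onlineF D Q) ≤ P.sqErr D Q lf Lf lg s / ε + 3 / 2 * ε := by
  rw [State.err, State.dir, hA.gradient_onlineF hP]
  have h0 := norm_adjoint_apply_sub_le s.jEst (fderiv ℝ (P.meang D) s.z) s.fEst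
    (gradient (P.meanf Q) (P.meang D s.z))
  have h1 := norm_le_frobNorm (s.jEst - fderiv ℝ (P.meang D) s.z)
  have h2 := hA.norm_gradient_meanf_le hP s.gEst
  have h3 := hA.norm_fderiv_meang_le hP s.z
  have h4 := hA.norm_gradient_meanf_sub_le hP s.gEst (P.meang D s.z)
  have h5 : ‖s.fEst‖ ≤ ‖s.fEst - gradient (P.meanf Q) s.gEst‖ + lf := by
    have := norm_add_le (s.fEst - gradient (P.meanf Q) s.gEst) (gradient (P.meanf Q) s.gEst)
    rw [sub_add_cancel] at this
    linarith
  have h6 : ‖s.fEst - gradient (P.meanf Q) (P.meang D s.z)‖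
      ≤ ‖s.fEst - gradient (P.meanf Q) s.gEst‖ + Lf * ‖s.gEst - P.meang D s.z‖ := by
    have := norm_sub_le_norm_sub_add_norm_sub s.fEst (gradient (P.meanf Q) s.gEst)
      (gradient (P.meanf Q) (P.meang D s.z))
    linarith
  unfold Problem.sqErr
  have ha := frobNorm_nonneg (s.jEst - fderiv ℝ (P.meang D) s.z)
  have hb := norm_nonneg (s.fEst - gradient (P.meanf Q) s.gEst)
  have hc := norm_nonneg (s.gEst - P.meang D s.z)
  set a := frobNorm (s.jEst - fderiv ℝ (P.meang D) s.z)
  set b := ‖s.fEst - gradient (P.meanf Q) s.gEst‖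
  set c := ‖s.gEst - P.meang D s.z‖
  have h7 : ‖s.jEst - fderiv ℝ (P.meang D) s.z‖ * ‖s.fEst‖ ≤ a * (b + lf) := by gcongr
  have h8 : ‖fderiv ℝ (P.meang D) s.z‖ * ‖s.fEst - gradient (P.meanf Q) (P.meang D s.z)‖
      ≤ lg * (b + Lf * c) := by gcongr
  -- The only term quadratic in the errors; `ε ≤ l_f l_g` converts it to the weights used in
  -- `sqErr`.
  have h9 : ε * (a * b) ≤ (lf * a) * (lg * b) := by
    have := mul_le_mul_of_nonneg_right hεl (mul_nonneg ha hb)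
    linarith
  refine (h0.trans (add_le_add h7 h8)).trans ?_
  rw [← sub_le_iff_le_add, le_div_iff₀ hε]
  nlinarith [sq_nonneg (lf * a - lg * b), sq_nonneg (lf * a - ε), sq_nonneg (lg * b - ε),
    sq_nonneg (lg * (Lf * c) - ε), sq_nonneg (lg * (Lf * c))]

end Online

/-! ### Variance of minibatch averages -/

/-- A law of `k`-samples whose coordinates have law `D` and are nonpositively correlated. -/
structure IsSamplingLaw {Ξ : Type u} [MeasurableSpace Ξ] (D : Measure Ξ) {k : ℕ}
    (ν : Measure (Fin k → Ξ)) : Prop where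
  prob : IsProbabilityMeasure ν
  marginal : ∀ i, ν.map (fun v => v i) = D
  corr : ∀ i j, i ≠ j → ∀ h : Ξ → ℝ, Measurable h → Integrable (fun x => h x ^ 2) D →
    ∫ x, h x ∂D = 0 → ∫ v, h (v i) * h (v j) ∂ν ≤ 0

section Variance

set_option linter.unusedSectionVars false

variable {Ξ : Type u} [MeasurableSpace Ξ] {D : Measure Ξ} [IsProbabilityMeasure D] {k : ℕ}
  {ν : Measure (Fin k → Ξ)}

/-- Expanding the square, the linear term has mean zero, the off-diagonal terms are nonpositive, and
the `k` diagonal terms contribute `k⁻¹` times the variance. The shift `a` plays the role of the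
error inherited from earlier iterations. -/
theorem IsSamplingLaw.scalar_centered (hν : IsSamplingLaw D ν) (hk : 1 ≤ k) {h : Ξ → ℝ}
    (hm : Measurable h) (hi : Integrable (fun x => h x ^ 2) D) (h0 : ∫ x, h x ∂D = 0) (a : ℝ) :
    Integrable (fun v => (a + (k : ℝ)⁻¹ * ∑ i, h (v i)) ^ 2) ν ∧
    ∫ v, (a + (k : ℝ)⁻¹ * ∑ i, h (v i)) ^ 2 ∂ν
      ≤ a ^ 2 + (k : ℝ)⁻¹ * ∫ x, h x ^ 2 ∂D := by
  have := hν.prob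
  have hL2 : MemLp h 2 D := (memLp_two_iff_integrable_sq hm.aestronglyMeasurable).2 hi
  have hmp : ∀ i, MeasurePreserving (fun v : Fin k → Ξ => v i) ν D :=
    fun i => ⟨measurable_pi_apply i, hν.marginal i⟩
  have hL2i : ∀ i, MemLp (fun v : Fin k → Ξ => h (v i)) 2 ν :=
    fun i => hL2.comp_measurePreserving (hmp i)
  have hI1 : ∀ i, Integrable (fun v : Fin k → Ξ => h (v i)) ν :=
    fun i => (hL2i i).integrable (by norm_num)
  have hI2 : ∀ i j, Integrable (fun v : Fin k → Ξ => h (v i) * h (v j)) ν :=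
    fun i j => (hL2i i).integrable_mul (hL2i j)
  have hexp : ∀ v : Fin k → Ξ, (a + (k : ℝ)⁻¹ * ∑ i, h (v i)) ^ 2
      = a ^ 2 + (2 * a * (k : ℝ)⁻¹) * ∑ i, h (v i)
        + (k : ℝ)⁻¹ ^ 2 * ∑ i, ∑ j, h (v i) * h (v j) := by
    intro v
    rw [← Finset.sum_mul_sum]
    ring
  have hS1 : Integrable (fun v : Fin k → Ξ => ∑ i, h (v i)) ν :=
    integrable_finsetSum _ fun i _ => hI1 i
  have hS2 : Integrable (fun v : Fin k → Ξ => ∑ i, ∑ j, h (v i) * h (v j)) ν :=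
    integrable_finsetSum _ fun i _ => integrable_finsetSum _ fun j _ => hI2 i j
  simp only [hexp]
  have hJ1 : Integrable (fun v : Fin k → Ξ => a ^ 2 + (2 * a * (k : ℝ)⁻¹) * ∑ i, h (v i)) ν :=
    (integrable_const _).add (hS1.const_mul _)
  refine ⟨hJ1.add (hS2.const_mul _), ?_⟩
  rw [integral_add hJ1 (hS2.const_mul _), integral_add (integrable_const _) (hS1.const_mul _),
    integral_const_mul, integral_const_mul, integral_finsetSum _ fun i _ => hI1 i,
    integral_finsetSum _ fun i _ => integrable_finsetSum _ fun j _ => hI2 i j]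
  have e1 : ∀ i, ∫ v, h (v i) ∂ν = 0 := by
    intro i
    rw [← h0, ← hν.marginal i, integral_map (measurable_pi_apply i).aemeasurable
      hm.aestronglyMeasurable]
  have e2 : ∀ i, ∫ v, h (v i) * h (v i) ∂ν = ∫ x, h x ^ 2 ∂D := by
    intro i
    rw [← hν.marginal i, integral_map (measurable_pi_apply i).aemeasurable
      (hm.pow_const 2).aestronglyMeasurable]
    simp only [sq]
  have e3 : ∀ i, ∫ v, ∑ j, h (v i) * h (v j) ∂ν ≤ ∫ x, h x ^ 2 ∂D := by
    intro i
    rw [integral_finsetSum _ fun j _ => hI2 i j, ← e2 i,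
      ← Finset.add_sum_erase _ _ (Finset.mem_univ i)]
    have : ∑ j ∈ Finset.univ.erase i, ∫ v, h (v i) * h (v j) ∂ν ≤ 0 :=
      Finset.sum_nonpos fun j hj =>
        hν.corr i j (Finset.ne_of_mem_erase hj).symm h hm hi h0
    linarith
  have e4 := Finset.sum_le_sum fun i (_ : i ∈ (Finset.univ : Finset (Fin k))) => e3 i
  simp only [Finset.sum_const, Finset.card_univ, Fintype.card_fin, nsmul_eq_mul] at e4
  simp only [e1, Finset.sum_const_zero, mul_zero, add_zero, integral_const, probReal_univ,
    one_smul]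
  have hk0 : (0 : ℝ) < k := by exact_mod_cast hk
  have e5 := mul_le_mul_of_nonneg_left e4 (by positivity : 0 ≤ (k : ℝ)⁻¹ ^ 2)
  have e6 : (k : ℝ)⁻¹ ^ 2 * (k * ∫ x, h x ^ 2 ∂D) = (k : ℝ)⁻¹ * ∫ x, h x ^ 2 ∂D := by
    field_simp
  linarith

/-- Second moment of the error of a shifted minibatch average. -/
theorem IsSamplingLaw.avg_sq_le (hν : IsSamplingLaw D ν) (hk : 1 ≤ k) {p : ℕ} {h : Ξ → Vec p}
    (hm : Measurable h) (hI : Integrable h D)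
    (hi : Integrable (fun x => ‖h x - ∫ y, h y ∂D‖ ^ 2) D) (e : Vec p) :
    Integrable (fun v => ‖e + Batch.avg ⟨k, v⟩ h - ∫ y, h y ∂D‖ ^ 2) ν ∧
    ∫ v, ‖e + Batch.avg ⟨k, v⟩ h - ∫ y, h y ∂D‖ ^ 2 ∂ν
      ≤ ‖e‖ ^ 2 + (k : ℝ)⁻¹ * ∫ x, ‖h x - ∫ y, h y ∂D‖ ^ 2 ∂D := by
  have := hν.prob
  set m := ∫ y, h y ∂D with hmdef
  have hk0 : (k : ℝ) ≠ 0 := by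
    have : 0 < k := hk
    positivity
  have hmc : ∀ c, Measurable fun x => h x c - m c := fun c => by fun_prop
  have hsq : ∀ c, Integrable (fun x => (h x c - m c) ^ 2) D := by
    intro c
    refine hi.mono' ((hmc c).pow_const 2).aestronglyMeasurable (.of_forall fun x => ?_)
    rw [Real.norm_of_nonneg (sq_nonneg _), EuclideanSpace.norm_sq_eq]
    refine le_trans (le_of_eq ?_) (Finset.single_le_sum
      (f := fun c => ‖(h x - m) c‖ ^ 2) (fun _ _ => sq_nonneg _) (Finset.mem_univ c))
    simp
  have hcint : ∀ c, Integrable (fun x => h x c) D := fun c =>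
    (EuclideanSpace.proj c : Vec p →L[ℝ] ℝ).integrable_comp hI
  have hzero : ∀ c, ∫ x, (h x c - m c) ∂D = 0 := by
    intro c
    rw [integral_sub (hcint c) (integrable_const _)]
    have : ∫ x, h x c ∂D = m c :=
      (EuclideanSpace.proj c : Vec p →L[ℝ] ℝ).integral_comp_comm hI
    simp [this]
  -- The mean is moved inside the average, which needs `k ≠ 0`; each coordinate is then an instance
  -- of the centred scalar case.
  have hcoord : ∀ v : Fin k → Ξ, ‖e + Batch.avg ⟨k, v⟩ h - m‖ ^ 2
      = ∑ c, (e c + (k : ℝ)⁻¹ * ∑ i, (h (v i) c - m c)) ^ 2 := by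
    intro v
    rw [EuclideanSpace.norm_sq_eq]
    refine Finset.sum_congr rfl fun c _ => ?_
    rw [Real.norm_eq_abs, sq_abs]
    congr 1
    simp only [Batch.avg, PiLp.sub_apply, PiLp.add_apply, PiLp.smul_apply, WithLp.ofLp_sum,
      Finset.sum_apply, smul_eq_mul, Finset.sum_sub_distrib, Finset.sum_const, Finset.card_univ,
      Fintype.card_fin, nsmul_eq_mul, mul_sub]
    rw [inv_mul_cancel_left₀ hk0]
    ring
  have hmain := fun c => hν.scalar_centered hk (hmc c) (hsq c) (hzero c) (e c)
  simp only [hcoord]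
  refine ⟨integrable_finsetSum _ fun c _ => (hmain c).1, ?_⟩
  rw [integral_finsetSum _ fun c _ => (hmain c).1]
  refine (Finset.sum_le_sum fun c _ => (hmain c).2).trans (le_of_eq ?_)
  rw [Finset.sum_add_distrib, ← Finset.mul_sum, ← integral_finsetSum _ fun c _ => hsq c,
    EuclideanSpace.norm_sq_eq]
  simp [EuclideanSpace.norm_sq_eq]

/-- The variance of a bounded vector is at most the squared bound. -/
theorem integral_norm_sub_integral_sq_le {p : ℕ} {h : Ξ → Vec p}
    (hI : Integrable h D) (hi : Integrable (fun x => ‖h x‖ ^ 2) D) :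
    Integrable (fun x => ‖h x - ∫ y, h y ∂D‖ ^ 2) D ∧
    ∫ x, ‖h x - ∫ y, h y ∂D‖ ^ 2 ∂D ≤ ∫ x, ‖h x‖ ^ 2 ∂D := by
  set m := ∫ y, h y ∂D with hm
  have e : ∀ x, ‖h x - m‖ ^ 2 = ‖h x‖ ^ 2 - 2 * inner ℝ m (h x) + ‖m‖ ^ 2 := by
    intro x
    rw [norm_sub_sq_real, real_inner_comm]
  have hin : Integrable (fun x => 2 * inner ℝ m (h x)) D := (hI.const_inner m).const_mul 2
  have hJ : Integrable (fun x => ‖h x‖ ^ 2 - 2 * inner ℝ m (h x)) D := hi.sub hin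
  simp only [e]
  refine ⟨hJ.add (integrable_const _), ?_⟩
  rw [integral_add hJ (integrable_const _), integral_sub hi hin, integral_const_mul,
    integral_inner hI, ← hm]
  simp only [real_inner_self_eq_norm_sq, integral_const, probReal_univ, one_smul]
  nlinarith [sq_nonneg ‖m‖]

end Variance

/-! ### Sampling laws -/

theorem isSamplingLaw_pi {Ξ : Type u} [MeasurableSpace Ξ] (D : Measure Ξ)
    [IsProbabilityMeasure D] (k : ℕ) : IsSamplingLaw D (Measure.pi fun _ : Fin k => D) where
  prob := inferInstance
  marginal i := (measurePreserving_eval (fun _ : Fin k => D) i).map_eq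
  corr i j hij h hm _ h0 := by
    have hind := (iIndepFun_pi (μ := fun _ : Fin k => D) (X := fun _ => h)
      fun _ => hm.aemeasurable).indepFun hij
    have hmi : ∀ i : Fin k, AEStronglyMeasurable (fun v : Fin k → Ξ => h (v i))
        (Measure.pi fun _ : Fin k => D) :=
      fun i => (hm.comp (measurable_pi_apply i)).aestronglyMeasurable
    rw [hind.integral_fun_mul_eq_mul_integral (hmi i) (hmi j)]
    have : ∫ v, h (v i) ∂(Measure.pi fun _ : Fin k => D) = 0 := by
      rw [← h0, ← (measurePreserving_eval (fun _ : Fin k => D) i).map_eq,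
        integral_map (measurable_pi_apply i).aemeasurable]
      · rw [(measurePreserving_eval (fun _ : Fin k => D) i).map_eq]
      · exact hm.aestronglyMeasurable
    rw [this, zero_mul]

/-- Right multiplication by a transposition shows that `S c` is the same for all `c ≠ a`. All `S c`
together sum to zero because `h` does, while `S a` is a sum of squares; so the common value is
nonpositive. -/
theorem sum_perm_mul_nonpos {n : ℕ} (h : Fin n → ℝ) (h0 : ∑ x, h x = 0) {a b : Fin n}
    (hab : a ≠ b) : ∑ σ : Equiv.Perm (Fin n), h (σ a) * h (σ b) ≤ 0 := by
  set S : Fin n → ℝ := fun c => ∑ σ : Equiv.Perm (Fin n), h (σ a) * h (σ c) with hS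
  have h1 : ∀ c ≠ a, S c = S b := by
    intro c hc
    refine Fintype.sum_equiv (Equiv.mulRight (Equiv.swap b c)) _ _ fun σ => ?_
    simp [Equiv.swap_apply_of_ne_of_ne hab hc.symm]
  have h2 : ∑ c, S c = 0 := by
    rw [hS, Finset.sum_comm]
    refine Finset.sum_eq_zero fun σ _ => ?_
    rw [← Finset.mul_sum, Equiv.sum_comp σ h, h0, mul_zero]
  have h3 : 0 ≤ S a := Finset.sum_nonneg fun σ _ => mul_self_nonneg _
  rw [← Finset.add_sum_erase _ _ (Finset.mem_univ a),
    Finset.sum_congr rfl fun c hc => h1 c (Finset.ne_of_mem_erase hc), Finset.sum_const,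
    nsmul_eq_mul] at h2
  have h4 : 0 < (Finset.univ.erase a).card :=
    Finset.card_pos.2 ⟨b, by simp [hab.symm]⟩
  have h5 : (0 : ℝ) < (Finset.univ.erase a).card := by exact_mod_cast h4
  change S b ≤ 0
  by_contra hcon
  push Not at hcon
  nlinarith

theorem map_uniformOn_equiv {α : Type*} [Finite α] [MeasurableSpace α]
    [DiscreteMeasurableSpace α] {s : Set α} (e : α ≃ α) (he : e ⁻¹' s = s) :
    (uniformOn s).map e = uniformOn s := by
  have hcount : ∀ t : Set α, Measure.count (e ⁻¹' t) = Measure.count t := by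
    intro t
    rw [Measure.count_apply (Set.toFinite _).measurableSet,
      Measure.count_apply (Set.toFinite _).measurableSet]
    rw [Set.encard_preimage_of_bijective e.bijective]
  ext t _
  rw [Measure.map_apply (measurable_of_countable _) (Set.toFinite _).measurableSet, uniformOn,
    cond_apply (Set.toFinite _).measurableSet, cond_apply (Set.toFinite _).measurableSet]
  congr 1
  conv_lhs => rw [← he]
  rw [← Set.preimage_inter, hcount]

/-- Transpositions force all atoms to have equal mass. This identifies the marginals of sampling
without replacement. -/
theorem eq_uniformOn_of_perm_invariant {n : ℕ} (ρ : Measure (Fin n)) [IsProbabilityMeasure ρ]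
    (h : ∀ σ : Equiv.Perm (Fin n), ρ.map σ = ρ) : ρ = uniformOn Set.univ := by
  have hc : ∀ a b, ρ {a} = ρ {b} := by
    intro a b
    conv_lhs => rw [← h (Equiv.swap b a), Measure.map_apply (measurable_of_countable _)
      (measurableSet_singleton _)]
    congr 1
    ext x
    simp [Equiv.swap_apply_eq_iff]
  have hsum : ∀ a, (n : ENNReal) * ρ {a} = 1 := by
    intro a
    rw [← measure_univ (μ := ρ), ← Finset.coe_univ, ← sum_measure_singleton,
      Finset.sum_congr rfl fun b _ => hc b a]
    simp
  refine Measure.ext_of_singleton fun a => ?_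
  rw [uniformOn_univ, Measure.count_singleton, Fintype.card_fin]
  exact (ENNReal.eq_div_iff (by have := a.pos; positivity) (ENNReal.natCast_ne_top n)).2 (hsum a)

/-- Relabelling the population by a permutation preserves the law of an injective sample. Averaging
the correlation over all relabellings therefore changes nothing, and pointwise the average is the
nonpositive permutation sum, since `v i ≠ v j`. -/
theorem isSamplingLaw_injective {n k : ℕ}
    [hp : IsProbabilityMeasure (uniformOn {v : Fin k → Fin n | Function.Injective v})] :
    IsSamplingLaw (uniformOn (Set.univ : Set (Fin n)))
      (uniformOn {v : Fin k → Fin n | Function.Injective v}) := by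
  set ν := uniformOn {v : Fin k → Fin n | Function.Injective v} with hν
  have hinv : ∀ σ : Equiv.Perm (Fin n), ν.map (fun v => σ ∘ v) = ν := by
    intro σ
    refine map_uniformOn_equiv (Equiv.piCongrRight fun _ : Fin k => σ) ?_
    ext v
    exact σ.injective.of_comp_iff v
  refine ⟨hp, fun i => ?_, fun i j hij h hm _ h0 => ?_⟩
  · have : IsProbabilityMeasure (ν.map (fun v => v i)) :=
      Measure.isProbabilityMeasure_map (measurable_pi_apply i).aemeasurable
    refine eq_uniformOn_of_perm_invariant _ fun σ => ?_
    conv_rhs => rw [← hinv σ]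
    have hev : Measurable fun v : Fin k → Fin n => v i := measurable_pi_apply i
    have hcomp : Measurable fun v : Fin k → Fin n => σ ∘ v := measurable_of_countable _
    rw [Measure.map_map (measurable_of_countable _) hev, Measure.map_map hev hcomp]
    rfl
  · have hn : 0 < n := by
      rcases Nat.eq_zero_or_pos n with rfl | hn
      · have : IsEmpty (Fin k → Fin 0) := ⟨fun v => (v i).elim0⟩
        have h1 := hp.measure_univ
        rw [Set.univ_eq_empty_iff.2 inferInstance, measure_empty] at h1
        exact absurd h1 zero_ne_one
      · exact hn
    have : Nonempty (Fin n) := ⟨⟨0, hn⟩⟩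
    have hsum : ∑ x, h x = 0 := by
      rw [integral_fintype Integrable.of_finite] at h0
      have hw : ∀ x : Fin n, (uniformOn (Set.univ : Set (Fin n))).real {x} = (n : ℝ)⁻¹ := by
        intro x
        rw [measureReal_def, uniformOn_univ, Measure.count_singleton, Fintype.card_fin]
        simp
      simp only [hw, smul_eq_mul, ← Finset.mul_sum] at h0
      exact (mul_eq_zero.1 h0).resolve_left (by positivity)
    have hσ : ∀ σ : Equiv.Perm (Fin n), ∫ v, h (σ (v i)) * h (σ (v j)) ∂ν
        = ∫ v, h (v i) * h (v j) ∂ν := by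
      intro σ
      conv_rhs => rw [← hinv σ]
      rw [integral_map (measurable_of_countable _).aemeasurable
        (measurable_of_countable _).aestronglyMeasurable]
      rfl
    have htot : (Fintype.card (Equiv.Perm (Fin n)) : ℝ) * ∫ v, h (v i) * h (v j) ∂ν
        = ∫ v, ∑ σ : Equiv.Perm (Fin n), h (σ (v i)) * h (σ (v j)) ∂ν := by
      rw [integral_finsetSum _ fun σ _ => Integrable.of_finite, Finset.sum_congr rfl fun σ _ => hσ σ]
      simp
    have hle : ∫ v, ∑ σ : Equiv.Perm (Fin n), h (σ (v i)) * h (σ (v j)) ∂ν ≤ 0 := by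
      refine integral_nonpos_of_ae ?_
      have hsupp : ∀ᵐ v ∂ν, v ∈ {v : Fin k → Fin n | Function.Injective v} := by
        rw [hν, uniformOn]
        exact ae_cond_mem (Set.toFinite _).measurableSet
      filter_upwards [hsupp] with v hv
      exact sum_perm_mul_nonpos h hsum (hv.ne hij)
    rw [← htot] at hle
    have hc : (0 : ℝ) < Fintype.card (Equiv.Perm (Fin n)) := by
      exact_mod_cast Fintype.card_pos
    by_contra hcon
    push Not at hcon
    nlinarith [mul_pos hc hcon]

theorem Scheme.isSamplingLaw (S : Scheme) {n k : ℕ} (hn : 1 ≤ n)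
    (hp : IsProbabilityMeasure (S.law n k)) :
    IsSamplingLaw (uniformOn (Set.univ : Set (Fin n))) (S.law n k) := by
  have : Nonempty (Fin n) := ⟨⟨0, hn⟩⟩
  cases S with
  | withReplacement =>
    -- The uniform law on all tuples is the product of the uniform laws.
    have h : Scheme.withReplacement.law n k
        = Measure.pi fun _ : Fin k => uniformOn (Set.univ : Set (Fin n)) := by
      rw [← uniformOn_pi, Set.pi_univ]
      rfl
    rw [h]
    exact isSamplingLaw_pi _ k
  | withoutReplacement => exact isSamplingLaw_injective (hp := hp)

/-! ### Errors of the estimators after one step -/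

theorem lintegral_ofReal_le {α : Type*} [MeasurableSpace α] {μ : Measure α} {f : α → ℝ} {c : ℝ}
    (hf0 : ∀ x, 0 ≤ f x) (hf : Integrable f μ) (hc : ∫ x, f x ∂μ ≤ c) :
    ∫⁻ x, ENNReal.ofReal (f x) ∂μ ≤ ENNReal.ofReal c := by
  rw [← ofReal_integral_eq_lintegral_ofReal hf (.of_forall hf0)]
  exact ENNReal.ofReal_le_ofReal hc

theorem continuous_frobNorm {d p : ℕ} : Continuous (frobNorm : (Vec d →L[ℝ] Vec p) → ℝ) := by
  unfold frobNorm
  fun_prop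

theorem Batch.norm_avg_le {Ξ : Type u} {V : Type*} [NormedAddCommGroup V] [NormedSpace ℝ V]
    (b : Batch Ξ) {h : Ξ → V} {c : ℝ} (hc0 : 0 ≤ c) (hc : ∀ x, ‖h x‖ ≤ c) : ‖b.avg h‖ ≤ c := by
  unfold Batch.avg
  rw [norm_smul, norm_inv, Real.norm_natCast]
  have h1 : ‖∑ i, h (b.2 i)‖ ≤ b.1 * c := by
    refine (norm_sum_le_of_le _ fun i _ => hc _).trans ?_
    simp
  rcases Nat.eq_zero_or_pos b.1 with h0 | h0
  · simp [h0, hc0]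
  · have : (0 : ℝ) < b.1 := by exact_mod_cast h0
    rw [inv_mul_le_iff₀ this]
    exact h1

theorem measurable_avg {Ξ : Type u} [MeasurableSpace Ξ] {V : Type*} [NormedAddCommGroup V]
    [NormedSpace ℝ V] [MeasurableSpace V] [BorelSpace V] [SecondCountableTopology V] {k : ℕ}
    {h : Ξ → V} (hm : Measurable h) :
    Measurable fun v : Fin k → Ξ => Batch.avg ⟨k, v⟩ h := by
  unfold Batch.avg
  have h1 : Measurable fun v : Fin k → Ξ => ∑ i, h (v i) :=
    Finset.measurable_sum _ fun i _ => hm.comp (measurable_pi_apply i)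
  exact h1.const_smul (k : ℝ)⁻¹

/-! ### Second moments of shifted minibatch averages, for vectors and for Jacobians. -/

section Moments

variable {Ξ : Type u} [MeasurableSpace Ξ] {D : Measure Ξ} [IsProbabilityMeasure D] {k : ℕ}
  {ν : Measure (Fin k → Ξ)} {p d : ℕ}

theorem IsSamplingLaw.lintegral_avg_le (hν : IsSamplingLaw D ν) (hk : 1 ≤ k) {h : Ξ → Vec p}
    (hm : Measurable h) (hI : Integrable h D)
    (hi : Integrable (fun x => ‖h x - ∫ y, h y ∂D‖ ^ 2) D) {V : ℝ}
    (hV : ∫ x, ‖h x - ∫ y, h y ∂D‖ ^ 2 ∂D ≤ V) (e : Vec p) :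
    ∫⁻ v, ENNReal.ofReal (‖e + Batch.avg ⟨k, v⟩ h - ∫ y, h y ∂D‖ ^ 2) ∂ν
      ≤ ENNReal.ofReal (‖e‖ ^ 2 + (k : ℝ)⁻¹ * V) := by
  have h1 := hν.avg_sq_le hk hm hI hi e
  refine lintegral_ofReal_le (fun _ => by positivity) h1.1 (h1.2.trans ?_)
  gcongr

theorem IsSamplingLaw.lintegral_avg_le_of_norm_le (hν : IsSamplingLaw D ν) (hk : 1 ≤ k)
    {h : Ξ → Vec p} (hm : Measurable h) {c : ℝ} (hc : ∀ x, ‖h x‖ ≤ c) (e : Vec p) :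
    ∫⁻ v, ENNReal.ofReal (‖e + Batch.avg ⟨k, v⟩ h - ∫ y, h y ∂D‖ ^ 2) ∂ν
      ≤ ENNReal.ofReal (‖e‖ ^ 2 + (k : ℝ)⁻¹ * c ^ 2) := by
  have hI : Integrable h D := Integrable.of_bound hm.aestronglyMeasurable c (.of_forall hc)
  have hc2 : ∀ x, ‖h x‖ ^ 2 ≤ c ^ 2 := fun x => by gcongr; exact hc x
  have hi : Integrable (fun x => ‖h x‖ ^ 2) D :=
    Integrable.of_bound (hm.norm.pow_const 2).aestronglyMeasurable (c ^ 2)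
      (.of_forall fun x => by rw [Real.norm_of_nonneg (by positivity)]; exact hc2 x)
  have h1 := integral_norm_sub_integral_sq_le hI hi
  refine hν.lintegral_avg_le hk hm hI h1.1 (h1.2.trans ?_) e
  calc ∫ x, ‖h x‖ ^ 2 ∂D ≤ ∫ _, c ^ 2 ∂D := integral_mono hi (integrable_const _) hc2
    _ = c ^ 2 := by simp

/-- The squared Frobenius norm is the sum over columns, so the vector estimate applies to each
column without any dimensional factor. -/
theorem IsSamplingLaw.lintegral_avg_frob_le (hν : IsSamplingLaw D ν) (hk : 1 ≤ k)
    {J : Ξ → Vec d →L[ℝ] Vec p} (hm : Measurable J) (hI : Integrable J D)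
    (hi : Integrable (fun x => frobNorm (J x - ∫ y, J y ∂D) ^ 2) D) {V : ℝ}
    (hV : ∫ x, frobNorm (J x - ∫ y, J y ∂D) ^ 2 ∂D ≤ V) (E : Vec d →L[ℝ] Vec p) :
    ∫⁻ v, ENNReal.ofReal (frobNorm (E + Batch.avg ⟨k, v⟩ J - ∫ y, J y ∂D) ^ 2) ∂ν
      ≤ ENNReal.ofReal (frobNorm E ^ 2 + (k : ℝ)⁻¹ * V) := by
  set M := ∫ y, J y ∂D with hM
  let u : Fin d → Vec d := fun i => EuclideanSpace.single i (1 : ℝ)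
  have hMu : ∀ i, M (u i) = ∫ y, J y (u i) ∂D := fun i =>
    ContinuousLinearMap.integral_apply hI (u i)
  have hmu : ∀ i, Measurable fun x => J x (u i) := fun i => hm.apply_continuousLinearMap (u i)
  have hIu : ∀ i, Integrable (fun x => J x (u i)) D := fun i => hI.apply_continuousLinearMap (u i)
  have hiu : ∀ i, Integrable (fun x => ‖J x (u i) - ∫ y, J y (u i) ∂D‖ ^ 2) D := by
    intro i
    refine hi.mono' (((hmu i).sub_const _).norm.pow_const 2).aestronglyMeasurable
      (.of_forall fun x => ?_)
    rw [Real.norm_of_nonneg (by positivity), frobNorm_sq, ← hMu]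
    exact Finset.single_le_sum (f := fun i => ‖(J x - M) (u i)‖ ^ 2)
      (fun _ _ => by positivity) (Finset.mem_univ i)
  have hmain := fun i => hν.avg_sq_le hk (hmu i) (hIu i) (hiu i) (E (u i))
  have hfrob : ∀ v : Fin k → Ξ, frobNorm (E + Batch.avg ⟨k, v⟩ J - M) ^ 2
      = ∑ i, ‖E (u i) + Batch.avg ⟨k, v⟩ (fun x => J x (u i)) - ∫ y, J y (u i) ∂D‖ ^ 2 := by
    intro v
    rw [frobNorm_sq]
    refine Finset.sum_congr rfl fun i _ => ?_
    rw [← hMu]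
    simp [Batch.avg, u]
  simp only [hfrob]
  refine lintegral_ofReal_le (fun _ => by positivity)
    (integrable_finsetSum _ fun i _ => (hmain i).1) ?_
  rw [integral_finsetSum _ fun i _ => (hmain i).1]
  refine (Finset.sum_le_sum fun i _ => (hmain i).2).trans ?_
  rw [Finset.sum_add_distrib, ← Finset.mul_sum, ← integral_finsetSum _ fun i _ => hiu i,
    frobNorm_sq]
  have : ∫ x, ∑ i, ‖J x (u i) - ∫ y, J y (u i) ∂D‖ ^ 2 ∂D ≤ V := by
    refine le_trans (le_of_eq ?_) hV
    congr 1
    funext x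
    rw [frobNorm_sq]
    refine Finset.sum_congr rfl fun i _ => ?_
    rw [← hMu]
    rfl
  gcongr

theorem IsSamplingLaw.lintegral_avg_frob_le_of_norm_le (hν : IsSamplingLaw D ν) (hk : 1 ≤ k)
    {J : Ξ → Vec d →L[ℝ] Vec p} (hm : Measurable J) {c : ℝ} (hc : ∀ x, frobNorm (J x) ≤ c)
    (E : Vec d →L[ℝ] Vec p) :
    ∫⁻ v, ENNReal.ofReal (frobNorm (E + Batch.avg ⟨k, v⟩ J - ∫ y, J y ∂D) ^ 2) ∂ν
      ≤ ENNReal.ofReal (frobNorm E ^ 2 + (k : ℝ)⁻¹ * c ^ 2) := by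
  have hI : Integrable J D := Integrable.of_bound hm.aestronglyMeasurable c
    (.of_forall fun x => (norm_le_frobNorm _).trans (hc x))
  let u : Fin d → Vec d := fun i => EuclideanSpace.single i (1 : ℝ)
  have hMu : ∀ i, (∫ y, J y ∂D) (u i) = ∫ y, J y (u i) ∂D := fun i =>
    ContinuousLinearMap.integral_apply hI (u i)
  have hmu : ∀ i, Measurable fun x => J x (u i) := fun i => hm.apply_continuousLinearMap (u i)
  have hIu : ∀ i, Integrable (fun x => J x (u i)) D := fun i => hI.apply_continuousLinearMap (u i)
  have hc2 : ∀ x, frobNorm (J x) ^ 2 ≤ c ^ 2 := fun x => by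
    gcongr
    · exact frobNorm_nonneg _
    · exact hc x
  have hiu : ∀ i, Integrable (fun x => ‖J x (u i)‖ ^ 2) D := fun i =>
    Integrable.of_bound ((hmu i).norm.pow_const 2).aestronglyMeasurable (c ^ 2)
      (.of_forall fun x => by
        rw [Real.norm_of_nonneg (by positivity)]
        refine le_trans ?_ (hc2 x)
        rw [frobNorm_sq]
        exact Finset.single_le_sum (f := fun i => ‖J x (u i)‖ ^ 2)
          (fun _ _ => by positivity) (Finset.mem_univ i))
  have hmain := fun i => integral_norm_sub_integral_sq_le (hIu i) (hiu i)
  have hfrob : ∀ x, frobNorm (J x - ∫ y, J y ∂D) ^ 2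
      = ∑ i, ‖J x (u i) - ∫ y, J y (u i) ∂D‖ ^ 2 := by
    intro x
    rw [frobNorm_sq]
    refine Finset.sum_congr rfl fun i _ => ?_
    rw [← hMu]
    rfl
  refine hν.lintegral_avg_frob_le hk hm hI ?_ ?_ E
  · simp only [hfrob]
    exact integrable_finsetSum _ fun i _ => (hmain i).1
  · simp only [hfrob]
    rw [integral_finsetSum _ fun i _ => (hmain i).1]
    refine (Finset.sum_le_sum fun i _ => (hmain i).2).trans ?_
    rw [← integral_finsetSum _ fun i _ => hiu i]
    calc ∫ x, ∑ i, ‖J x (u i)‖ ^ 2 ∂D ≤ ∫ _, c ^ 2 ∂D :=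
          integral_mono (integrable_finsetSum _ fun i _ => hiu i) (integrable_const _)
            fun x => (frobNorm_sq (J x)).symm.trans_le (hc2 x)
      _ = c ^ 2 := by simp

end Moments

/-- The term `χ` depends on two batches because the `∇f` samples are evaluated at the freshly
updated `g̃`. Its bound is uniform in the first batch, and since only an upper bound is sought, no
joint measurability of `χ` is required. -/
theorem lintegral_prod_three_le {α β γ : Type*} [MeasurableSpace α] [MeasurableSpace β]
    [MeasurableSpace γ] {μ : Measure α} {ν : Measure β} {ρ : Measure γ} [IsProbabilityMeasure μ]
    [IsProbabilityMeasure ν] [IsProbabilityMeasure ρ] {φ : α → ENNReal} {ψ : β → ENNReal}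
    {χ : α → γ → ENNReal} (hφ : Measurable φ) (hψ : Measurable ψ) {a b c : ENNReal}
    (ha : ∫⁻ x, φ x ∂μ ≤ a) (hb : ∫⁻ y, ψ y ∂ν ≤ b) (hc : ∀ x, ∫⁻ z, χ x z ∂ρ ≤ c) :
    ∫⁻ q, (ψ q.2.1 + χ q.1 q.2.2 + φ q.1) ∂(μ.prod (ν.prod ρ)) ≤ b + c + a := by
  have hφ' : Measurable fun q : α × β × γ => φ q.1 := hφ.comp measurable_fst
  have hψ' : Measurable fun q : α × β × γ => ψ q.2.1 :=
    hψ.comp (measurable_fst.comp measurable_snd)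
  rw [lintegral_add_right _ hφ', lintegral_add_left hψ']
  have h1 : ∫⁻ q : α × β × γ, φ q.1 ∂(μ.prod (ν.prod ρ)) ≤ a := by
    refine (lintegral_prod_le _).trans ?_
    simpa using ha
  have h2 : ∫⁻ q : α × β × γ, ψ q.2.1 ∂(μ.prod (ν.prod ρ)) ≤ b := by
    refine (lintegral_prod_le _).trans ?_
    simp only [lintegral_const, measure_univ, mul_one]
    refine (lintegral_prod_le _).trans ?_
    simpa using hb
  have h3 : ∫⁻ q : α × β × γ, χ q.1 q.2.2 ∂(μ.prod (ν.prod ρ)) ≤ c := by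
    refine (lintegral_prod_le _).trans ?_
    calc ∫⁻ x, ∫⁻ y : β × γ, χ x y.2 ∂(ν.prod ρ) ∂μ ≤ ∫⁻ _, c ∂μ := by
          refine lintegral_mono fun x => (lintegral_prod_le _).trans ?_
          calc ∫⁻ _, ∫⁻ z, χ x z ∂ρ ∂ν ≤ ∫⁻ _, c ∂ν := lintegral_mono fun _ => hc x
            _ = c := by simp
      _ = c := by simp
  exact add_le_add (add_le_add h2 h3) h1

/-- Minibatches given by a triple of samples. -/
def tripleBatches {Ξ : Type u} {H : Type v} {a a' b : ℕ}
    (q : (Fin a → Ξ) × (Fin a' → Ξ) × (Fin b → H)) : Batches Ξ H :=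
  ⟨⟨a, q.1⟩, ⟨a', q.2.1⟩, ⟨b, q.2.2⟩⟩

/-! ### Evolution of the squared error in one iteration. -/

section StepError

variable {Ξ : Type u} {H : Type v} [MeasurableSpace Ξ] [MeasurableSpace H] {d p : ℕ}
  {P : Problem Ξ H d p} {D : Measure Ξ} [IsProbabilityMeasure D] {Q : Measure H}
  [IsProbabilityMeasure Q] {F : Vec d → ℝ} {lf Lf lg Lg : ℝ≥0} {τ : ℕ} {ε β : ℝ} {lam : ℕ → ℝ}
  {t : ℕ} {a a' b : ℕ} {νA : Measure (Fin a → Ξ)} {νJ : Measure (Fin a' → Ξ)}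
  {νB : Measure (Fin b → H)}

theorem lintegral_const_mul_ofReal_le {α : Type*} [MeasurableSpace α] {μ : Measure α} {f : α → ℝ}
    {c r : ℝ} (hc : 0 ≤ c) (h : ∫⁻ x, ENNReal.ofReal (f x) ∂μ ≤ ENNReal.ofReal r) :
    ∫⁻ x, ENNReal.ofReal (c * f x) ∂μ ≤ ENNReal.ofReal (c * r) := by
  simp only [ENNReal.ofReal_mul hc]
  rw [lintegral_const_mul' _ _ ENNReal.ofReal_ne_top]
  gcongr

/-- Each new error is the old one plus a centred minibatch average of increments. The cross terms
vanish, and the variance is at most the squared size of an increment, which is Lipschitz in the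
displacement of `z`, divided by the batch size. -/
theorem Problem.Averages.lintegral_sqErr_step_le (hA : P.Averages D Q)
    (hP : P.Regular F lf Lf lg Lg) (hνA : IsSamplingLaw D νA) (hνJ : IsSamplingLaw D νJ)
    (hνB : IsSamplingLaw Q νB) (ha : 1 ≤ a) (ha' : 1 ≤ a') (hb : 1 ≤ b) (ht : t % τ ≠ 0) {r : ℝ}
    (har : (a : ℝ)⁻¹ ≤ r) (har' : (a' : ℝ)⁻¹ ≤ r) (hbr : (b : ℝ)⁻¹ ≤ r) (s : State d p) :
    ∫⁻ q, ENNReal.ofReal (P.sqErr D Q lf Lf lg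
        (step P τ ε β lam t (tripleBatches q) s)) ∂(νA.prod (νJ.prod νB))
      ≤ ENNReal.ofReal (P.sqErr D Q lf Lf lg s
        + 2 * r * LF lf Lf lg Lg ^ 2 * ‖zPoint t s - s.z‖ ^ 2) := by
  have := hνA.prob
  have := hνJ.prob
  have := hνB.prob
  have hr : 0 ≤ r := le_trans (by positivity) har
  set z := zPoint t s with hz
  set Δ := ‖z - s.z‖ with hΔ
  let gE : (Fin a → Ξ) → Vec p := fun v =>
    s.gEst + Batch.avg ⟨a, v⟩ fun ξ => P.g ξ z - P.g ξ s.z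
  let jE : (Fin a' → Ξ) → (Vec d →L[ℝ] Vec p) := fun v =>
    s.jEst + Batch.avg ⟨a', v⟩ fun ξ => fderiv ℝ (P.g ξ) z - fderiv ℝ (P.g ξ) s.z
  let fE : Vec p → (Fin b → H) → Vec p := fun y v =>
    s.fEst + Batch.avg ⟨b, v⟩ fun η => gradient (P.f η) y - gradient (P.f η) s.gEst
  have hgm : Measurable fun ξ => P.g ξ z - P.g ξ s.z := (hA.g_meas _).sub (hA.g_meas _)
  have hjm : Measurable fun ξ => fderiv ℝ (P.g ξ) z - fderiv ℝ (P.g ξ) s.z :=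
    (hA.measurable_fderiv hP _).sub (hA.measurable_fderiv hP _)
  have hfm : ∀ y, Measurable fun η => gradient (P.f η) y - gradient (P.f η) s.gEst := fun y =>
    (hA.measurable_gradient hP _).sub (hA.measurable_gradient hP _)
  have hgn : ∀ ξ, ‖P.g ξ z - P.g ξ s.z‖ ≤ lg * Δ := fun ξ => by
    simpa [dist_eq_norm] using (hP.g_lip ξ).dist_le_mul z s.z
  -- This bound holds for every batch, not only on average, so the increments of `∇f` are at most
  -- `L_f l_g Δ` whatever `g̃` turns out to be.
  have hgE : ∀ v, ‖gE v - s.gEst‖ ≤ lg * Δ := fun v => by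
    simp only [gE, add_sub_cancel_left]
    exact Batch.norm_avg_le _ (by positivity) hgn
  have hmean_g : ∫ ξ, (P.g ξ z - P.g ξ s.z) ∂D = P.meang D z - P.meang D s.z :=
    integral_sub (hA.g_int _) (hA.g_int _)
  have hmean_j : ∫ ξ, (fderiv ℝ (P.g ξ) z - fderiv ℝ (P.g ξ) s.z) ∂D
      = fderiv ℝ (P.meang D) z - fderiv ℝ (P.meang D) s.z := by
    rw [hA.fderiv_meang hP, hA.fderiv_meang hP]
    exact integral_sub (integrable_fderiv_of_lipschitz hP.g_diff hA.g_meas hP.g_lip _)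
      (integrable_fderiv_of_lipschitz hP.g_diff hA.g_meas hP.g_lip _)
  have hmean_f : ∀ y, ∫ η, (gradient (P.f η) y - gradient (P.f η) s.gEst) ∂Q
      = gradient (P.meanf Q) y - gradient (P.meanf Q) s.gEst := by
    intro y
    rw [hA.gradient_meanf hP, hA.gradient_meanf hP]
    exact integral_sub (hA.integrable_gradient hP _) (hA.integrable_gradient hP _)
  have kA := hνA.lintegral_avg_le_of_norm_le ha hgm hgn (s.gEst - P.meang D s.z)
  have kJ := hνJ.lintegral_avg_frob_le_of_norm_le ha' hjm (fun ξ => hP.g_jac_lip ξ z s.z)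
    (s.jEst - fderiv ℝ (P.meang D) s.z)
  have kB : ∀ v, _ := fun v => hνB.lintegral_avg_le_of_norm_le hb (hfm (gE v))
    (c := Lf * (lg * Δ)) (fun η => by
      have := (hP.f_grad_lip η).dist_le_mul (gE v) s.gEst
      rw [dist_eq_norm, dist_eq_norm] at this
      exact this.trans (by gcongr; exact hgE v)) (s.fEst - gradient (P.meanf Q) s.gEst)
  simp only [hmean_g] at kA
  simp only [hmean_j] at kJ
  simp only [hmean_f] at kB
  have kA' := lintegral_const_mul_ofReal_le (c := (lg : ℝ) ^ 2 * Lf ^ 2) (by positivity) kA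
  have kJ' := lintegral_const_mul_ofReal_le (c := (lf : ℝ) ^ 2) (by positivity) kJ
  have kB' := fun v => lintegral_const_mul_ofReal_le (c := (lg : ℝ) ^ 2) (by positivity) (kB v)
  have hmA : Measurable fun v : Fin a → Ξ => ENNReal.ofReal ((lg : ℝ) ^ 2 * Lf ^ 2 *
      ‖s.gEst - P.meang D s.z + Batch.avg ⟨a, v⟩ (fun ξ => P.g ξ z - P.g ξ s.z)
        - (P.meang D z - P.meang D s.z)‖ ^ 2) :=
    (((((measurable_avg hgm).const_add _).sub_const _).norm.pow_const 2).const_mul _).ennreal_ofReal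
  have hmJ : Measurable fun v : Fin a' → Ξ => ENNReal.ofReal ((lf : ℝ) ^ 2 *
      frobNorm (s.jEst - fderiv ℝ (P.meang D) s.z
        + Batch.avg ⟨a', v⟩ (fun ξ => fderiv ℝ (P.g ξ) z - fderiv ℝ (P.g ξ) s.z)
        - (fderiv ℝ (P.meang D) z - fderiv ℝ (P.meang D) s.z)) ^ 2) :=
    (((continuous_frobNorm.measurable.comp
      (((measurable_avg hjm).const_add _).sub_const _)).pow_const 2).const_mul _).ennreal_ofReal
  have hmain := lintegral_prod_three_le hmA hmJ kA' kJ' kB'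
  refine le_trans (lintegral_mono fun q => ?_) (hmain.trans ?_)
  · rw [← ENNReal.ofReal_add (by positivity) (by positivity),
      ← ENNReal.ofReal_add (by positivity) (by positivity)]
    refine ENNReal.ofReal_le_ofReal (le_of_eq ?_)
    have e1 : (step P τ ε β lam t (tripleBatches q) s).gEst = gE q.1 := by
      simp only [step, if_neg ht]; rfl
    have e2 : (step P τ ε β lam t (tripleBatches q) s).jEst = jE q.2.1 := by
      simp only [step, if_neg ht]; rfl
    have e3 : (step P τ ε β lam t (tripleBatches q) s).fEst = fE (gE q.1) q.2.2 := by
      simp only [step, if_neg ht]; rfl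
    have f1 : jE q.2.1 - fderiv ℝ (P.meang D) z = s.jEst - fderiv ℝ (P.meang D) s.z
        + Batch.avg ⟨a', q.2.1⟩ (fun ξ => fderiv ℝ (P.g ξ) z - fderiv ℝ (P.g ξ) s.z)
        - (fderiv ℝ (P.meang D) z - fderiv ℝ (P.meang D) s.z) := by
      simp only [jE]
      abel
    have f2 : fE (gE q.1) q.2.2 - gradient (P.meanf Q) (gE q.1)
        = s.fEst - gradient (P.meanf Q) s.gEst
          + Batch.avg ⟨b, q.2.2⟩ (fun η => gradient (P.f η) (gE q.1) - gradient (P.f η) s.gEst)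
          - (gradient (P.meanf Q) (gE q.1) - gradient (P.meanf Q) s.gEst) := by
      simp only [fE]
      abel
    have f3 : gE q.1 - P.meang D z = s.gEst - P.meang D s.z
        + Batch.avg ⟨a, q.1⟩ (fun ξ => P.g ξ z - P.g ξ s.z)
        - (P.meang D z - P.meang D s.z) := by
      simp only [gE]
      abel
    rw [Problem.sqErr, e1, e2, e3, step_z, ← hz, f1, f2, f3]
  · rw [← ENNReal.ofReal_add (by positivity) (by positivity),
      ← ENNReal.ofReal_add (by positivity) (by positivity)]
    refine ENNReal.ofReal_le_ofReal ?_
    unfold Problem.sqErr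
    have i1 : (a : ℝ)⁻¹ * (lg * Δ) ^ 2 ≤ r * (lg * Δ) ^ 2 := by gcongr
    have i2 : (a' : ℝ)⁻¹ * (Lg * Δ) ^ 2 ≤ r * (Lg * Δ) ^ 2 := by gcongr
    have i3 : (b : ℝ)⁻¹ * (Lf * (lg * Δ)) ^ 2 ≤ r * (Lf * (lg * Δ)) ^ 2 := by gcongr
    have j1 := mul_le_mul_of_nonneg_left i1 (by positivity : 0 ≤ (lg : ℝ) ^ 2 * Lf ^ 2)
    have j2 := mul_le_mul_of_nonneg_left i2 (by positivity : 0 ≤ (lf : ℝ) ^ 2)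
    have j3 := mul_le_mul_of_nonneg_left i3 (by positivity : 0 ≤ (lg : ℝ) ^ 2)
    -- The factor 2 is needed because the `g` and `∇f` parts both contribute `l_g⁴ L_f²`.
    have j4 : (lf : ℝ) ^ 2 * (r * (Lg * Δ) ^ 2) + lg ^ 2 * (r * (Lf * (lg * Δ)) ^ 2)
        + lg ^ 2 * Lf ^ 2 * (r * (lg * Δ) ^ 2) ≤ 2 * r * LF lf Lf lg Lg ^ 2 * Δ ^ 2 := by
      have : 0 ≤ r * Δ ^ 2 * (((lf : ℝ) * Lg) ^ 2 + 4 * (lf * Lg) * (lg ^ 2 * Lf)) := by positivity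
      unfold LF
      nlinarith
    nlinarith

/-- At a restart nothing is inherited: the same averaging bounds apply with zero shift, and the
variances enter in place of Lipschitz increments. -/
theorem Problem.Averages.lintegral_sqErr_restart_le (hA : P.Averages D Q)
    (hP : P.Regular F lf Lf lg Lg) (hνA : IsSamplingLaw D νA) (hνJ : IsSamplingLaw D νJ)
    (hνB : IsSamplingLaw Q νB) (ha : 1 ≤ a) (ha' : 1 ≤ a') (hb : 1 ≤ b) (ht : t % τ = 0)
    {σg σJ σf : ℝ} (hV : P.BoundedVariance D Q σg σJ σf) (s : State d p) :
    ∫⁻ q, ENNReal.ofReal (P.sqErr D Q lf Lf lg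
        (step P τ ε β lam t (tripleBatches q) s)) ∂(νA.prod (νJ.prod νB))
      ≤ ENNReal.ofReal (lf ^ 2 * ((a' : ℝ)⁻¹ * σJ ^ 2) + lg ^ 2 * ((b : ℝ)⁻¹ * σf ^ 2)
        + lg ^ 2 * Lf ^ 2 * ((a : ℝ)⁻¹ * σg ^ 2)) := by
  have := hνA.prob
  have := hνJ.prob
  have := hνB.prob
  set z := zPoint t s with hz
  let gE : (Fin a → Ξ) → Vec p := fun v => Batch.avg ⟨a, v⟩ fun ξ => P.g ξ z
  have hgm : Measurable fun ξ => P.g ξ z := hA.g_meas _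
  have hjm : Measurable fun ξ => fderiv ℝ (P.g ξ) z := hA.measurable_fderiv hP _
  have hmean_g : ∫ ξ, P.g ξ z ∂D = P.meang D z := rfl
  have hmean_j : ∫ ξ, fderiv ℝ (P.g ξ) z ∂D = fderiv ℝ (P.meang D) z :=
    (hA.fderiv_meang hP z).symm
  have hmean_f : ∀ y, ∫ η, gradient (P.f η) y ∂Q = gradient (P.meanf Q) y :=
    fun y => (hA.gradient_meanf hP y).symm
  have kA := hνA.lintegral_avg_le ha hgm (hA.g_int _) (hV.g_var_int z) (hV.g_var z) 0
  have kJ := hνJ.lintegral_avg_frob_le (V := σJ ^ 2) ha' hjm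
    (integrable_fderiv_of_lipschitz hP.g_diff hA.g_meas hP.g_lip _)
    (by rw [hmean_j]; exact hV.jac_var_int z) (by rw [hmean_j]; exact hV.jac_var z) 0
  have kB := fun v => hνB.lintegral_avg_le (V := σf ^ 2) hb (hA.measurable_gradient hP (gE v))
    (hA.integrable_gradient hP _) (by rw [hmean_f]; exact hV.f_var_int (gE v))
    (by rw [hmean_f]; exact hV.f_var (gE v)) 0
  have hfrob0 : frobNorm (0 : Vec d →L[ℝ] Vec p) = 0 := by simp [frobNorm]
  simp only [hmean_g, zero_add, norm_zero, ne_eq, OfNat.ofNat_ne_zero, not_false_eq_true,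
    zero_pow] at kA
  simp only [hmean_j, zero_add, hfrob0, ne_eq, OfNat.ofNat_ne_zero, not_false_eq_true,
    zero_pow] at kJ
  simp only [hmean_f, zero_add, norm_zero, ne_eq, OfNat.ofNat_ne_zero, not_false_eq_true,
    zero_pow] at kB
  have kA' := lintegral_const_mul_ofReal_le (c := (lg : ℝ) ^ 2 * Lf ^ 2) (by positivity) kA
  have kJ' := lintegral_const_mul_ofReal_le (c := (lf : ℝ) ^ 2) (by positivity) kJ
  have kB' := fun v => lintegral_const_mul_ofReal_le (c := (lg : ℝ) ^ 2) (by positivity) (kB v)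
  have hmA : Measurable fun v : Fin a → Ξ => ENNReal.ofReal ((lg : ℝ) ^ 2 * Lf ^ 2 *
      ‖Batch.avg ⟨a, v⟩ (fun ξ => P.g ξ z) - P.meang D z‖ ^ 2) :=
    ((((measurable_avg hgm).sub_const _).norm.pow_const 2).const_mul _).ennreal_ofReal
  have hmJ : Measurable fun v : Fin a' → Ξ => ENNReal.ofReal ((lf : ℝ) ^ 2 *
      frobNorm (Batch.avg ⟨a', v⟩ (fun ξ => fderiv ℝ (P.g ξ) z)
        - fderiv ℝ (P.meang D) z) ^ 2) :=
    (((continuous_frobNorm.measurable.comp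
      ((measurable_avg hjm).sub_const _)).pow_const 2).const_mul _).ennreal_ofReal
  have hmain := lintegral_prod_three_le hmA hmJ kA' kJ' kB'
  refine le_trans (lintegral_mono fun q => ?_) (hmain.trans ?_)
  · rw [← ENNReal.ofReal_add (by positivity) (by positivity),
      ← ENNReal.ofReal_add (by positivity) (by positivity)]
    refine ENNReal.ofReal_le_ofReal (le_of_eq ?_)
    have e1 : (step P τ ε β lam t (tripleBatches q) s).gEst = gE q.1 := by
      simp only [step, if_pos ht]; rfl
    have e2 : (step P τ ε β lam t (tripleBatches q) s).jEst
        = Batch.avg ⟨a', q.2.1⟩ fun ξ => fderiv ℝ (P.g ξ) z := by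
      simp only [step, if_pos ht]; rfl
    have e3 : (step P τ ε β lam t (tripleBatches q) s).fEst
        = Batch.avg ⟨b, q.2.2⟩ fun η => gradient (P.f η) (gE q.1) := by
      simp only [step, if_pos ht]; rfl
    rw [Problem.sqErr, e1, e2, e3, step_z, ← hz]
  · rw [← ENNReal.ofReal_add (by positivity) (by positivity),
      ← ENNReal.ofReal_add (by positivity) (by positivity)]

end StepError

/-! ### Measurability of the iteration -/

section StateMeas

variable {d p : ℕ}

/-- The components of a state. -/
def State.toProd (s : State d p) :
    Vec d × Vec d × Vec d × Vec p × (Vec d →L[ℝ] Vec p) × Vec p :=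
  (s.x, s.y, s.z, s.gEst, s.jEst, s.fEst)

instance : MeasurableSpace (State d p) := MeasurableSpace.comap State.toProd inferInstance

theorem measurable_toProd : Measurable (State.toProd : State d p → _) := comap_measurable _

theorem State.measurable_x : Measurable (State.x : State d p → _) :=
  measurable_fst.comp measurable_toProd

theorem State.measurable_y : Measurable (State.y : State d p → _) :=
  (measurable_fst.comp measurable_snd).comp measurable_toProd

theorem State.measurable_z : Measurable (State.z : State d p → _) :=
  (measurable_fst.comp (measurable_snd.comp measurable_snd)).comp measurable_toProd

theorem State.measurable_gEst : Measurable (State.gEst : State d p → _) :=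
  (measurable_fst.comp (measurable_snd.comp (measurable_snd.comp measurable_snd))).comp
    measurable_toProd

theorem State.measurable_jEst : Measurable (State.jEst : State d p → _) :=
  (measurable_fst.comp (measurable_snd.comp (measurable_snd.comp (measurable_snd.comp
    measurable_snd)))).comp measurable_toProd

theorem State.measurable_fEst : Measurable (State.fEst : State d p → _) :=
  (measurable_snd.comp (measurable_snd.comp (measurable_snd.comp (measurable_snd.comp
    measurable_snd)))).comp measurable_toProd

theorem State.measurable_of_components {α : Type*} [MeasurableSpace α] {s : α → State d p}
    (hx : Measurable fun a => (s a).x) (hy : Measurable fun a => (s a).y)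
    (hz : Measurable fun a => (s a).z) (hg : Measurable fun a => (s a).gEst)
    (hj : Measurable fun a => (s a).jEst) (hf : Measurable fun a => (s a).fEst) :
    Measurable s := by
  rw [measurable_comap_iff]
  exact hx.prodMk (hy.prodMk (hz.prodMk (hg.prodMk (hj.prodMk hf))))

theorem measurable_zPoint (t : ℕ) : Measurable (zPoint t : State d p → Vec d) :=
  (State.measurable_y.const_smul (1 - alpha (t + 1))).add
    (State.measurable_x.const_smul (alpha (t + 1)))

end StateMeas

/-- A family of minibatches depending measurably on a parameter, as far as averages of
jointly measurable functions can tell. -/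
def MeasurableBatch {Ξ : Type u} [MeasurableSpace Ξ] {α : Type*} [MeasurableSpace α]
    (b : α → Batch Ξ) : Prop :=
  ∃ (k : ℕ) (w : α → Fin k → Ξ), Measurable w ∧ ∀ a, b a = ⟨k, w a⟩

theorem MeasurableBatch.measurable_avg {Ξ : Type u} [MeasurableSpace Ξ] {α : Type*}
    [MeasurableSpace α] {b : α → Batch Ξ} (hb : MeasurableBatch b) {V : Type*}
    [NormedAddCommGroup V] [NormedSpace ℝ V] [MeasurableSpace V] [BorelSpace V]
    [SecondCountableTopology V] {h : α → Ξ → V} (hh : Measurable (Function.uncurry h)) :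
    Measurable fun a => (b a).avg (h a) := by
  obtain ⟨k, w, hw, hbw⟩ := hb
  have e : (fun a => (b a).avg (h a)) = fun a => (k : ℝ)⁻¹ • ∑ i, h a (w a i) := by
    funext a
    rw [hbw a]
    rfl
  rw [e]
  have h1 : Measurable fun a => ∑ i, h a (w a i) :=
    Finset.measurable_sum _ fun i _ => hh.comp
      (measurable_id.prodMk ((measurable_pi_apply i).comp hw))
  exact h1.const_smul (k : ℝ)⁻¹

section StepMeas

set_option linter.unusedSectionVars false

variable {Ξ : Type u} {H : Type v} [MeasurableSpace Ξ] [MeasurableSpace H] {d p : ℕ}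
  {P : Problem Ξ H d p} {D : Measure Ξ} {Q : Measure H} {F : Vec d → ℝ} {lf Lf lg Lg : ℝ≥0}

theorem continuous_of_norm_sub_le {E V : Type*} [SeminormedAddCommGroup E]
    [SeminormedAddCommGroup V] {f : E → V} {K : ℝ} (h : ∀ x y, ‖f x - f y‖ ≤ K * ‖x - y‖) :
    Continuous f := by
  refine (LipschitzWith.of_dist_le' (K := K) fun x y => ?_).continuous
  simpa [dist_eq_norm] using h x y

/-- Continuity in the point and measurability in the sample give joint measurability. It is needed
because samples are evaluated at random points. -/
theorem Problem.Averages.measurable_uncurry_g (hA : P.Averages D Q)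
    (hP : P.Regular F lf Lf lg Lg) :
    Measurable (Function.uncurry fun (x : Vec d) (ξ : Ξ) => P.g ξ x) :=
  measurable_uncurry_of_continuous_of_measurable (fun ξ => (hP.g_lip ξ).continuous) hA.g_meas

theorem Problem.Averages.measurable_uncurry_gradient (hA : P.Averages D Q)
    (hP : P.Regular F lf Lf lg Lg) :
    Measurable (Function.uncurry fun (y : Vec p) (η : H) => gradient (P.f η) y) :=
  measurable_uncurry_of_continuous_of_measurable (fun η => (hP.f_grad_lip η).continuous)
    (measurable_gradient_of_measurable hP.f_diff hA.f_meas)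

theorem Problem.Averages.measurable_uncurry_fderiv (hA : P.Averages D Q)
    (hP : P.Regular F lf Lf lg Lg) :
    Measurable (Function.uncurry fun (x : Vec d) (ξ : Ξ) => fderiv ℝ (P.g ξ) x) :=
  measurable_uncurry_of_continuous_of_measurable
    (fun ξ => continuous_of_norm_sub_le fun x y =>
      (norm_le_frobNorm _).trans (hP.g_jac_lip ξ x y))
    (measurable_fderiv_of_measurable hP.g_diff hA.g_meas)

theorem continuous_adjoint_apply : Continuous fun q : (Vec d →L[ℝ] Vec p) × Vec p =>
    ContinuousLinearMap.adjoint q.1 q.2 := by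
  have h : Continuous fun A : Vec d →L[ℝ] Vec p => ContinuousLinearMap.adjoint A :=
    LinearIsometryEquiv.continuous _
  exact (h.comp continuous_fst).clm_apply continuous_snd

theorem measurable_adjoint_apply : Measurable fun q : (Vec d →L[ℝ] Vec p) × Vec p =>
    ContinuousLinearMap.adjoint q.1 q.2 := continuous_adjoint_apply.measurable

theorem measurable_uncurry_comp {α E X V : Type*} [MeasurableSpace α] [MeasurableSpace E]
    [MeasurableSpace X] [MeasurableSpace V] {h : E → X → V} {y : α → E}
    (hh : Measurable (Function.uncurry h)) (hy : Measurable y) :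
    Measurable (Function.uncurry fun a x => h (y a) x) :=
  hh.comp ((hy.comp measurable_fst).prodMk measurable_snd)

section Components

variable {α : Type*} [MeasurableSpace α] {τ : ℕ} {ε β : ℝ} {lam : ℕ → ℝ} {t : ℕ}
  {b : α → Batches Ξ H} {s : α → State d p}

theorem Problem.Averages.measurable_step_gEst (hA : P.Averages D Q)
    (hP : P.Regular F lf Lf lg Lg) (hbA : MeasurableBatch fun a => (b a).A) (hs : Measurable s) :
    Measurable fun a => (step P τ ε β lam t (b a) (s a)).gEst := by
  have hz : Measurable fun a => zPoint t (s a) := (measurable_zPoint t).comp hs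
  have hsz : Measurable fun a => (s a).z := State.measurable_z.comp hs
  have hsg : Measurable fun a => (s a).gEst := State.measurable_gEst.comp hs
  have hg := hA.measurable_uncurry_g hP
  by_cases ht : t % τ = 0
  · simp only [step, if_pos ht]
    exact hbA.measurable_avg (h := fun a ξ => P.g ξ (zPoint t (s a)))
      (measurable_uncurry_comp hg hz)
  · simp only [step, if_neg ht]
    exact hsg.add (hbA.measurable_avg
      (h := fun a ξ => P.g ξ (zPoint t (s a)) - P.g ξ (s a).z)
      ((measurable_uncurry_comp hg hz).sub (measurable_uncurry_comp hg hsz)))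

theorem Problem.Averages.measurable_step_jEst (hA : P.Averages D Q)
    (hP : P.Regular F lf Lf lg Lg) (hbJ : MeasurableBatch fun a => (b a).AJ)
    (hs : Measurable s) : Measurable fun a => (step P τ ε β lam t (b a) (s a)).jEst := by
  have hz : Measurable fun a => zPoint t (s a) := (measurable_zPoint t).comp hs
  have hsz : Measurable fun a => (s a).z := State.measurable_z.comp hs
  have hsj : Measurable fun a => (s a).jEst := State.measurable_jEst.comp hs
  have hj := hA.measurable_uncurry_fderiv hP
  by_cases ht : t % τ = 0
  · simp only [step, if_pos ht]
    exact hbJ.measurable_avg (h := fun a ξ => fderiv ℝ (P.g ξ) (zPoint t (s a)))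
      (measurable_uncurry_comp hj hz)
  · simp only [step, if_neg ht]
    exact hsj.add (hbJ.measurable_avg
      (h := fun a ξ => fderiv ℝ (P.g ξ) (zPoint t (s a)) - fderiv ℝ (P.g ξ) (s a).z)
      ((measurable_uncurry_comp hj hz).sub (measurable_uncurry_comp hj hsz)))

theorem step_fEst_of_eq {b : Batches Ξ H} {s : State d p} (ht : t % τ = 0) :
    (step P τ ε β lam t b s).fEst
      = b.B.avg fun η => gradient (P.f η) (step P τ ε β lam t b s).gEst := by
  simp only [step, if_pos ht]

theorem step_fEst_of_ne {b : Batches Ξ H} {s : State d p} (ht : t % τ ≠ 0) :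
    (step P τ ε β lam t b s).fEst = s.fEst + b.B.avg fun η =>
      gradient (P.f η) (step P τ ε β lam t b s).gEst - gradient (P.f η) s.gEst := by
  simp only [step, if_neg ht]

theorem Problem.Averages.measurable_step_fEst (hA : P.Averages D Q)
    (hP : P.Regular F lf Lf lg Lg) (hbA : MeasurableBatch fun a => (b a).A)
    (hbB : MeasurableBatch fun a => (b a).B) (hs : Measurable s) :
    Measurable fun a => (step P τ ε β lam t (b a) (s a)).fEst := by
  have hgE := hA.measurable_step_gEst (τ := τ) (ε := ε) (β := β) (lam := lam) (t := t) hP hbA hs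
  have hsg : Measurable fun a => (s a).gEst := State.measurable_gEst.comp hs
  have hsf : Measurable fun a => (s a).fEst := State.measurable_fEst.comp hs
  have hf := hA.measurable_uncurry_gradient hP
  by_cases ht : t % τ = 0
  · simp only [step_fEst_of_eq ht]
    exact hbB.measurable_avg
      (h := fun a η => gradient (P.f η) (step P τ ε β lam t (b a) (s a)).gEst)
      (measurable_uncurry_comp hf hgE)
  · simp only [step_fEst_of_ne ht]
    exact hsf.add (hbB.measurable_avg
      (h := fun a η => gradient (P.f η) (step P τ ε β lam t (b a) (s a)).gEst
        - gradient (P.f η) (s a).gEst)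
      ((measurable_uncurry_comp hf hgE).sub (measurable_uncurry_comp hf hsg)))

theorem Problem.Averages.measurable_step_dir (hA : P.Averages D Q)
    (hP : P.Regular F lf Lf lg Lg) (hbA : MeasurableBatch fun a => (b a).A)
    (hbJ : MeasurableBatch fun a => (b a).AJ) (hbB : MeasurableBatch fun a => (b a).B)
    (hs : Measurable s) : Measurable fun a => (step P τ ε β lam t (b a) (s a)).dir :=
  measurable_adjoint_apply.comp (f := fun a =>
      ((step P τ ε β lam t (b a) (s a)).jEst, (step P τ ε β lam t (b a) (s a)).fEst))
    ((hA.measurable_step_jEst hP hbJ hs).prodMk (hA.measurable_step_fEst hP hbA hbB hs))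

theorem Problem.Averages.measurable_step_x (hA : P.Averages D Q)
    (hP : P.Regular F lf Lf lg Lg) (hl : 0 < lam t) (hbA : MeasurableBatch fun a => (b a).A)
    (hbJ : MeasurableBatch fun a => (b a).AJ) (hbB : MeasurableBatch fun a => (b a).B)
    (hs : Measurable s) : Measurable fun a => (step P τ ε β lam t (b a) (s a)).x := by
  have hsx : Measurable fun a => (s a).x := State.measurable_x.comp hs
  have hdir := hA.measurable_step_dir (τ := τ) (ε := ε) (β := β) (lam := lam) (t := t) hP hbA
    hbJ hbB hs
  have e : ∀ a, (step P τ ε β lam t (b a) (s a)).x = (s a).x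
      + min (ε * lam t / ‖prox (lam t) P.r ((s a).x - lam t •
          (step P τ ε β lam t (b a) (s a)).dir) - (s a).x‖) (1 / 2) •
        (prox (lam t) P.r ((s a).x - lam t • (step P τ ε β lam t (b a) (s a)).dir)
          - (s a).x) := fun a => by
    rw [← step_x_sub]; abel
  have hq : Measurable fun a =>
      prox (lam t) P.r ((s a).x - lam t • (step P τ ε β lam t (b a) (s a)).dir) :=
    (continuous_prox hP.r_convex hl).measurable.comp (hsx.sub (hdir.const_smul (lam t)))
  have h1 := (hq.sub hsx).norm
  rw [funext e]
  exact hsx.add (((measurable_const.div h1).min measurable_const).smul (hq.sub hsx))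

theorem Problem.Averages.measurable_step (hA : P.Averages D Q) (hP : P.Regular F lf Lf lg Lg)
    (hl : 0 < lam t) (hbA : MeasurableBatch fun a => (b a).A)
    (hbJ : MeasurableBatch fun a => (b a).AJ) (hbB : MeasurableBatch fun a => (b a).B)
    (hs : Measurable s) : Measurable fun a => step P τ ε β lam t (b a) (s a) := by
  have hz : Measurable fun a => zPoint t (s a) := (measurable_zPoint t).comp hs
  have hsx : Measurable fun a => (s a).x := State.measurable_x.comp hs
  have hx := hA.measurable_step_x (τ := τ) (ε := ε) (β := β) (lam := lam) (t := t) hP hl hbA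
    hbJ hbB hs
  have hy : Measurable fun a => (step P τ ε β lam t (b a) (s a)).y :=
    hz.add ((hx.sub hsx).const_smul (β / lam t))
  exact State.measurable_of_components hx hy hz (hA.measurable_step_gEst hP hbA hs)
    (hA.measurable_step_jEst hP hbJ hs) (hA.measurable_step_fEst hP hbA hbB hs)

end Components

theorem Problem.Averages.measurable_sqErr [IsProbabilityMeasure D] [IsProbabilityMeasure Q]
    (hA : P.Averages D Q) (hP : P.Regular F lf Lf lg Lg) :
    Measurable (P.sqErr D Q lf Lf lg) := by
  have h1 : Continuous (fderiv ℝ (P.meang D)) :=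
    continuous_of_norm_sub_le (hA.norm_fderiv_meang_sub_le hP)
  have h2 : Continuous (gradient (P.meanf Q)) :=
    continuous_of_norm_sub_le (hA.norm_gradient_meanf_sub_le hP)
  have h3 : Continuous (P.meang D) := continuous_of_norm_sub_le (hA.norm_meang_sub_le hP)
  have hz := State.measurable_z (d := d) (p := p)
  have hg := State.measurable_gEst (d := d) (p := p)
  refine Measurable.add (Measurable.add ?_ ?_) ?_
  · exact ((continuous_frobNorm.measurable.comp
      (State.measurable_jEst.sub (h1.measurable.comp hz))).pow_const 2).const_mul _
  · exact ((State.measurable_fEst.sub (h2.measurable.comp hg)).norm.pow_const 2).const_mul _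
  · exact ((hg.sub (h3.measurable.comp hz)).norm.pow_const 2).const_mul _

end StepMeas

/-! ### Runs as adapted processes -/

section RunProcess

variable {Ξ : Type u} {H : Type v} {Ω : Type w} {d p : ℕ}

/-- The drawn samples, except that the given minibatches (if any) are used when `τ ∣ t`. -/
def Run.selBatches (R : Run Ξ H Ω d p) (full : Option (Batches Ξ H)) (ω : Ω) (m t : ℕ) :
    Batches Ξ H :=
  if t % R.τ = 0 then full.getD (R.drawnBatches ω m t) else R.drawnBatches ω m t

theorem Run.drawnBatches_eq_selBatches (R : Run Ξ H Ω d p) :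
    R.drawnBatches = R.selBatches none := by
  funext ω m t
  simp [Run.selBatches]

theorem Run.sumBatches_eq_selBatches {N n : ℕ} (R : Run (Fin n) (Fin N) Ω d p) :
    R.sumBatches = R.selBatches (some ⟨⟨n, id⟩, ⟨n, id⟩, ⟨N, id⟩⟩) := by
  funext ω m t
  simp [Run.selBatches, Run.sumBatches]

/-- The state at the start of iteration `t` of run `m`. -/
def Run.state (R : Run Ξ H Ω d p) (full : Option (Batches Ξ H)) (m t : ℕ) (ω : Ω) : State d p :=
  iter R.P R.τ R.ε R.β R.lam (R.selBatches full ω m) (R.start (R.selBatches full ω) m) t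

/-- One iteration as a function of the state and of the samples drawn. -/
def Run.next (R : Run Ξ H Ω d p) (full : Option (Batches Ξ H)) (t : ℕ)
    (q : State d p × (Fin (R.a t) → Ξ) × (Fin (R.aJ t) → Ξ) × (Fin (R.b t) → H)) : State d p :=
  step R.P R.τ R.ε R.β R.lam t
    (if t % R.τ = 0 then full.getD (tripleBatches q.2) else tripleBatches q.2) q.1

/-- The samples drawn in iteration `t` of run `m`. -/
def Run.drawn (R : Run Ξ H Ω d p) (m t : ℕ) :
    Ω → (Fin (R.a t) → Ξ) × (Fin (R.aJ t) → Ξ) × (Fin (R.b t) → H) := R.draw (m, t)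

theorem Run.state_succ (R : Run Ξ H Ω d p) (full : Option (Batches Ξ H)) (m t : ℕ) :
    R.state full m (t + 1) = fun ω => R.next full t (R.state full m t ω, R.drawn m t ω) := rfl

variable [MeasurableSpace Ξ] [MeasurableSpace H] {R : Run Ξ H Ω d p}
  {full : Option (Batches Ξ H)} {D : Measure Ξ} {Q : Measure H} {F : Vec d → ℝ}
  {lf Lf lg Lg : ℝ≥0}

theorem Run.measurable_next (hA : R.P.Averages D Q) (hP : R.P.Regular F lf Lf lg Lg)
    {t : ℕ} (hl : 0 < R.lam t) : Measurable (R.next full t) := by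
  have h1 : Measurable fun q : State d p × (Fin (R.a t) → Ξ) × (Fin (R.aJ t) → Ξ)
      × (Fin (R.b t) → H) => q.2 := measurable_snd
  by_cases hfull : t % R.τ = 0 ∧ full ≠ none
  · obtain ⟨ht, hne⟩ := hfull
    obtain ⟨b, rfl⟩ := Option.ne_none_iff_exists'.1 hne
    have e : R.next (some b) t = fun q => step R.P R.τ R.ε R.β R.lam t b q.1 := by
      funext q
      rw [Run.next, if_pos ht, Option.getD_some]
    rw [e]
    exact hA.measurable_step hP hl ⟨_, fun _ => b.A.2, measurable_const, fun _ => rfl⟩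
      ⟨_, fun _ => b.AJ.2, measurable_const, fun _ => rfl⟩
      ⟨_, fun _ => b.B.2, measurable_const, fun _ => rfl⟩ measurable_fst
  · have e : R.next full t = fun q => step R.P R.τ R.ε R.β R.lam t (tripleBatches q.2) q.1 := by
      funext q
      unfold Run.next
      split_ifs with ht
      · have : full = none := by
          by_contra hne
          exact hfull ⟨ht, hne⟩
        simp [this]
      · rfl
    rw [e]
    exact hA.measurable_step hP hl
      ⟨_, fun q => q.2.1, measurable_fst.comp h1, fun _ => rfl⟩
      ⟨_, fun q => q.2.2.1, measurable_fst.comp (measurable_snd.comp h1), fun _ => rfl⟩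
      ⟨_, fun q => q.2.2.2, measurable_snd.comp (measurable_snd.comp h1), fun _ => rfl⟩
      measurable_fst

/-- The σ-algebra of the samples drawn before iteration `t` of run `m`. -/
@[reducible]
def Run.past (R : Run Ξ H Ω d p) (m t : ℕ) : MeasurableSpace Ω :=
  ⨆ q ∈ {q : ℕ × ℕ | q.1 < m ∨ q.1 = m ∧ q.2 < t}, MeasurableSpace.comap (R.draw q) inferInstance

theorem Run.past_mono {m t m' t' : ℕ} (h : m < m' ∨ m = m' ∧ t ≤ t') :
    R.past m t ≤ R.past m' t' := by
  refine biSup_mono fun q hq => ?_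
  simp only [Set.mem_ofPred_eq] at hq ⊢
  omega

theorem Run.comap_draw_le_past (m t : ℕ) :
    MeasurableSpace.comap (R.drawn m t) inferInstance ≤ R.past m (t + 1) :=
  le_biSup (fun q => MeasurableSpace.comap (R.draw q) inferInstance)
    (show (m, t) ∈ {q : ℕ × ℕ | q.1 < m ∨ q.1 = m ∧ q.2 < t + 1} by simp)

theorem Run.measurable_state_of_start (hA : R.P.Averages D Q) (hP : R.P.Regular F lf Lf lg Lg)
    (hl : ∀ t, 0 < R.lam t) {m : ℕ}
    (hm : Measurable[R.past m 0] fun ω => R.start (R.selBatches full ω) m) (t : ℕ) :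
    Measurable[R.past m t] (R.state full m t) := by
  induction t with
  | zero =>
    exact @State.measurable_of_components _ _ _ (R.past m 0) _ hm hm hm
      (@measurable_const _ _ _ (R.past m 0) _) (@measurable_const _ _ _ (R.past m 0) _)
      (@measurable_const _ _ _ (R.past m 0) _)
  | succ t ih =>
    have h1 : Measurable[R.past m (t + 1)] (R.state full m t) :=
      ih.mono (Run.past_mono (Or.inr ⟨rfl, Nat.le_succ t⟩)) le_rfl
    have h2 : Measurable[R.past m (t + 1)] (R.drawn m t) :=
      (comap_measurable _).mono (Run.comap_draw_le_past m t) le_rfl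
    rw [Run.state_succ]
    exact (Run.measurable_next hA hP (hl t)).comp
      (Measurable.prodMk h1 h2)

/-- A starting point is a function of the samples of all earlier runs only, by induction over the
runs; `past` orders the draws lexicographically. -/
theorem Run.measurable_start (hA : R.P.Averages D Q) (hP : R.P.Regular F lf Lf lg Lg)
    (hl : ∀ t, 0 < R.lam t) (m : ℕ) :
    Measurable[R.past m 0] fun ω => R.start (R.selBatches full ω) m := by
  induction m with
  | zero => exact @measurable_const _ _ _ (R.past 0 0) _
  | succ m ih =>
    have h := Run.measurable_state_of_start hA hP hl ih (R.T - 1)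
    exact State.measurable_x.comp (h.mono (Run.past_mono (Or.inl (Nat.lt_succ_self m))) le_rfl)

theorem Run.measurable_state (hA : R.P.Averages D Q) (hP : R.P.Regular F lf Lf lg Lg)
    (hl : ∀ t, 0 < R.lam t) (m t : ℕ) : Measurable[R.past m t] (R.state full m t) :=
  Run.measurable_state_of_start hA hP hl (Run.measurable_start hA hP hl m) t

variable [mΩ : MeasurableSpace Ω] {μ : Measure Ω}
  {lawA : (k : ℕ) → Measure (Fin k → Ξ)} {lawB : (k : ℕ) → Measure (Fin k → H)}

theorem Run.Sampled.past_le (hS : R.Sampled μ lawA lawB) (m t : ℕ) : R.past m t ≤ mΩ :=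
  iSup₂_le fun q _ => (hS.draw_meas q).comap_le

theorem Run.Sampled.measurable_drawn (hS : R.Sampled μ lawA lawB) (m t : ℕ) :
    Measurable (R.drawn m t) := hS.draw_meas (m, t)

theorem Run.Sampled.map_drawn (hS : R.Sampled μ lawA lawB) (m t : ℕ) :
    μ.map (R.drawn m t) = (lawA (R.a t)).prod ((lawA (R.aJ t)).prod (lawB (R.b t))) :=
  hS.draw_law (m, t)

/-- The state is measurable with respect to draws with index preceding `(m, t)`, a set disjoint from
`{(m, t)}`. This independence takes the place of conditional expectations. -/
theorem Run.Sampled.indepFun_state (hS : R.Sampled μ lawA lawB) (hA : R.P.Averages D Q)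
    (hP : R.P.Regular F lf Lf lg Lg) (hl : ∀ t, 0 < R.lam t) (m t : ℕ) :
    IndepFun (R.state full m t) (R.drawn m t) μ := by
  have h := indep_iSup_of_disjoint (μ := μ)
    (m := fun q => MeasurableSpace.comap (R.draw q) inferInstance)
    (fun q => (hS.draw_meas q).comap_le) hS.draw_indep
    (S := {q : ℕ × ℕ | q.1 < m ∨ q.1 = m ∧ q.2 < t}) (T := {(m, t)})
    (by simp)
  rw [IndepFun_iff_Indep]
  refine indep_of_indep_of_le_left (indep_of_indep_of_le_right h ?_) ?_
  · exact le_biSup (fun q => MeasurableSpace.comap (R.draw q) inferInstance)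
      (Set.mem_singleton (m, t))
  · exact (Run.measurable_state hA hP hl m t).comap_le

/-- Integration over the samples of one iteration. -/
theorem Run.Sampled.lintegral_state_succ_le (hS : R.Sampled μ lawA lawB)
    (hA : R.P.Averages D Q) (hP : R.P.Regular F lf Lf lg Lg) (hl : ∀ t, 0 < R.lam t)
    [IsProbabilityMeasure μ] {φ : State d p → ENNReal} (hφ : Measurable φ) (m t : ℕ)
    {ψ : State d p → ENNReal} (hψ : ∀ s, ∫⁻ q, φ (R.next full t (s, q))
      ∂((lawA (R.a t)).prod ((lawA (R.aJ t)).prod (lawB (R.b t)))) ≤ ψ s) :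
    ∫⁻ ω, φ (R.state full m (t + 1) ω) ∂μ ≤ ∫⁻ ω, ψ (R.state full m t ω) ∂μ := by
  have hst : Measurable (R.state full m t) :=
    (Run.measurable_state hA hP hl m t).mono (hS.past_le m t) le_rfl
  have hpair := (indepFun_iff_map_prod_eq_prod_map_map hst.aemeasurable
    (hS.measurable_drawn m t).aemeasurable).1 (hS.indepFun_state (full := full) hA hP hl m t)
  have : IsProbabilityMeasure (μ.map (R.drawn m t)) :=
    Measure.isProbabilityMeasure_map (hS.measurable_drawn m t).aemeasurable
  have hnext : Measurable (R.next full t) := Run.measurable_next hA hP (hl t)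
  calc ∫⁻ ω, φ (R.state full m (t + 1) ω) ∂μ
      = ∫⁻ q, φ (R.next full t q)
          ∂(μ.map fun ω => (R.state full m t ω, R.drawn m t ω)) := by
        rw [lintegral_map (f := fun q => φ (R.next full t q)) (hφ.comp hnext)
          (hst.prodMk (hS.measurable_drawn m t))]
        rw [Run.state_succ]
    _ = ∫⁻ q, φ (R.next full t q)
          ∂((μ.map (R.state full m t)).prod (μ.map (R.drawn m t))) := by rw [hpair]
    _ ≤ ∫⁻ s, ∫⁻ q, φ (R.next full t (s, q)) ∂(μ.map (R.drawn m t))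
          ∂(μ.map (R.state full m t)) := lintegral_prod_le _
    _ ≤ ∫⁻ s, ψ s ∂(μ.map (R.state full m t)) := by
        refine lintegral_mono fun s => ?_
        rw [hS.map_drawn m t]
        exact hψ s
    -- As only an inequality is required, `ψ` need not be measurable.
    _ ≤ ∫⁻ ω, ψ (R.state full m t ω) ∂μ := lintegral_map_le _ _

/-- Second moments of the estimation errors along a run. -/
theorem Run.Sampled.lintegral_sqErr_le (hS : R.Sampled μ lawA lawB)
    [IsProbabilityMeasure μ] [IsProbabilityMeasure D] [IsProbabilityMeasure Q]
    (hA : R.P.Averages D Q) (hP : R.P.Regular F lf Lf lg Lg) {C : ℝ}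
    (hstep : R.StepSizes C (LF lf Lf lg Lg)) (hε : 0 ≤ R.ε) {c₀ c₁ : ℝ} (hc₀ : 0 ≤ c₀)
    (hc₁ : 0 ≤ c₁)
    (hrestart : ∀ t, t % R.τ = 0 → ∀ s,
      ∫⁻ q, ENNReal.ofReal (R.P.sqErr D Q lf Lf lg (R.next full t (s, q)))
        ∂((lawA (R.a t)).prod ((lawA (R.aJ t)).prod (lawB (R.b t)))) ≤ ENNReal.ofReal c₀)
    (hrec : ∀ t, t % R.τ ≠ 0 → ∀ s,
      ∫⁻ q, ENNReal.ofReal (R.P.sqErr D Q lf Lf lg (R.next full t (s, q)))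
        ∂((lawA (R.a t)).prod ((lawA (R.aJ t)).prod (lawB (R.b t))))
        ≤ ENNReal.ofReal (R.P.sqErr D Q lf Lf lg s + c₁ * ‖zPoint t s - s.z‖ ^ 2)) (m t : ℕ) :
    ∫⁻ ω, ENNReal.ofReal (R.P.sqErr D Q lf Lf lg (R.state full m (t + 1) ω)) ∂μ
      ≤ ENNReal.ofReal (c₀ + (t % R.τ : ℕ) * (c₁ * (7 * R.β * R.ε) ^ 2)) := by
  have hl : ∀ t, 0 < R.lam t := fun t => hstep.β_pos.trans_le (hstep.lam_ge t)
  have hmeas : Measurable fun s => ENNReal.ofReal (R.P.sqErr D Q lf Lf lg s) :=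
    (hA.measurable_sqErr hP).ennreal_ofReal
  induction t with
  | zero =>
    have h := hS.lintegral_state_succ_le (full := full) hA hP hl hmeas m 0
      (hrestart 0 (Nat.zero_mod _))
    refine h.trans ?_
    simp
  | succ t ih =>
    by_cases ht : (t + 1) % R.τ = 0
    · have h := hS.lintegral_state_succ_le (full := full) hA hP hl hmeas m (t + 1)
        (hrestart (t + 1) ht)
      refine h.trans ?_
      simp [ht]
    · have h := hS.lintegral_state_succ_le (full := full) hA hP hl hmeas m (t + 1)
        (hrec (t + 1) ht)
      -- Away from restarts the number of accumulated increments grows by exactly one. The state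
      -- indexed `t + 1` holds the estimators formed in iteration `t`, whence `t % R.τ` in the
      -- bound.
      have hmod : (t + 1) % R.τ = t % R.τ + 1 := by
        rcases Nat.eq_zero_or_pos R.τ with h0 | h0
        · simp [h0]
        · rcases Nat.lt_or_ge (t % R.τ + 1) R.τ with h1 | h1
          · rw [Nat.add_mod, Nat.mod_eq_of_lt (show 1 < R.τ by omega), Nat.mod_eq_of_lt h1]
          · exfalso
            apply ht
            have h2 := Nat.mod_lt t h0
            have h3 : t % R.τ + 1 = R.τ := by omega
            rw [Nat.add_mod]
            rcases Nat.lt_or_ge 1 R.τ with h4 | h4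
            · rw [Nat.mod_eq_of_lt h4, h3, Nat.mod_self]
            · have : R.τ = 1 := by omega
              simp [this, Nat.mod_one]
      refine h.trans ?_
      have hz : ∀ ω, ‖zPoint (t + 1) (R.state full m (t + 1) ω)
          - (R.state full m (t + 1) ω).z‖ ≤ 7 * R.β * R.ε := fun ω =>
        norm_zPoint_succ_sub_le (P := R.P) (τ := R.τ) (b := R.selBatches full ω m)
          (x₀ := R.start (R.selBatches full ω) m) hε hstep.β_pos hstep.lam_ge hstep.lam_le t
      calc _ ≤ ∫⁻ ω, (ENNReal.ofReal (R.P.sqErr D Q lf Lf lg (R.state full m (t + 1) ω))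
              + ENNReal.ofReal (c₁ * (7 * R.β * R.ε) ^ 2)) ∂μ := by
            refine lintegral_mono fun ω => ?_
            rw [← ENNReal.ofReal_add (Problem.sqErr_nonneg _) (by positivity)]
            refine ENNReal.ofReal_le_ofReal ?_
            gcongr
            exact hz ω
        _ ≤ ENNReal.ofReal (c₀ + (t % R.τ : ℕ) * (c₁ * (7 * R.β * R.ε) ^ 2))
              + ENNReal.ofReal (c₁ * (7 * R.β * R.ε) ^ 2) := by
            rw [lintegral_add_right _ measurable_const]
            simp only [lintegral_const, measure_univ, mul_one]
            gcongr
        _ = _ := by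
            rw [← ENNReal.ofReal_add (by positivity) (by positivity), hmod]
            congr 1
            push_cast
            ring

/-- Averaging over the random output index. -/
theorem Run.Sampled.lintegral_output_le (hS : R.Sampled μ lawA lawB) [IsProbabilityMeasure μ]
    (hM : 1 ≤ R.M) (hT : 1 ≤ R.T) {N : ℕ → ℕ → Ω → ENNReal}
    (hN : ∀ m t, Measurable[R.past m t] (N m t)) :
    ∫⁻ ω, N (R.δ ω) (R.ζ ω) ω ∂μ
      = ((R.M : ENNReal) * R.T)⁻¹
        * ∑ m ∈ Finset.range R.M, ∑ t ∈ Finset.range R.T, ∫⁻ ω, N m t ω ∂μ := by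
  set O : Ω → ℕ × ℕ := fun ω => (R.ζ ω, R.δ ω) with hO
  have hOm : Measurable O := hS.out_meas
  have hpast : ∀ m t, R.past m t ≤ MeasurableSpace.comap (fun ω q => R.draw q ω) inferInstance := by
    intro m t
    refine iSup₂_le fun q _ => ?_
    rw [← measurable_iff_comap_le]
    exact (measurable_pi_apply q).comp (comap_measurable (fun ω q => R.draw q ω))
  have hNm : ∀ m t, Measurable (N m t) := fun m t => (hN m t).mono (hS.past_le m t) le_rfl
  have huni : ∀ k j : ℕ, j < k → uniformOn (Set.Iio k) {j} = (k : ENNReal)⁻¹ := by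
    intro k j hj
    have e1 : (Set.Iio k : Set ℕ) = (Finset.range k : Finset ℕ) := by ext; simp
    have e2 : ({j} : Set ℕ) = (({j} : Finset ℕ) : Set ℕ) := by simp
    rw [e1, e2, uniformOn_apply_finset, Finset.inter_singleton_of_mem (by simpa using hj)]
    simp
  have hprobT : IsProbabilityMeasure (uniformOn (Set.Iio R.T)) :=
    isProbabilityMeasure_uniformOn (Set.finite_Iio _) ⟨0, hT⟩
  have hprobM : IsProbabilityMeasure (uniformOn (Set.Iio R.M)) :=
    isProbabilityMeasure_uniformOn (Set.finite_Iio _) ⟨0, hM⟩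
  have hmass : ∀ m < R.M, ∀ t < R.T, μ (O ⁻¹' {(t, m)}) = ((R.M : ENNReal) * R.T)⁻¹ := by
    intro m hm t ht
    rw [← Measure.map_apply hOm (measurableSet_singleton _), hS.out_law, ← Set.singleton_prod_singleton,
      Measure.prod_prod, huni _ _ ht, huni _ _ hm, mul_comm,
      ENNReal.mul_inv (Or.inr (ENNReal.natCast_ne_top _)) (Or.inl (ENNReal.natCast_ne_top _))]
  have hsupp : ∀ᵐ ω ∂μ, R.ζ ω < R.T ∧ R.δ ω < R.M := by
    have h1 : ∀ᵐ o ∂(μ.map O), o.1 < R.T ∧ o.2 < R.M := by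
      rw [hS.out_law]
      have hp : ((uniformOn (Set.Iio R.T)).prod (uniformOn (Set.Iio R.M)))
          (Set.Iio R.T ×ˢ Set.Iio R.M) = 1 := by
        rw [Measure.prod_prod, uniformOn_self (Set.finite_Iio _) ⟨0, hT⟩,
          uniformOn_self (Set.finite_Iio _) ⟨0, hM⟩, one_mul]
      have := (prob_compl_eq_zero_iff (measurableSet_Iio.prod measurableSet_Iio)).2 hp
      filter_upwards [measure_eq_zero_iff_ae_notMem.1 this] with o ho
      simpa using ho
    exact ae_of_ae_map hOm.aemeasurable h1
  -- Splitting by the value of the output index reduces the claim to fixed `(m, t)`, where the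
  -- indicator is independent of the trajectory.
  have hsplit : ∀ᵐ ω ∂μ, N (R.δ ω) (R.ζ ω) ω = ∑ m ∈ Finset.range R.M, ∑ t ∈ Finset.range R.T,
      (Set.indicator {(t, m)} (fun _ => (1 : ENNReal)) (O ω)) * N m t ω := by
    filter_upwards [hsupp] with ω hω
    rw [Finset.sum_eq_single (R.δ ω), Finset.sum_eq_single (R.ζ ω)]
    · simp [hO]
    · intro t _ ht
      simp [hO, Set.indicator, ht.symm]
    · simp [hω.1]
    · intro m _ hm
      refine Finset.sum_eq_zero fun t _ => ?_
      simp [hO, Set.indicator, hm.symm]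
    · simp [hω.2]
  rw [lintegral_congr_ae hsplit]
  have hind : ∀ m t, Measurable fun ω =>
      (Set.indicator {(t, m)} (fun _ => (1 : ENNReal)) (O ω)) := fun m t =>
    (measurable_const.indicator (measurableSet_singleton _)).comp hOm
  have hmul : ∀ m t, Measurable fun ω =>
      (Set.indicator {(t, m)} (fun _ => (1 : ENNReal)) (O ω)) * N m t ω :=
    fun m t => (hind m t).mul (hNm m t)
  rw [lintegral_finsetSum _ fun m _ => Finset.measurable_sum _ fun t _ => hmul m t,
    Finset.mul_sum]
  refine Finset.sum_congr rfl fun m hm => ?_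
  rw [lintegral_finsetSum _ fun t _ => hmul m t, Finset.mul_sum]
  refine Finset.sum_congr rfl fun t ht => ?_
  -- `N m t` depends on draws only, and the output index is independent of the whole family of
  -- draws.
  have hindep : IndepFun (fun ω => Set.indicator {(t, m)} (fun _ => (1 : ENNReal)) (O ω))
      (N m t) μ := by
    have h0 := hS.out_indep
    rw [IndepFun_iff_Indep] at h0 ⊢
    refine indep_of_indep_of_le_left (indep_of_indep_of_le_right h0 ?_) ?_
    · exact (hN m t).comap_le.trans (hpast m t)
    · rw [← measurable_iff_comap_le]
      exact (measurable_const.indicator (measurableSet_singleton (t, m))).comp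
        (comap_measurable O)
  have hprod := lintegral_mul_eq_lintegral_mul_lintegral_of_indepFun (hind m t) (hNm m t) hindep
  simp only [Pi.mul_apply] at hprod
  rw [hprod]
  congr 1
  rw [← hmass m (Finset.mem_range.1 hm) t (Finset.mem_range.1 ht),
    ← lintegral_indicator_one (hOm (measurableSet_singleton _))]
  rfl

end RunProcess

/-! ### Convergence rate -/

/-- The constant of the convergence rate, in terms of the constant of the hyperparameters. -/
def rateConst (C : ℝ) : ℝ := 78 + 67 * C + 16 * (3 * C + 98 * C ^ 3)

theorem four_le_rateConst {C : ℝ} (hC : 1 ≤ C) : 4 ≤ rateConst C := by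
  unfold rateConst
  have : 0 ≤ C ^ 3 := by positivity
  linarith

theorem Run.gap_nonneg {Ξ : Type u} {H : Type v} {Ω : Type w} {d p : ℕ} {R : Run Ξ H Ω d p}
    {F : Vec d → ℝ} (hbdd : BddBelow (Set.range (R.P.obj F))) : 0 ≤ R.gap F :=
  sub_nonneg.2 (ciInf_le hbdd R.x₀)

section Rate

variable {Ξ : Type u} {H : Type v} {Ω : Type w} {d p : ℕ} [MeasurableSpace Ξ]
  [MeasurableSpace H] {R : Run Ξ H Ω d p}
  {full : Option (Batches Ξ H)} {D : Measure Ξ} {Q : Measure H} {lf Lf lg Lg : ℝ≥0}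

theorem continuous_gradMap {F r : Vec d → ℝ} {lam : ℝ} (hl : 0 < lam)
    (hr : ConvexOn ℝ Set.univ r) (hF : Continuous (gradient F)) :
    Continuous (gradMap lam F r) :=
  (continuous_id.sub ((continuous_prox hr hl).comp
    (continuous_id.sub (hF.const_smul lam)))).const_smul (1 / lam)

theorem sum_lintegral_ofReal_le {α : Type*} [MeasurableSpace α] {ν : Measure α}
    [IsProbabilityMeasure ν] {ι : Type*} {I : Finset ι} {N E : ι → α → ℝ} {A c B : ℝ}
    (hN : ∀ i, Measurable (N i)) (hE : ∀ i, Measurable (E i)) (hN0 : ∀ i x, 0 ≤ N i x)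
    (hE0 : ∀ i x, 0 ≤ E i x) (hA : 0 ≤ A) (hc : 0 ≤ c) (hB : 0 ≤ B)
    (h : ∀ x, ∑ i ∈ I, N i x ≤ A + ∑ i ∈ I, c * E i x)
    (hEB : ∀ i, ∫⁻ x, ENNReal.ofReal (E i x) ∂ν ≤ ENNReal.ofReal B) :
    ∑ i ∈ I, ∫⁻ x, ENNReal.ofReal (N i x) ∂ν ≤ ENNReal.ofReal (A + I.card * (c * B)) := by
  rw [← lintegral_finsetSum _ fun i _ => (hN i).ennreal_ofReal]
  calc ∫⁻ x, ∑ i ∈ I, ENNReal.ofReal (N i x) ∂ν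
      ≤ ∫⁻ x, (ENNReal.ofReal A + ∑ i ∈ I, ENNReal.ofReal c * ENNReal.ofReal (E i x)) ∂ν := by
        refine lintegral_mono fun x => ?_
        have h0 : ∀ i, 0 ≤ c * E i x := fun i => mul_nonneg hc (hE0 i x)
        simp only [← ENNReal.ofReal_mul hc]
        rw [← ENNReal.ofReal_sum_of_nonneg fun i _ => hN0 i x,
          ← ENNReal.ofReal_sum_of_nonneg fun i _ => h0 i,
          ← ENNReal.ofReal_add hA (Finset.sum_nonneg fun i _ => h0 i)]
        exact ENNReal.ofReal_le_ofReal (h x)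
    _ = ENNReal.ofReal A
          + ∑ i ∈ I, ENNReal.ofReal c * ∫⁻ x, ENNReal.ofReal (E i x) ∂ν := by
        rw [lintegral_add_left measurable_const, lintegral_const, measure_univ, mul_one,
          lintegral_finsetSum _ fun i _ => (hE i).ennreal_ofReal.const_mul _]
        congr 1
        exact Finset.sum_congr rfl fun i _ => lintegral_const_mul _ (hE i).ennreal_ofReal
    _ ≤ ENNReal.ofReal A + ∑ i ∈ I, ENNReal.ofReal c * ENNReal.ofReal B := by
        gcongr with i
        exact hEB i
    _ = ENNReal.ofReal (A + I.card * (c * B)) := by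
        rw [Finset.sum_const, nsmul_eq_mul, ENNReal.ofReal_add hA (by positivity),
          ENNReal.ofReal_mul (by positivity), ENNReal.ofReal_mul hc, ENNReal.ofReal_natCast]

/-- Every direction error, weighted by 16, is replaced by its Young bound; the extra `16 * (3 / 2) =
24` raises 54 to 78. -/
theorem Run.sum_norm_gradMap_le_sqErr [IsProbabilityMeasure D] [IsProbabilityMeasure Q]
    (hA : R.P.Averages D Q) (hP : R.P.Regular (R.P.onlineF D Q) lf Lf lg Lg) {C : ℝ}
    (hstep : R.StepSizes C (LF lf Lf lg Lg)) (hε : 0 < R.ε) (hεl : R.ε ≤ lf * lg)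
    (hT : 2 ≤ R.T) (ω : Ω) :
    ∑ m ∈ Finset.range R.M, ∑ t ∈ Finset.range R.T,
      ‖gradMap (R.lam t) (R.P.onlineF D Q) R.P.r (zPoint t (R.state full m t ω))‖
      ≤ (4 * R.gap (R.P.onlineF D Q) / (R.β * R.ε) + (78 + 67 * C) * R.ε * R.T * R.M)
        + ∑ m ∈ Finset.range R.M, ∑ t ∈ Finset.range R.T,
          16 / R.ε * R.P.sqErr D Q lf Lf lg (R.state full m (t + 1) ω) := by
  have h := R.sum_norm_gradMap_le (hA.differentiable_onlineF hP) (LF_nonneg lf Lf lg Lg)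
    (hA.norm_gradient_onlineF_sub_le hP) hP.r_convex hP.obj_bdd hε hstep hT
    (R.selBatches full ω)
  have hiter : ∀ m t, iter R.P R.τ R.ε R.β R.lam (R.selBatches full ω m)
      (R.start (R.selBatches full ω) m) t = R.state full m t ω := fun _ _ => rfl
  simp only [Run.z, hiter] at h
  refine h.trans ?_
  generalize R.state full = σ
  have h2 : ∑ m ∈ Finset.range R.M, ∑ t ∈ Finset.range R.T,
      (σ m (t + 1) ω).err (R.P.onlineF D Q)
      ≤ ∑ m ∈ Finset.range R.M, ∑ t ∈ Finset.range R.T,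
        (R.P.sqErr D Q lf Lf lg (σ m (t + 1) ω) / R.ε + 3 / 2 * R.ε) :=
    Finset.sum_le_sum fun m _ => Finset.sum_le_sum fun t _ => hA.err_le hP hε hεl _
  have h3 : ∑ m ∈ Finset.range R.M, ∑ t ∈ Finset.range R.T,
        (R.P.sqErr D Q lf Lf lg (σ m (t + 1) ω) / R.ε + 3 / 2 * R.ε)
      = (∑ m ∈ Finset.range R.M, ∑ t ∈ Finset.range R.T,
        R.P.sqErr D Q lf Lf lg (σ m (t + 1) ω)) / R.ε + 3 / 2 * R.ε * R.T * R.M := by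
    simp only [Finset.sum_add_distrib, Finset.sum_const, Finset.card_range, nsmul_eq_mul,
      Finset.sum_div]
    ring
  have h4 : ∑ m ∈ Finset.range R.M, ∑ t ∈ Finset.range R.T,
        16 / R.ε * R.P.sqErr D Q lf Lf lg (σ m (t + 1) ω)
      = 16 * ((∑ m ∈ Finset.range R.M, ∑ t ∈ Finset.range R.T,
        R.P.sqErr D Q lf Lf lg (σ m (t + 1) ω)) / R.ε) := by
    simp only [← Finset.mul_sum]
    ring
  rw [h4]
  rw [h3] at h2
  linarith

variable [mΩ : MeasurableSpace Ω] {μ : Measure Ω} {lawA : (k : ℕ) → Measure (Fin k → Ξ)}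
  {lawB : (k : ℕ) → Measure (Fin k → H)}

/-- The output index takes countably many values, so the composed function is measurable; finiteness
of its lower integral then gives integrability, and the bound passes to the Bochner integral. -/
theorem Run.Sampled.integral_output_le (hS : R.Sampled μ lawA lawB) [IsProbabilityMeasure μ]
    (hM : 1 ≤ R.M) (hT : 1 ≤ R.T) {N : ℕ → ℕ → Ω → ℝ} (hN0 : ∀ m t ω, 0 ≤ N m t ω)
    (hN : ∀ m t, Measurable[R.past m t] (N m t)) {B : ℝ} (hB : 0 ≤ B)
    (h : ∑ m ∈ Finset.range R.M, ∑ t ∈ Finset.range R.T, ∫⁻ ω, ENNReal.ofReal (N m t ω) ∂μ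
      ≤ ENNReal.ofReal B) :
    Integrable (fun ω => N (R.δ ω) (R.ζ ω) ω) μ ∧
    ∫ ω, N (R.δ ω) (R.ζ ω) ω ∂μ ≤ (R.M * R.T : ℝ)⁻¹ * B := by
  have hM0 : (0 : ℝ) < R.M := by exact_mod_cast hM
  have hT0 : (0 : ℝ) < R.T := by exact_mod_cast hT
  have hm : Measurable fun ω => N (R.δ ω) (R.ζ ω) ω := by
    have h1 : Measurable fun q : Ω × (ℕ × ℕ) => N q.2.2 q.2.1 q.1 :=
      measurable_from_prod_countable_left fun y => (hN y.2 y.1).mono (hS.past_le y.2 y.1) le_rfl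
    exact h1.comp (g := fun q : Ω × (ℕ × ℕ) => N q.2.2 q.2.1 q.1)
      (f := fun ω => (ω, (R.ζ ω, R.δ ω))) (measurable_id.prodMk hS.out_meas)
  have hnn : ∀ ω, 0 ≤ N (R.δ ω) (R.ζ ω) ω := fun ω => hN0 _ _ _
  have hle : ∫⁻ ω, ENNReal.ofReal (N (R.δ ω) (R.ζ ω) ω) ∂μ
      ≤ ENNReal.ofReal ((R.M * R.T : ℝ)⁻¹ * B) := by
    rw [hS.lintegral_output_le hM hT (N := fun m t ω => ENNReal.ofReal (N m t ω))
      fun m t => ENNReal.measurable_ofReal.comp (hN m t),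
      ENNReal.ofReal_mul (by positivity), ENNReal.ofReal_inv_of_pos (by positivity),
      ENNReal.ofReal_mul (by positivity), ENNReal.ofReal_natCast, ENNReal.ofReal_natCast]
    gcongr
  have hint : Integrable (fun ω => N (R.δ ω) (R.ζ ω) ω) μ := by
    refine ⟨hm.aestronglyMeasurable, ?_⟩
    rw [hasFiniteIntegral_iff_ofReal (.of_forall hnn)]
    exact hle.trans_lt ENNReal.ofReal_lt_top
  refine ⟨hint, ?_⟩
  rw [← ofReal_integral_eq_lintegral_ofReal hint (.of_forall hnn)] at hle
  exact (ENNReal.ofReal_le_ofReal_iff (by positivity)).1 hle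

/-- The pathwise bound is integrated and divided by `MT`. Each squared error contributes `(16 / ε) *
(3C + 98C³) ε²`, which explains the form of `rateConst`. -/
theorem Run.Sampled.rate_of_moments (hS : R.Sampled μ lawA lawB) [IsProbabilityMeasure μ]
    [IsProbabilityMeasure D] [IsProbabilityMeasure Q] (hA : R.P.Averages D Q)
    (hP : R.P.Regular (R.P.onlineF D Q) lf Lf lg Lg) {C : ℝ} (hC : 1 ≤ C)
    (hstep : R.StepSizes C (LF lf Lf lg Lg)) (hε : 0 < R.ε) (hεl : R.ε ≤ lf * lg)
    (hM : 1 ≤ R.M) (hT : 2 ≤ R.T)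
    (hmom : ∀ m t, ∫⁻ ω, ENNReal.ofReal (R.P.sqErr D Q lf Lf lg (R.state full m (t + 1) ω)) ∂μ
      ≤ ENNReal.ofReal ((3 * C + 98 * C ^ 3) * R.ε ^ 2)) :
    Integrable (R.outNorm (R.P.onlineF D Q) (R.selBatches full)) μ ∧
    ∫ ω, R.outNorm (R.P.onlineF D Q) (R.selBatches full) ω ∂μ
      ≤ rateConst C * (R.ε + R.gap (R.P.onlineF D Q) / (R.β * R.ε * R.M * R.T)) := by
  have hl : ∀ t, 0 < R.lam t := fun t => hstep.β_pos.trans_le (hstep.lam_ge t)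
  have hβ := hstep.β_pos
  have hgap : 0 ≤ R.gap (R.P.onlineF D Q) := Run.gap_nonneg hP.obj_bdd
  have hM0 : (0 : ℝ) < R.M := by exact_mod_cast hM
  have hT0 : (0 : ℝ) < R.T := by exact_mod_cast (by omega : 0 < R.T)
  have hC0 : 0 ≤ C := by linarith
  have hgc : Continuous (gradient (R.P.onlineF D Q)) :=
    continuous_of_norm_sub_le (hA.norm_gradient_onlineF_sub_le hP)
  have hg : ∀ t, Measurable fun s : State d p =>
      ‖gradMap (R.lam t) (R.P.onlineF D Q) R.P.r (zPoint t s)‖ := fun t =>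
    (continuous_gradMap (hl t) hP.r_convex hgc).norm.measurable.comp (measurable_zPoint t)
  have hst := Run.measurable_state (full := full) hA hP hl
  have hdet := Run.sum_norm_gradMap_le_sqErr (full := full) hA hP hstep hε hεl hT
  have hE := hA.measurable_sqErr hP
  have hout : R.outNorm (R.P.onlineF D Q) (R.selBatches full) = fun ω =>
      ‖gradMap (R.lam (R.ζ ω)) (R.P.onlineF D Q) R.P.r
        (zPoint (R.ζ ω) (R.state full (R.δ ω) (R.ζ ω) ω))‖ := rfl
  rw [hout]
  have hgap' := hgap
  revert hst hdet hmom hgap'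
  generalize R.state full = σ, R.gap (R.P.onlineF D Q) = γ
  intro hmom hst hdet hγ
  set A := 4 * γ / (R.β * R.ε) + (78 + 67 * C) * R.ε * R.T * R.M with hAdef
  have hA0 : 0 ≤ A := by positivity
  have hstm : ∀ m t, Measurable (σ m t) := fun m t => (hst m t).mono (hS.past_le m t) le_rfl
  have hsum := sum_lintegral_ofReal_le (ν := μ) (I := Finset.range R.M ×ˢ Finset.range R.T)
    (N := fun i ω => ‖gradMap (R.lam i.2) (R.P.onlineF D Q) R.P.r (zPoint i.2 (σ i.1 i.2 ω))‖)
    (E := fun i ω => R.P.sqErr D Q lf Lf lg (σ i.1 (i.2 + 1) ω)) (A := A) (c := 16 / R.ε)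
    (fun i => (hg i.2).comp (hstm i.1 i.2)) (fun i => hE.comp (hstm i.1 (i.2 + 1)))
    (fun i ω => norm_nonneg _) (fun i ω => Problem.sqErr_nonneg _) hA0 (by positivity)
    (by positivity) (fun ω => by rw [Finset.sum_product, Finset.sum_product]; exact hdet ω)
    (fun i => hmom i.1 i.2)
  rw [Finset.sum_product, Finset.card_product, Finset.card_range, Finset.card_range] at hsum
  have hfin := hS.integral_output_le hM (by omega)
    (N := fun m t ω => ‖gradMap (R.lam t) (R.P.onlineF D Q) R.P.r (zPoint t (σ m t ω))‖)
    (fun m t ω => norm_nonneg _) (fun m t => (hg t).comp (hst m t)) (by positivity) hsum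
  refine ⟨hfin.1, hfin.2.trans ?_⟩
  have e1 : (R.M * R.T : ℝ)⁻¹
      * (A + (R.M * R.T : ℕ) * (16 / R.ε * ((3 * C + 98 * C ^ 3) * R.ε ^ 2)))
      = 4 * (γ / (R.β * R.ε * R.M * R.T)) + rateConst C * R.ε := by
    rw [hAdef, rateConst]
    push_cast
    field_simp
    ring
  rw [e1, mul_add]
  have h4 := four_le_rateConst hC
  have h5 : 0 ≤ γ / (R.β * R.ε * R.M * R.T) := by positivity
  nlinarith

/-- The convergence rate, given the second moments of the errors at the restarts. -/
theorem Run.Sampled.rate (hS : R.Sampled μ lawA lawB) [IsProbabilityMeasure μ]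
    [IsProbabilityMeasure D] [IsProbabilityMeasure Q] (hA : R.P.Averages D Q)
    (hP : R.P.Regular (R.P.onlineF D Q) lf Lf lg Lg) {C : ℝ} (hC : 1 ≤ C)
    (hstep : R.StepSizes C (LF lf Lf lg Lg)) (hε : 0 < R.ε) (hεl : R.ε ≤ lf * lg)
    (hM : 1 ≤ R.M) (hT : 2 ≤ R.T) (hτ : 1 ≤ R.τ)
    (hlA : ∀ t, IsSamplingLaw D (lawA (R.a t))) (hlJ : ∀ t, IsSamplingLaw D (lawA (R.aJ t)))
    (hlB : ∀ t, IsSamplingLaw Q (lawB (R.b t)))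
    (ha : ∀ t, t % R.τ ≠ 0 → IsOfOrder C R.τ (R.a t))
    (haJ : ∀ t, t % R.τ ≠ 0 → IsOfOrder C R.τ (R.aJ t))
    (hb : ∀ t, t % R.τ ≠ 0 → IsOfOrder C R.τ (R.b t))
    (hrestart : ∀ t, t % R.τ = 0 → ∀ s,
      ∫⁻ q, ENNReal.ofReal (R.P.sqErr D Q lf Lf lg (R.next full t (s, q)))
        ∂((lawA (R.a t)).prod ((lawA (R.aJ t)).prod (lawB (R.b t))))
        ≤ ENNReal.ofReal (3 * C * R.ε ^ 2)) :
    Integrable (R.outNorm (R.P.onlineF D Q) (R.selBatches full)) μ ∧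
    ∫ ω, R.outNorm (R.P.onlineF D Q) (R.selBatches full) ω ∂μ
      ≤ rateConst C * (R.ε + R.gap (R.P.onlineF D Q) / (R.β * R.ε * R.M * R.T)) := by
  have hC0 : 0 ≤ C := by linarith
  have hτ0 : (0 : ℝ) < R.τ := by exact_mod_cast hτ
  have hinv : ∀ k, IsOfOrder C R.τ k → (k : ℝ)⁻¹ ≤ C / R.τ := by
    intro k hk
    have hk0 : (0 : ℝ) < k := by exact_mod_cast hk.pos
    rw [inv_eq_one_div, div_le_div_iff₀ hk0 hτ0]
    linarith [hk.lower]
  refine hS.rate_of_moments hA hP hC hstep hε hεl hM hT fun m t => ?_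
  have hmom := hS.lintegral_sqErr_le (full := full) hA hP hstep hε.le (c₀ := 3 * C * R.ε ^ 2)
    (c₁ := 2 * (C / R.τ) * LF lf Lf lg Lg ^ 2) (by positivity) (by positivity) hrestart
    (fun t ht s => by
      have h := hA.lintegral_sqErr_step_le (τ := R.τ) (ε := R.ε) (β := R.β) (lam := R.lam) hP
        (hlA t) (hlJ t) (hlB t) (ha t ht).pos (haJ t ht).pos (hb t ht).pos ht
        (hinv _ (ha t ht)) (hinv _ (haJ t ht)) (hinv _ (hb t ht)) s
      refine le_trans (le_of_eq ?_) h
      refine lintegral_congr fun q => ?_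
      rw [Run.next, if_neg ht]) m t
  refine hmom.trans (ENNReal.ofReal_le_ofReal ?_)
  have h1 : ((t % R.τ : ℕ) : ℝ) ≤ R.τ := by exact_mod_cast (Nat.mod_lt t hτ).le
  have h2 : ((t % R.τ : ℕ) : ℝ) * (2 * (C / R.τ) * LF lf Lf lg Lg ^ 2 * (7 * R.β * R.ε) ^ 2)
      ≤ R.τ * (2 * (C / R.τ) * LF lf Lf lg Lg ^ 2 * (7 * R.β * R.ε) ^ 2) := by
    gcongr
  -- The period cancels against the batch size: at most `τ` increments, each with variance of order
  -- `1 / τ`. The constant is `98 = 2 * 7 ^ 2`, and `β L_F ≤ C` turns `C` into `C ^ 3`.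
  have h3 : R.τ * (2 * (C / R.τ) * LF lf Lf lg Lg ^ 2 * (7 * R.β * R.ε) ^ 2)
      = 98 * C * R.ε ^ 2 * (R.β * LF lf Lf lg Lg) ^ 2 := by
    field_simp
    ring
  have h4 : (R.β * LF lf Lf lg Lg) ^ 2 ≤ C ^ 2 := by
    have := hstep.β_pos
    have := LF_nonneg lf Lf lg Lg
    gcongr
    exact hstep.β_le
  have h5 := mul_le_mul_of_nonneg_left h4 (by positivity : 0 ≤ 98 * C * R.ε ^ 2)
  nlinarith

end Rate

/-! ### The finite-sum problem -/

section Sum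

theorem integral_uniformOn_univ {n : ℕ} {V : Type*} [NormedAddCommGroup V] [NormedSpace ℝ V]
    [CompleteSpace V] (h : Fin n → V) :
    ∫ x, h x ∂(uniformOn (Set.univ : Set (Fin n))) = (n : ℝ)⁻¹ • ∑ x, h x := by
  rcases Nat.eq_zero_or_pos n with rfl | hn
  · simp [Measure.eq_zero_of_isEmpty]
  · have : Nonempty (Fin n) := ⟨⟨0, hn⟩⟩
    rw [integral_fintype Integrable.of_finite, Finset.smul_sum]
    refine Finset.sum_congr rfl fun x _ => ?_
    rw [measureReal_def, uniformOn_univ, Measure.count_singleton, Fintype.card_fin]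
    simp

theorem avg_full {n : ℕ} {V : Type*} [NormedAddCommGroup V] [NormedSpace ℝ V] [CompleteSpace V]
    (h : Fin n → V) :
    Batch.avg ⟨n, id⟩ h = ∫ x, h x ∂(uniformOn (Set.univ : Set (Fin n))) :=
  (integral_uniformOn_univ h).symm

variable {N n d p : ℕ}

/-- Through this identity the finite-sum problem inherits the whole analysis of expectations. -/
theorem Problem.sumF_eq_onlineF (P : Problem (Fin n) (Fin N) d p) :
    P.sumF = P.onlineF (uniformOn Set.univ) (uniformOn Set.univ) := by
  funext x
  simp only [Problem.sumF, Problem.onlineF, Problem.meanf, Problem.meang,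
    integral_uniformOn_univ, smul_eq_mul]

theorem Problem.averages_uniformOn (P : Problem (Fin n) (Fin N) d p) (hN : 1 ≤ N) (hn : 1 ≤ n) :
    P.Averages (uniformOn Set.univ) (uniformOn Set.univ) := by
  have : Nonempty (Fin N) := ⟨⟨0, hN⟩⟩
  have : Nonempty (Fin n) := ⟨⟨0, hn⟩⟩
  exact ⟨fun _ => measurable_of_countable _, fun _ => measurable_of_countable _,
    fun _ => Integrable.of_finite, fun _ => Integrable.of_finite⟩

theorem Scheme.law_eq_zero_or_prob (S : Scheme) (n k : ℕ) :
    S.law n k = 0 ∨ IsProbabilityMeasure (S.law n k) := by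
  have key : ∀ s : Set (Fin k → Fin n), uniformOn s = 0 ∨ IsProbabilityMeasure (uniformOn s) := by
    intro s
    rcases s.eq_empty_or_nonempty with rfl | hs
    · exact Or.inl uniformOn_empty_meas
    · exact Or.inr (isProbabilityMeasure_uniformOn (Set.toFinite s) hs)
  cases S
  · exact key _
  · exact key _

/-- A sampling law here is zero or a probability measure. It cannot be zero, since the product of
the three laws is the law of a random variable; this excludes batches larger than the population
without replacement. -/
theorem Run.Sampled.isSamplingLaw {Ω : Type w} [MeasurableSpace Ω] {μ : Measure Ω}
    [IsProbabilityMeasure μ] {R : Run (Fin n) (Fin N) Ω d p} {S : Scheme} (hN : 1 ≤ N)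
    (hn : 1 ≤ n) (hS : R.Sampled μ (S.law n) (S.law N)) (t : ℕ) :
    IsSamplingLaw (uniformOn (Set.univ : Set (Fin n))) (S.law n (R.a t)) ∧
    IsSamplingLaw (uniformOn (Set.univ : Set (Fin n))) (S.law n (R.aJ t)) ∧
    IsSamplingLaw (uniformOn (Set.univ : Set (Fin N))) (S.law N (R.b t)) := by
  have hp : IsProbabilityMeasure (μ.map (R.drawn 0 t)) :=
    Measure.isProbabilityMeasure_map (hS.measurable_drawn 0 t).aemeasurable
  rw [hS.map_drawn] at hp
  have hne := hp.ne_zero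
  rcases S.law_eq_zero_or_prob n (R.a t) with h1 | h1
  · exact absurd (by rw [h1, Measure.zero_prod]) hne
  rcases S.law_eq_zero_or_prob N (R.b t) with h3 | h3
  · exact absurd (by rw [h3, Measure.prod_zero, Measure.prod_zero]) hne
  rcases S.law_eq_zero_or_prob n (R.aJ t) with h2 | h2
  · exact absurd (by rw [h2, Measure.zero_prod, Measure.prod_zero]) hne
  exact ⟨S.isSamplingLaw hn h1, S.isSamplingLaw hn h2, S.isSamplingLaw hN h3⟩

/-- A full batch computes each average exactly; `g̃` is then `g(z)`, and the gradient estimate is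
exact at that very point. -/
theorem sqErr_step_full {P : Problem (Fin n) (Fin N) d p} {F : Vec d → ℝ} {lf Lf lg Lg : ℝ≥0}
    (hN : 1 ≤ N) (hn : 1 ≤ n) (hP : P.Regular F lf Lf lg Lg) {τ : ℕ} {ε β : ℝ} {lam : ℕ → ℝ}
    {t : ℕ} (ht : t % τ = 0) (s : State d p) :
    P.sqErr (uniformOn Set.univ) (uniformOn Set.univ) lf Lf lg
      (step P τ ε β lam t ⟨⟨n, id⟩, ⟨n, id⟩, ⟨N, id⟩⟩ s) = 0 := by
  have : Nonempty (Fin N) := ⟨⟨0, hN⟩⟩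
  have : Nonempty (Fin n) := ⟨⟨0, hn⟩⟩
  have hA := P.averages_uniformOn hN hn
  have e1 : (step P τ ε β lam t ⟨⟨n, id⟩, ⟨n, id⟩, ⟨N, id⟩⟩ s).gEst
      = P.meang (uniformOn Set.univ) (zPoint t s) := by
    simp only [step, if_pos ht]
    exact avg_full _
  have e2 : (step P τ ε β lam t ⟨⟨n, id⟩, ⟨n, id⟩, ⟨N, id⟩⟩ s).jEst
      = fderiv ℝ (P.meang (uniformOn Set.univ)) (zPoint t s) := by
    rw [hA.fderiv_meang hP]
    simp only [step, if_pos ht]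
    exact avg_full _
  have e3 : (step P τ ε β lam t ⟨⟨n, id⟩, ⟨n, id⟩, ⟨N, id⟩⟩ s).fEst
      = gradient (P.meanf (uniformOn Set.univ)) (P.meang (uniformOn Set.univ) (zPoint t s)) := by
    rw [step_fEst_of_eq ht, e1, hA.gradient_meanf hP]
    exact avg_full _
  rw [Problem.sqErr, e1, e2, e3, step_z]
  simp [frobNorm]

theorem IsSumRun.rate {Ω : Type w} [MeasurableSpace Ω] {μ : Measure Ω} [IsProbabilityMeasure μ]
    {R : Run (Fin n) (Fin N) Ω d p} {S : Scheme} {C : ℝ} {lf Lf lg Lg : ℝ≥0} (hC : 1 ≤ C)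
    (h : IsSumRun μ R S C lf Lf lg Lg) (hε : 0 < R.ε)
    (hεl : R.ε ≤ lf * lg) (hM : 1 ≤ R.M) (hT : 2 ≤ R.T) :
    Integrable (R.outNorm R.P.sumF R.sumBatches) μ ∧
    ∫ ω, R.outNorm R.P.sumF R.sumBatches ω ∂μ
      ≤ rateConst C * (R.ε + R.gap R.P.sumF / (R.β * R.ε * R.M * R.T)) := by
  have : Nonempty (Fin N) := ⟨⟨0, h.N_pos⟩⟩
  have : Nonempty (Fin n) := ⟨⟨0, h.n_pos⟩⟩
  have hP := h.regular
  rw [Problem.sumF_eq_onlineF] at hP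
  rw [Problem.sumF_eq_onlineF, Run.sumBatches_eq_selBatches]
  have hτ : 1 ≤ R.τ := by
    rw [h.period, Nat.one_le_iff_ne_zero, ← Nat.pos_iff_ne_zero, Nat.sqrt_pos]
    exact lt_max_of_lt_left h.N_pos
  have hlaw := fun t => h.sampled.isSamplingLaw h.N_pos h.n_pos t
  refine h.sampled.rate (R.P.averages_uniformOn h.N_pos h.n_pos) hP hC h.steps hε hεl hM hT hτ
    (fun t => (hlaw t).1) (fun t => (hlaw t).2.1) (fun t => (hlaw t).2.2)
    (fun t _ => h.a_size t) (fun t _ => h.aJ_size t) (fun t _ => h.b_size t) fun t ht s => ?_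
  have e : ∀ q, R.P.sqErr (uniformOn Set.univ) (uniformOn Set.univ) lf Lf lg
      (R.next (some ⟨⟨n, id⟩, ⟨n, id⟩, ⟨N, id⟩⟩) t (s, q)) = 0 := by
    intro q
    rw [Run.next, if_pos ht, Option.getD_some]
    exact sqErr_step_full h.N_pos h.n_pos hP ht s
  simp [e]

end Sum

/-! ### The online problem -/

theorem IsOnlineRun.rate {Ξ : Type u} {H : Type v} {Ω : Type w} {d p : ℕ} [MeasurableSpace Ξ]
    [MeasurableSpace H] [MeasurableSpace Ω] {D : Measure Ξ} [IsProbabilityMeasure D]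
    {Q : Measure H} [IsProbabilityMeasure Q] {μ : Measure Ω} [IsProbabilityMeasure μ]
    {R : Run Ξ H Ω d p} {C : ℝ} {lf Lf lg Lg : ℝ≥0} {σg σJ σf : ℝ} (hC : 1 ≤ C)
    (h : IsOnlineRun D Q μ R C lf Lf lg Lg σg σJ σf) (hε : 0 < R.ε) (hεl : R.ε ≤ lf * lg)
    (hM : 1 ≤ R.M) (hT : 2 ≤ R.T) :
    Integrable (R.outNorm (R.P.onlineF D Q) R.drawnBatches) μ ∧
    ∫ ω, R.outNorm (R.P.onlineF D Q) R.drawnBatches ω ∂μ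
      ≤ rateConst C * (R.ε + R.gap (R.P.onlineF D Q) / (R.β * R.ε * R.M * R.T)) := by
  rw [Run.drawnBatches_eq_selBatches]
  have hV := h.variance
  have hA : R.P.Averages D Q := ⟨hV.f_meas, hV.g_meas, hV.f_int, hV.g_int⟩
  have hτ : 1 ≤ R.τ := by
    rw [h.period, Nat.one_le_floor_iff, one_le_div hε]
    exact hεl
  refine h.sampled.rate hA h.regular hC h.steps hε hεl hM hT hτ
    (fun t => isSamplingLaw_pi D _) (fun t => isSamplingLaw_pi D _)
    (fun t => isSamplingLaw_pi Q _)
    (fun t ht => by simpa only [if_neg ht] using h.a_size t)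
    (fun t ht => by simpa only [if_neg ht] using h.aJ_size t)
    (fun t ht => by simpa only [if_neg ht] using h.b_size t) fun t ht s => ?_
  have hbound := hA.lintegral_sqErr_restart_le (τ := R.τ) (ε := R.ε) (β := R.β) (lam := R.lam)
    h.regular (isSamplingLaw_pi D (R.a t)) (isSamplingLaw_pi D (R.aJ t))
    (isSamplingLaw_pi Q (R.b t)) (h.a_size t).pos (h.aJ_size t).pos (h.b_size t).pos ht hV s
  have e : ∀ q, R.next none t (s, q) = step R.P R.τ R.ε R.β R.lam t (tripleBatches q) s := by
    intro q
    rw [Run.next, if_pos ht, Option.getD_none]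
  simp only [e]
  refine hbound.trans (ENNReal.ofReal_le_ofReal ?_)
  -- The restart batches are sized so that each of the three weighted variances is at most `C ε²`;
  -- hence the `3C`.
  have key : ∀ (X : ℝ) (k : ℕ), IsOfOrder C ⌈X / R.ε ^ 2⌉₊ k → (k : ℝ)⁻¹ * X ≤ C * R.ε ^ 2 := by
    intro X k hk
    have hk0 : (0 : ℝ) < k := by exact_mod_cast hk.pos
    have h1 := (Nat.le_ceil (X / R.ε ^ 2)).trans hk.lower
    rw [div_le_iff₀ (by positivity)] at h1
    rw [inv_mul_le_iff₀ hk0]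
    linarith
  have k1 := key _ _ (by simpa only [if_pos ht] using h.a_size t)
  have k2 := key _ _ (by simpa only [if_pos ht] using h.aJ_size t)
  have k3 := key _ _ (by simpa only [if_pos ht] using h.b_size t)
  linarith

/-! ### Sample complexity -/

section Complexity

/-- Running at `ε / (2K)` makes the first term of the rate `ε / 2`. The second is `2K²γ / (βεT²)`,
at most `ε / 2` once `4K²γ ≤ β (Tε)²`; this follows from `Tε ≥ s` and `s² ≥ s ≥ 4K²Δ/β`. -/
theorem accuracy_of_rate {K Δ β ε s γ E : ℝ} {T : ℕ} (hK : 0 < K) (hβ : 0 < β) (hε : 0 < ε)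
    (hγ : γ ≤ Δ) (hs : 1 ≤ s) (hsΔ : 4 * K ^ 2 * Δ / β ≤ s)
    (hT : T = ⌈s / ε⌉₊)
    (hE : E ≤ K * (ε / (2 * K) + γ / (β * (ε / (2 * K)) * T * T))) : E ≤ ε := by
  have hTs : s / ε ≤ T := hT ▸ Nat.le_ceil _
  have hT0 : (0 : ℝ) < T := lt_of_lt_of_le (by positivity) hTs
  have h1 : s ≤ T * ε := (div_le_iff₀ hε).1 hTs
  have h2 : s ^ 2 ≤ (T * ε) ^ 2 := by gcongr
  have h3 : 4 * K ^ 2 * γ ≤ s * β := by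
    rw [div_le_iff₀ hβ] at hsΔ
    exact (by gcongr : 4 * K ^ 2 * γ ≤ 4 * K ^ 2 * Δ).trans hsΔ
  have h4 : 4 * K ^ 2 * γ ≤ (T * ε) ^ 2 * β :=
    h3.trans (by gcongr; nlinarith)
  have h5 : K * (γ / (β * (ε / (2 * K)) * T * T)) ≤ ε / 2 := by
    have e : K * (γ / (β * (ε / (2 * K)) * T * T)) = 2 * K ^ 2 * γ / (β * ε * T ^ 2) := by
      field_simp
    rw [e, div_le_iff₀ (by positivity)]
    nlinarith
  have e : K * (ε / (2 * K)) = ε / 2 := by field_simp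
  rw [mul_add, e] at hE
  linarith

/-- Division by `τ` is injective on the restart times. -/
theorem card_filter_mod_le (T τ : ℕ) :
    ((Finset.range T).filter fun t => t % τ = 0).card ≤ T / τ + 1 := by
  rw [← Finset.card_range (T / τ + 1)]
  refine Finset.card_le_card_of_injOn (fun t => t / τ) (fun t ht => ?_) fun t ht t' ht' h => ?_
  · simp only [Finset.coe_filter, Finset.mem_range, Set.mem_ofPred_eq] at ht
    simp only [Finset.coe_range, Set.mem_Iio]
    exact Nat.lt_succ_of_le (Nat.div_le_div_right ht.1.le)
  · simp only [Finset.coe_filter, Finset.mem_range, Set.mem_ofPred_eq] at ht ht' h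
    rw [← Nat.div_add_mod t τ, ← Nat.div_add_mod t' τ, ht.2, ht'.2, h]

theorem Run.evals_le {Ξ : Type u} {H : Type v} {Ω : Type w} {d p : ℕ} {R : Run Ξ H Ω d p}
    {b : ℕ → ℕ → Batches Ξ H} {X Y : ℝ} (hX0 : 0 ≤ X) (hY0 : 0 ≤ Y)
    (hX : ∀ m t, t % R.τ = 0 → ((b m t).size : ℝ) ≤ X)
    (hY : ∀ m t, t % R.τ ≠ 0 → ((b m t).size : ℝ) ≤ Y) :
    (R.evals b : ℝ) ≤ R.M * ((R.T / R.τ + 1) * X + 2 * R.T * Y) := by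
  have h1 : ∀ m t, (((if t % R.τ = 0 then 1 else 2) * (b m t).size : ℕ) : ℝ)
      ≤ (if t % R.τ = 0 then X else 0) + 2 * Y := by
    intro m t
    by_cases h : t % R.τ = 0
    · simp only [if_pos h, one_mul]
      linarith [hX m t h]
    · simp only [if_neg h]
      push_cast
      linarith [hY m t h]
  have h2 : ∑ t ∈ Finset.range R.T, ((if t % R.τ = 0 then X else 0) + 2 * Y)
      ≤ (R.T / R.τ + 1) * X + 2 * R.T * Y := by
    rw [Finset.sum_add_distrib, ← Finset.sum_filter, Finset.sum_const, Finset.sum_const,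
      Finset.card_range, nsmul_eq_mul, nsmul_eq_mul]
    have h3 : ((((Finset.range R.T).filter fun t => t % R.τ = 0).card : ℕ) : ℝ)
        ≤ (R.T : ℝ) / R.τ + 1 :=
      (by exact_mod_cast card_filter_mod_le R.T R.τ :
        ((((Finset.range R.T).filter fun t => t % R.τ = 0).card : ℕ) : ℝ)
          ≤ ((R.T / R.τ : ℕ) : ℝ) + 1).trans (add_le_add_left Nat.cast_div_le 1)
    have h4 := mul_le_mul_of_nonneg_right h3 hX0
    linarith
  rw [Run.evals, Nat.cast_sum]
  calc ∑ m ∈ Finset.range R.M, ((∑ t ∈ Finset.range R.T,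
        (if t % R.τ = 0 then 1 else 2) * (b m t).size : ℕ) : ℝ)
      ≤ ∑ m ∈ Finset.range R.M, ((R.T / R.τ + 1) * X + 2 * R.T * Y) := by
        refine Finset.sum_le_sum fun m _ => ?_
        rw [Nat.cast_sum]
        exact (Finset.sum_le_sum fun t _ => h1 m t).trans h2
    _ = _ := by rw [Finset.sum_const, Finset.card_range, nsmul_eq_mul]

theorem ceil_div_le {s ε c : ℝ} (hε : 0 < ε) (hεc : ε ≤ c) (hs : c ≤ s) :
    (⌈s / ε⌉₊ : ℝ) ≤ 2 * s / ε := by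
  have h1 : 1 ≤ s / ε := (one_le_div hε).2 (hεc.trans hs)
  have h2 := (Nat.ceil_lt_add_one (zero_le_one.trans h1)).le
  have e : 2 * s / ε = s / ε + s / ε := by ring
  linarith

theorem two_le_ceil_div {s ε : ℝ} (hε : 0 < ε) (hs : ε < s) : 2 ≤ ⌈s / ε⌉₊ := by
  have h : ((1 : ℕ) : ℝ) < s / ε := by rw [Nat.cast_one, one_lt_div hε]; exact hs
  exact Nat.lt_ceil.2 h

/-- With `q = √max(N, n)`, both the periodic restarts and the other iterations cost a multiple of `q
/ ε²`. The initial full batch of each run costs order `q² / ε` in total, absorbed by `εq < l`. The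
summand `N + n` is slack. -/
theorem IsSumRun.evals_le {N n d p : ℕ} {Ω : Type w} [MeasurableSpace Ω] {μ : Measure Ω}
    {R : Run (Fin n) (Fin N) Ω d p} {S : Scheme} {C : ℝ} {lf Lf lg Lg : ℝ≥0} (hC : 1 ≤ C)
    (h : IsSumRun μ R S C lf Lf lg Lg) {ε s l : ℝ} (hε : 0 < ε)
    (hεl : ε < l / Real.sqrt (max N n : ℕ)) (hs : l ≤ s)
    (hM : R.M = ⌈s / ε⌉₊) (hT : R.T = ⌈s / ε⌉₊) (ω : Ω) :
    (R.evals (R.sumBatches ω) : ℝ)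
      ≤ (24 * s ^ 2 + 6 * s * l + 24 * C * s ^ 2)
        * (N + n + Real.sqrt (max N n : ℕ) / ε ^ 2) := by
  set q := Real.sqrt (max N n : ℕ) with hq
  have hmax1 : 1 ≤ max N n := le_max_of_le_left h.N_pos
  have hq1 : 1 ≤ q := by
    rw [hq, Real.one_le_sqrt]
    exact_mod_cast hmax1
  have hq0 : 0 < q := by linarith
  have hqq : q ^ 2 = (max N n : ℕ) := Real.sq_sqrt (Nat.cast_nonneg _)
  have hτq : (R.τ : ℝ) ≤ q := by rw [h.period]; exact Real.nat_sqrt_le_real_sqrt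
  have hτ1 : 1 ≤ R.τ := by
    rw [h.period, Nat.one_le_iff_ne_zero, ← Nat.pos_iff_ne_zero, Nat.sqrt_pos]
    exact hmax1
  have hτ1' : (1 : ℝ) ≤ R.τ := by exact_mod_cast hτ1
  -- Rounding down the root loses at most a factor 2, as the period is at least 1.
  have hqτ : q ≤ 2 * R.τ := by
    have := Real.real_sqrt_lt_nat_sqrt_succ (a := max N n)
    rw [← h.period] at this
    linarith
  have hqε : ε * q < l := (lt_div_iff₀ hq0).1 hεl
  have hl0 : 0 < l := lt_trans (by positivity) hqε
  have hεl' : ε ≤ l := by nlinarith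
  have hs0 : 0 < s := by linarith
  have hMT : (⌈s / ε⌉₊ : ℝ) ≤ 2 * s / ε := ceil_div_le hε hεl' hs
  have hsz : ∀ k, IsOfOrder C R.τ k → (k : ℝ) ≤ C * q := fun k hk =>
    hk.upper.trans (by
      rw [max_eq_left hτ1']
      gcongr)
  have hb := Run.evals_le (R := R) (b := R.sumBatches ω) (X := 3 * q ^ 2) (Y := 3 * (C * q))
    (by positivity) (by positivity)
    (fun m t ht => by
      simp only [Run.sumBatches, if_pos ht, Batches.size]
      have h1 : (n : ℝ) ≤ q ^ 2 := by rw [hqq]; exact_mod_cast le_max_right N n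
      have h2 : (N : ℝ) ≤ q ^ 2 := by rw [hqq]; exact_mod_cast le_max_left N n
      push_cast
      linarith)
    (fun m t ht => by
      simp only [Run.sumBatches, if_neg ht, Batches.size, Run.drawnBatches]
      have h1 := hsz _ (h.a_size t)
      have h2 := hsz _ (h.aJ_size t)
      have h3 := hsz _ (h.b_size t)
      push_cast
      linarith)
  rw [hM, hT] at hb
  have hdiv : (⌈s / ε⌉₊ : ℝ) / R.τ ≤ 2 * (2 * s / ε) / q := by
    rw [div_le_div_iff₀ (by linarith) hq0]
    nlinarith [Nat.cast_nonneg (α := ℝ) ⌈s / ε⌉₊]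
  have hb2 : (R.evals (R.sumBatches ω) : ℝ)
      ≤ (2 * s / ε) * ((2 * (2 * s / ε) / q + 1) * (3 * q ^ 2)
        + 2 * (2 * s / ε) * (3 * (C * q))) := hb.trans (by gcongr)
  have e1 : (2 * s / ε) * ((2 * (2 * s / ε) / q + 1) * (3 * q ^ 2)
        + 2 * (2 * s / ε) * (3 * (C * q)))
      = (24 * s ^ 2 + 6 * s * (ε * q) + 24 * C * s ^ 2) * (q / ε ^ 2) := by
    field_simp
    ring
  rw [e1] at hb2
  refine hb2.trans ?_
  have : 0 ≤ q / ε ^ 2 := by positivity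
  gcongr
  have : (0 : ℝ) ≤ N + n := by positivity
  linarith

/-- There are order `ε⁻¹` runs. In each, order one restarts cost `ε⁻²` each, and order `ε⁻¹` other
iterations cost `ε⁻¹` each. -/
theorem IsOnlineRun.evals_le {Ξ : Type u} {H : Type v} {Ω : Type w} {d p : ℕ}
    [MeasurableSpace Ξ] [MeasurableSpace H] [MeasurableSpace Ω] {D : Measure Ξ}
    {Q : Measure H} {μ : Measure Ω} {R : Run Ξ H Ω d p} {C : ℝ} {lf Lf lg Lg : ℝ≥0}
    {σg σJ σf : ℝ} (hC : 1 ≤ C)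
    (h : IsOnlineRun D Q μ R C lf Lf lg Lg σg σJ σf) {ε s K l : ℝ} (hl : l = lf * lg)
    (hK : 1 ≤ K) (hε : 0 < ε) (hεl : ε ≤ l) (hs : l ≤ s) (hRε : R.ε = ε / K)
    (hM : R.M = ⌈s / ε⌉₊) (hT : R.T = ⌈s / ε⌉₊) (ω : Ω) :
    (R.evals (R.drawnBatches ω) : ℝ)
      ≤ 2 * s * ((4 * s / (l * K) + 1) * (C * (K ^ 2 * ((Lf : ℝ) ^ 2 * (lg : ℝ) ^ 2 * σg ^ 2
        + (lf : ℝ) ^ 2 * σJ ^ 2 + (lg : ℝ) ^ 2 * σf ^ 2) + 3 * l ^ 2))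
        + 12 * s * (C * (l * K))) / ε ^ 3 := by
  have hl0 : 0 < l := hε.trans_le hεl
  have hs0 : 0 < s := by linarith
  set V := K ^ 2 * ((Lf : ℝ) ^ 2 * (lg : ℝ) ^ 2 * σg ^ 2
        + (lf : ℝ) ^ 2 * σJ ^ 2 + (lg : ℝ) ^ 2 * σf ^ 2) + 3 * l ^ 2 with hV
  have hV0 : 0 ≤ V := by positivity
  set c := l * K with hc
  have hc0 : 0 < c := by positivity
  have hτ : R.τ = ⌊c / ε⌋₊ := by
    rw [h.period, hRε, hc, hl]
    congr 1
    field_simp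
  have hc1 : 1 ≤ c / ε := by
    rw [one_le_div hε]
    nlinarith
  have hτ1 : 1 ≤ R.τ := by rw [hτ]; exact (Nat.one_le_floor_iff _).2 hc1
  have hτ1' : (1 : ℝ) ≤ R.τ := by exact_mod_cast hτ1
  have hτc : (R.τ : ℝ) ≤ c / ε := by rw [hτ]; exact Nat.floor_le (by positivity)
  have hcτ : c / ε ≤ 2 * R.τ := by
    have := Nat.lt_floor_add_one (c / ε)
    rw [← hτ] at this
    linarith
  have hMT : (⌈s / ε⌉₊ : ℝ) ≤ 2 * s / ε := ceil_div_le hε hεl hs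
  have hsz : ∀ k, IsOfOrder C R.τ k → (k : ℝ) ≤ C * (c / ε) := fun k hk =>
    hk.upper.trans (by
      rw [max_eq_left hτ1']
      gcongr)
  -- Running at `ε / K` produces the factor `K ^ 2`; the summand `l ^ 2 / ε ^ 2 ≥ 1` absorbs the
  -- rounding and the maximum with 1.
  have hsz0 : ∀ (X : ℝ) (k : ℕ), 0 ≤ X → IsOfOrder C ⌈X / R.ε ^ 2⌉₊ k →
      (k : ℝ) ≤ C * ((K ^ 2 * X + l ^ 2) / ε ^ 2) := by
    intro X k hX hk
    refine hk.upper.trans ?_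
    gcongr
    have e : X / R.ε ^ 2 = K ^ 2 * X / ε ^ 2 := by
      rw [hRε]
      field_simp
    have h0 : 0 ≤ K ^ 2 * X / ε ^ 2 := by positivity
    have h1 : 1 ≤ l ^ 2 / ε ^ 2 := by
      rw [one_le_div (by positivity)]
      gcongr
    have h2 := (Nat.ceil_lt_add_one h0).le
    rw [add_div, e]
    exact max_le (by linarith) (by linarith)
  have hb := Run.evals_le (R := R) (b := R.drawnBatches ω) (X := C * V / ε ^ 2)
    (Y := 3 * (C * (c / ε))) (by positivity) (by positivity)
    (fun m t ht => by
      simp only [Batches.size, Run.drawnBatches]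
      have h1 := hsz0 ((Lf : ℝ) ^ 2 * (lg : ℝ) ^ 2 * σg ^ 2) _ (by positivity)
        (by simpa only [if_pos ht] using h.a_size t)
      have h2 := hsz0 ((lf : ℝ) ^ 2 * σJ ^ 2) _ (by positivity)
        (by simpa only [if_pos ht] using h.aJ_size t)
      have h3 := hsz0 ((lg : ℝ) ^ 2 * σf ^ 2) _ (by positivity)
        (by simpa only [if_pos ht] using h.b_size t)
      have e : C * V / ε ^ 2
          = C * ((K ^ 2 * ((Lf : ℝ) ^ 2 * (lg : ℝ) ^ 2 * σg ^ 2) + l ^ 2) / ε ^ 2)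
          + C * ((K ^ 2 * ((lf : ℝ) ^ 2 * σJ ^ 2) + l ^ 2) / ε ^ 2)
          + C * ((K ^ 2 * ((lg : ℝ) ^ 2 * σf ^ 2) + l ^ 2) / ε ^ 2) := by
        rw [hV]
        ring
      push_cast
      linarith)
    (fun m t ht => by
      simp only [Batches.size, Run.drawnBatches]
      have h1 := hsz _ (by simpa only [if_neg ht] using h.a_size t)
      have h2 := hsz _ (by simpa only [if_neg ht] using h.aJ_size t)
      have h3 := hsz _ (by simpa only [if_neg ht] using h.b_size t)
      push_cast
      linarith)
  rw [hM, hT] at hb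
  have hdiv : (⌈s / ε⌉₊ : ℝ) / R.τ ≤ 4 * s / c := by
    have h1 : (⌈s / ε⌉₊ : ℝ) / R.τ ≤ (2 * s / ε) / (c / (2 * ε)) := by
      gcongr
      rw [mul_comm 2 ε, ← div_div]
      linarith
    refine h1.trans (le_of_eq ?_)
    field_simp
    norm_num
  have hb2 : (R.evals (R.drawnBatches ω) : ℝ)
      ≤ (2 * s / ε) * ((4 * s / c + 1) * (C * V / ε ^ 2)
        + 2 * (2 * s / ε) * (3 * (C * (c / ε)))) := hb.trans (by gcongr)
  refine hb2.trans (le_of_eq ?_)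
  field_simp
  ring

end Complexity

end MVRC

end

/-! ### Choice of the constants. -/

theorem mainTheorem7 (C : ℝ) (hC : 1 ≤ C) :
    ∃ K : ℝ, 1 ≤ K ∧
      -- finite-sum problem: convergence rate
      (∀ (lf Lf lg Lg : ℝ≥0) (N n d p : ℕ) (Ω : Type w) [MeasurableSpace Ω]
        (μ : Measure Ω) [IsProbabilityMeasure μ] (R : MVRC.Run (Fin n) (Fin N) Ω d p)
        (S : MVRC.Scheme),
        MVRC.IsSumRun μ R S C lf Lf lg Lg →
        0 < R.ε → R.ε < lf * lg / Real.sqrt (max N n : ℕ) →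
        1 ≤ R.M → 2 ≤ R.T →
        Integrable (R.outNorm R.P.sumF R.sumBatches) μ ∧
        ∫ ω, R.outNorm R.P.sumF R.sumBatches ω ∂μ
          ≤ K * (R.ε + R.gap R.P.sumF / (R.β * R.ε * R.M * R.T))) ∧
      -- online problem: convergence rate
      (∀ (lf Lf lg Lg : ℝ≥0) (σg σJ σf : ℝ) (d p : ℕ) (Ξ : Type u) (H : Type v) (Ω : Type w)
        [MeasurableSpace Ξ] [MeasurableSpace H] [MeasurableSpace Ω]
        (D : Measure Ξ) [IsProbabilityMeasure D] (Q : Measure H) [IsProbabilityMeasure Q]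
        (μ : Measure Ω) [IsProbabilityMeasure μ] (R : MVRC.Run Ξ H Ω d p),
        MVRC.IsOnlineRun D Q μ R C lf Lf lg Lg σg σJ σf →
        0 < R.ε → R.ε ≤ lf * lg →
        1 ≤ R.M → 2 ≤ R.T →
        Integrable (R.outNorm (R.P.onlineF D Q) R.drawnBatches) μ ∧
        ∫ ω, R.outNorm (R.P.onlineF D Q) R.drawnBatches ω ∂μ
          ≤ K * (R.ε + R.gap (R.P.onlineF D Q) / (R.β * R.ε * R.M * R.T))) ∧
      -- finite-sum problem: sample complexity with `M = T = O(1 / ε)`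
      (∀ (lf Lf lg Lg : ℝ≥0) (β Δ : ℝ), ∃ s K₁ : ℝ, 0 < s ∧ 0 < K₁ ∧
        ∀ (N n d p : ℕ) (Ω : Type w) [MeasurableSpace Ω]
          (μ : Measure Ω) [IsProbabilityMeasure μ] (R : MVRC.Run (Fin n) (Fin N) Ω d p)
          (S : MVRC.Scheme) (ε : ℝ),
          MVRC.IsSumRun μ R S C lf Lf lg Lg →
          R.β = β → R.gap R.P.sumF ≤ Δ →
          0 < ε → ε < lf * lg / Real.sqrt (max N n : ℕ) →
          R.ε = ε / K → R.M = ⌈s / ε⌉₊ → R.T = ⌈s / ε⌉₊ →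
          Integrable (R.outNorm R.P.sumF R.sumBatches) μ ∧
          ∫ ω, R.outNorm R.P.sumF R.sumBatches ω ∂μ ≤ ε ∧
          ∀ ω, (R.evals (R.sumBatches ω) : ℝ)
            ≤ K₁ * (N + n + Real.sqrt (max N n : ℕ) / ε ^ 2)) ∧
      -- online problem: sample complexity with `M = T = O(1 / ε)`
      (∀ (lf Lf lg Lg : ℝ≥0) (σg σJ σf β Δ : ℝ), ∃ s K₁ : ℝ, 0 < s ∧ 0 < K₁ ∧
        ∀ (d p : ℕ) (Ξ : Type u) (H : Type v) (Ω : Type w)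
          [MeasurableSpace Ξ] [MeasurableSpace H] [MeasurableSpace Ω]
          (D : Measure Ξ) [IsProbabilityMeasure D] (Q : Measure H) [IsProbabilityMeasure Q]
          (μ : Measure Ω) [IsProbabilityMeasure μ] (R : MVRC.Run Ξ H Ω d p) (ε : ℝ),
          MVRC.IsOnlineRun D Q μ R C lf Lf lg Lg σg σJ σf →
          R.β = β → R.gap (R.P.onlineF D Q) ≤ Δ →
          0 < ε → ε ≤ lf * lg →
          R.ε = ε / K → R.M = ⌈s / ε⌉₊ → R.T = ⌈s / ε⌉₊ →
          Integrable (R.outNorm (R.P.onlineF D Q) R.drawnBatches) μ ∧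
          ∫ ω, R.outNorm (R.P.onlineF D Q) R.drawnBatches ω ∂μ ≤ ε ∧
          ∀ ω, (R.evals (R.drawnBatches ω) : ℝ) ≤ K₁ / ε ^ 3) := by
  have hK4 := MVRC.four_le_rateConst hC
  set K₀ := MVRC.rateConst C with hK₀
  have hK0 : 0 < K₀ := by linarith
  have hK1 : 1 ≤ 2 * K₀ := by linarith
  have hweak : ∀ {E ε γ β : ℝ} {M T : ℕ}, 0 < ε → 0 ≤ γ → 0 < β →
      E ≤ K₀ * (ε + γ / (β * ε * M * T)) → E ≤ 2 * K₀ * (ε + γ / (β * ε * M * T)) := by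
    intro E ε γ β M T hε hγ hβ hE
    refine hE.trans ?_
    have : 0 ≤ ε + γ / (β * ε * M * T) := by positivity
    gcongr
    linarith
  have hεl_sum : ∀ {l ε : ℝ} {N n : ℕ}, 1 ≤ N → 0 < ε → ε < l / Real.sqrt (max N n : ℕ) →
      ε ≤ l := by
    intro l ε N n hN hε h
    have hq : 1 ≤ Real.sqrt (max N n : ℕ) := by
      rw [Real.one_le_sqrt]
      exact_mod_cast le_max_of_le_left hN
    have := (lt_div_iff₀ (by linarith)).1 h
    nlinarith
  have hdiv : ∀ {ε : ℝ}, 0 < ε → ε / (2 * K₀) ≤ ε := fun h => div_le_self h.le hK1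
  -- `K₀` already suffices for the rate. It is doubled so that running at `ε / K` leaves half of the
  -- target accuracy for the gap term.
  refine ⟨2 * K₀, hK1, ?_, ?_, ?_, ?_⟩
  · intro lf Lf lg Lg N n d p Ω _ μ _ R S h hε hεl hM hT
    have hr := h.rate hC hε (hεl_sum h.N_pos hε hεl) hM hT
    exact ⟨hr.1, hweak hε (MVRC.Run.gap_nonneg h.regular.obj_bdd) h.steps.β_pos hr.2⟩
  · intro lf Lf lg Lg σg σJ σf d p Ξ H Ω _ _ _ D _ Q _ μ _ R h hε hεl hM hT
    have hr := h.rate hC hε hεl hM hT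
    exact ⟨hr.1, hweak hε (MVRC.Run.gap_nonneg h.regular.obj_bdd) h.steps.β_pos hr.2⟩
  · intro lf Lf lg Lg β Δ
    -- The summands ensure, in turn, `s ≥ 1`, `s ≥ l_f l_g ≥ ε` (with the first, `s > ε` and so `T ≥
    -- 2`), and `s ≥ 4K₀²Δ/β`. The absolute value keeps `s` positive for arbitrary `Δ` and `β`.
    set s : ℝ := 1 + lf * lg + |4 * K₀ ^ 2 * Δ / β| with hs
    have hl0 : (0 : ℝ) ≤ lf * lg := by positivity
    have habs := abs_nonneg (4 * K₀ ^ 2 * Δ / β)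
    have hs0 : 0 < s := by linarith
    refine ⟨s, 24 * s ^ 2 + 6 * s * (lf * lg) + 24 * C * s ^ 2, hs0, by positivity, ?_⟩
    intro N n d p Ω _ μ _ R S ε h hβ hΔ hε hεl hRε hM hT
    have hεl' := hεl_sum h.N_pos hε hεl
    have h2 : 2 ≤ ⌈s / ε⌉₊ := MVRC.two_le_ceil_div hε (by linarith)
    have hr := h.rate hC (by rw [hRε]; positivity) (by rw [hRε]; exact (hdiv hε).trans hεl')
      (by omega) (by omega)
    refine ⟨hr.1, ?_, h.evals_le hC hε hεl (by linarith) hM hT⟩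
    have hβ0 := h.steps.β_pos
    rw [hβ] at hβ0
    have hr2 := hr.2
    rw [hRε, hβ, hM, hT] at hr2
    exact MVRC.accuracy_of_rate hK0 hβ0 hε hΔ (by linarith)
      (by linarith [le_abs_self (4 * K₀ ^ 2 * Δ / β)]) rfl hr2
  · intro lf Lf lg Lg σg σJ σf β Δ
    set s : ℝ := 1 + lf * lg + |4 * K₀ ^ 2 * Δ / β| with hs
    have hl0 : (0 : ℝ) ≤ lf * lg := by positivity
    have habs := abs_nonneg (4 * K₀ ^ 2 * Δ / β)
    have hs0 : 0 < s := by linarith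
    -- The evaluation bound plus 1: the bound itself may be zero when the Lipschitz constants
    -- vanish, while `K₁` must be positive.
    refine ⟨s, _, hs0, lt_of_le_of_lt ?_ (lt_add_one (2 * s * ((4 * s / (lf * lg * (2 * K₀)) + 1)
      * (C * ((2 * K₀) ^ 2 * ((Lf : ℝ) ^ 2 * (lg : ℝ) ^ 2 * σg ^ 2 + (lf : ℝ) ^ 2 * σJ ^ 2
        + (lg : ℝ) ^ 2 * σf ^ 2) + 3 * (lf * lg) ^ 2))
      + 12 * s * (C * (lf * lg * (2 * K₀)))))), ?_⟩
    · positivity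
    intro d p Ξ H Ω _ _ _ D _ Q _ μ _ R ε h hβ hΔ hε hεl hRε hM hT
    have h2 : 2 ≤ ⌈s / ε⌉₊ := MVRC.two_le_ceil_div hε (by linarith)
    have hr := h.rate hC (by rw [hRε]; positivity) (by rw [hRε]; exact (hdiv hε).trans hεl)
      (by omega) (by omega)
    refine ⟨hr.1, ?_, fun ω => (h.evals_le hC rfl hK1 hε hεl (by linarith) hRε hM hT ω).trans
      (by gcongr; linarith)⟩
    have hβ0 := h.steps.β_pos
    rw [hβ] at hβ0
    have hr2 := hr.2
    rw [hRε, hβ, hM, hT] at hr2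
    exact MVRC.accuracy_of_rate hK0 hβ0 hε hΔ (by linarith)
      (by linarith [le_abs_self (4 * K₀ ^ 2 * Δ / β)]) rfl hr2
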